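/- Let $N$ be a simply connected nilpotent Lie group of dimension $n\ge 1$, and let $\mathrm{Aff}(N)$ be the group of all maps $x\mapsto A(x)c$ with $A$ an automorphism of the Lie group $N$ and $c\in N$. Let $\Gamma\subset \mathrm{Aff}(N)$ be a subgroup which acts freely and properly discontinuously on $N$ with compact quotient, and in which the subgroup $\Lambda$ of all right translations $x\mapsto xc$ belonging to $\Gamma$ has finite index. Let $\widehat M=N/\Gamma$ be the resulting $n$-dimensional infranil manifold (for $N=\mathbb R^n$ these are the compact flat manifolds), with the Riemannian distance induced by a smooth $\Gamma$-invariant Riemannian metric on $N$ (for example the average over the finite group $\Gamma/\Lambda$ of a right-invariant metric). Let $\widehat{\mathcal C}$ be the set of all self-maps $\hat\rho$ of $\widehat M$ induced by automorphisms $R$ of the Lie group $N$ such that - $R$ preserves the $\Gamma$-action, i.e. for all $x\in N$, $\gamma\in\Gamma$ there is $\gamma'\in\Gamma$ with $R(\gamma x)=\gamma' R(x)$, and - the linear automorphism $\bar R$ induced by $R$ on the vector group $N/[N,N]\cong\mathbb R^d$, i.e. the linear lift of the endomorphism induced by $R$ on the torus $N/([N,N]\Lambda)$, is semisimple and has no complex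 eigenvalue of absolute value $1$. Then there are a real number $\nu$ with $0<\nu\le 1/2$ and a set $\widehat S\subset\widehat M$ such that: 1. $\widehat S$ is exceptional relative to $\widehat{\mathcal C}$: it is nonempty, and for every $\hat\rho\in\widehat{\mathcal C}$ and $x\in\widehat S$ the closure of $\{\hat\rho^k(x): k\ge 0\}$ contains no $\hat\rho$-periodic point; 2. $\widehat S$ is $\alpha$-winning for every $\alpha\in(0,\nu]$; 3. $\widehat S\cap U$ has Hausdorff dimension $n$ for every nonempty open $U\subset\widehat M$. Here a subset $S$ of a complete metric space is $\alpha$-winning if for every $\beta\in(0,1)$ the player $\mathcal A$ has a winning strategy in the following (Schmidt) game: $\mathcal B$ chooses a closed ball $B_0$ of some radius $r>0$; then, for $k=0,1,2,\dots$, $\mathcal A$ chooses a closed ball $A_{k+1}\subset B_k$ of radius $\alpha(\alpha\beta)^k r$ and $\mathcal B$ chooses a closed ball $B_{k+1}\subset A_{k+1}$ of radius $(\alpha\beta)^{k+1}r$; $\mathcal A$ wins if the unique point of $\bigcap_k A_k$ lies in $S$. -/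

import Mathlib

open Manifold Bundle Set Topology
open scoped ContDiff ENNReal

noncomputable section

/-! ### Exceptional sets and the Schmidt game -/

/-- A nonempty set `S` is exceptional relative to a collection `C` of self-maps if, for `f ∈ C` and
`x ∈ S`, the closure of the forward `f`-orbit of `x` contains no `f`-periodic point. -/
def IsExceptional {X : Type*} [TopologicalSpace X] (C : Set (X → X)) (S : Set X) : Prop :=
  S.Nonempty ∧ ∀ f ∈ C, ∀ x ∈ S, ∀ y ∈ closure (range fun k : ℕ => f^[k] x),
    y ∉ Function.periodicPts f

/-- `(α, β)`-winning sets of the Schmidt game. Bob's `k`-th ball has centre `b k` and radius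
`(α * β) ^ k * r`; Alice answers with a ball of radius `α * ((α * β) ^ k * r)`, whose centre her
strategy `σ` computes from the initial radius and the centres `b 0, …, b k`. Alice has to move
legally as long as Bob did, and in every infinite legal play the single common point of her balls
has to lie in `S`. -/
def IsAlphaBetaWinning {X : Type*} [MetricSpace X] (α β : ℝ) (S : Set X) : Prop :=
  ∃ σ : ℝ → (k : ℕ) → (Fin (k + 1) → X) → X, ∀ r : ℝ, 0 < r → ∀ b : ℕ → X,
    let B : ℕ → Set X := fun k => Metric.closedBall (b k) ((α * β) ^ k * r)
    let A : ℕ → Set X := fun k =>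
      Metric.closedBall (σ r k fun i => b i) (α * ((α * β) ^ k * r))
    (∀ k, (∀ j < k, B (j + 1) ⊆ A j) → A k ⊆ B k) ∧
      ((∀ j, B (j + 1) ⊆ A j) → ∃ x ∈ S, ⋂ k, A k = {x})

/-- `α`-winning sets of the Schmidt game. -/
def IsAlphaWinning {X : Type*} [MetricSpace X] (α : ℝ) (S : Set X) : Prop :=
  ∀ β : ℝ, 0 < β → β < 1 → IsAlphaBetaWinning α β S

/-! ### The distance on a quotient by a group of isometries -/

section OrbitDistance

variable {G X : Type*} [Group G] [PseudoEMetricSpace X] [MulAction G X]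

/-- The distance between two orbits. -/
def orbitEDist (a b : MulAction.orbitRel.Quotient G X) : ℝ≥0∞ :=
  ⨅ (x : X) (_ : (Quotient.mk _ x : MulAction.orbitRel.Quotient G X) = a)
    (y : X) (_ : (Quotient.mk _ y : MulAction.orbitRel.Quotient G X) = b), edist x y

theorem orbitEDist_le (x y : X) :
    orbitEDist (Quotient.mk _ x : MulAction.orbitRel.Quotient G X) (Quotient.mk _ y)
      ≤ edist x y :=
  iInf_le_of_le x <| iInf_le_of_le rfl <| iInf_le_of_le y <| iInf_le_of_le rfl le_rfl

theorem orbitEDist_lt_iff [IsIsometricSMul G X] (x : X) (b : MulAction.orbitRel.Quotient G X)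
    (c : ℝ≥0∞) : orbitEDist (Quotient.mk _ x) b < c ↔
      ∃ y : X, (Quotient.mk _ y : MulAction.orbitRel.Quotient G X) = b ∧ edist x y < c := by
  constructor
  · intro h
    simp only [orbitEDist, iInf_lt_iff] at h
    obtain ⟨x', hx', y, hy, h⟩ := h
    obtain ⟨γ, rfl⟩ := Quotient.exact hx'
    refine ⟨γ⁻¹ • y, ?_, ?_⟩
    · rw [MulAction.orbitRel.Quotient.quotient_smul_eq, hy]
    · rwa [← edist_smul_left γ, smul_inv_smul]
  · rintro ⟨y, rfl, h⟩
    exact (orbitEDist_le x y).trans_lt h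

theorem orbitEDist_self (a : MulAction.orbitRel.Quotient G X) : orbitEDist a a = 0 := by
  induction a using Quotient.inductionOn with
  | h x => exact le_antisymm ((orbitEDist_le x x).trans (edist_self x).le) bot_le

theorem orbitEDist_comm (a b : MulAction.orbitRel.Quotient G X) :
    orbitEDist a b = orbitEDist b a := by
  have H : ∀ a b : MulAction.orbitRel.Quotient G X, orbitEDist a b ≤ orbitEDist b a := by
    intro a b
    simp only [orbitEDist, le_iInf_iff]
    rintro x rfl y rfl
    rw [edist_comm]
    exact orbitEDist_le y x
  exact le_antisymm (H a b) (H b a)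

theorem orbitEDist_triangle [IsIsometricSMul G X] (a b c : MulAction.orbitRel.Quotient G X) :
    orbitEDist a c ≤ orbitEDist a b + orbitEDist b c := by
  induction a using Quotient.inductionOn with
  | h x =>
    apply le_of_forall_gt (fun r hr => ?_)
    obtain ⟨u, hu, v, hv, huv⟩ := ENNReal.exists_add_lt_of_add_lt hr
    obtain ⟨y, rfl, hy⟩ := (orbitEDist_lt_iff x b u).1 hu
    obtain ⟨z, rfl, hz⟩ := (orbitEDist_lt_iff y c v).1 hv
    exact (orbitEDist_le x z).trans_lt (((edist_triangle x y z).trans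
      (add_le_add hy.le hz.le)).trans_lt huv)

theorem nhds_hasBasis_orbitEDist [IsIsometricSMul G X] (a : MulAction.orbitRel.Quotient G X) :
    (𝓝 a).HasBasis (fun c : ℝ≥0∞ => 0 < c) (fun c => {b | orbitEDist a b < c}) := by
  induction a using Quotient.inductionOn with
  | h x =>
    have hq : IsOpenQuotientMap (Quotient.mk (MulAction.orbitRel G X)) :=
      MulAction.isOpenQuotientMap_quotientMk
    have h1 : 𝓝 (Quotient.mk (MulAction.orbitRel G X) x)
        = Filter.map (Quotient.mk (MulAction.orbitRel G X)) (𝓝 x) :=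
      (hq.map_nhds_eq x).symm
    rw [h1]
    refine ((Metric.nhds_basis_eball (x := x)).map _).to_hasBasis ?_ ?_
    all_goals
      intro c hc
      refine ⟨c, hc, fun b hb => ?_⟩
    · obtain ⟨y, rfl, hy⟩ := (orbitEDist_lt_iff x b c).1 hb
      exact ⟨y, by rwa [Metric.mem_eball, edist_comm], rfl⟩
    · obtain ⟨y, hy, rfl⟩ := hb
      exact (orbitEDist_lt_iff x _ c).2 ⟨y, rfl, by rwa [edist_comm, ← Metric.mem_eball]⟩

end OrbitDistance

/-! ### Affine transformations of a Lie group and infranil manifolds -/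

section Infranil

variable (n : ℕ) {N : Type*} [TopologicalSpace N] [ChartedSpace (EuclideanSpace ℝ (Fin n)) N]
  [Group N]

/-- Automorphisms of the Lie group `N`: smooth group automorphisms with smooth inverse. -/
def IsLieAut (A : N ≃* N) : Prop :=
  ContMDiff (𝓡 n) (𝓡 n) ∞ A ∧ ContMDiff (𝓡 n) (𝓡 n) ∞ A.symm

variable (N) in
/-- The group of affine transformations of `N`, generated by the right translations and the
automorphisms; its elements are the maps `x ↦ A x * c` with `A` an automorphism and `c ∈ N`. -/
def affineGroup : Subgroup (Equiv.Perm N) where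
  carrier := {γ | ∃ A : N ≃* N, IsLieAut n A ∧ ∃ c : N, ∀ x, γ x = A x * c}
  one_mem' := ⟨MulEquiv.refl N, ⟨contMDiff_id, contMDiff_id⟩, 1, fun x => by simp⟩
  mul_mem' := by
    rintro γ δ ⟨A, hA, c, hc⟩ ⟨B, hB, d, hd⟩
    exact ⟨B.trans A, ⟨hA.1.comp hB.1, hB.2.comp hA.2⟩, A d * c, fun x => by
      simp [hc, hd, mul_assoc]⟩
  inv_mem' := by
    rintro γ ⟨A, hA, c, hc⟩
    refine ⟨A.symm, ⟨hA.2, hA.1⟩, A.symm c⁻¹, fun x => ?_⟩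
    rw [Equiv.Perm.inv_eq_iff_eq, hc]
    simp

variable (N) in
/-- The group of right translations of `N`. -/
def rightTranslations : Subgroup (Equiv.Perm N) where
  carrier := {γ | ∃ c : N, ∀ x, γ x = x * c}
  one_mem' := ⟨1, fun x => by simp⟩
  mul_mem' := by
    rintro γ δ ⟨c, hc⟩ ⟨d, hd⟩
    exact ⟨d * c, fun x => by simp [hc, hd, mul_assoc]⟩
  inv_mem' := by
    rintro γ ⟨c, hc⟩
    refine ⟨c⁻¹, fun x => ?_⟩
    rw [Equiv.Perm.inv_eq_iff_eq, hc]
    simp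

/-- The orbit space `N / Γ`. -/
abbrev InfranilManifold (Γ : Subgroup (Equiv.Perm N)) : Type _ :=
  MulAction.orbitRel.Quotient Γ N

/-- The groups `Γ` whose orbit space `N / Γ` is an infranil manifold: groups of affine
transformations acting freely, properly discontinuously and cocompactly on `N`, in which the right
translations form a subgroup of finite index. -/
structure IsInfranilGroup (Γ : Subgroup (Equiv.Perm N)) : Prop where
  affine : Γ ≤ affineGroup n N
  finiteIndex : ((rightTranslations N).subgroupOf Γ).FiniteIndex
  free : ∀ γ ∈ Γ, ∀ x : N, γ x = x → γ = 1
  properlyDiscontinuous : ProperlyDiscontinuousSMul Γ N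
  cocompact : CompactSpace (InfranilManifold Γ)

/-! ### The Riemannian distance on an infranil manifold -/

variable {n} [LieGroup (𝓡 n) ∞ N]

/-- The isometry condition `φ^* g = g`, for a differentiable map `φ : N → N`. -/
def PreservesMetric (g : ContMDiffRiemannianMetric (𝓡 n) ∞ (EuclideanSpace ℝ (Fin n))
    (fun x : N => TangentSpace (𝓡 n) x)) (φ : N → N) : Prop :=
  ∀ (x : N) (v w : TangentSpace (𝓡 n) x),
    g.inner (φ x) (mfderiv (𝓡 n) (𝓡 n) φ x v) (mfderiv (𝓡 n) (𝓡 n) φ x w) = g.inner x v w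

/-- The extended distance on `N` given by a Riemannian metric: the infimum of the lengths of
`C^1` paths. -/
@[reducible] def lieGroupEDist [T2Space N]
    (g : ContMDiffRiemannianMetric (𝓡 n) ∞ (EuclideanSpace ℝ (Fin n))
      (fun x : N => TangentSpace (𝓡 n) x)) : PseudoEMetricSpace N :=
  letI : RiemannianBundle (fun x : N => TangentSpace (𝓡 n) x) := ⟨g.toRiemannianMetric⟩
  haveI : IsTopologicalGroup N := topologicalGroup_of_lieGroup (𝓡 n) ∞
  haveI : IsManifold (𝓡 n) 1 N := IsManifold.of_le (n := ∞) (by simp)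
  haveI : IsContinuousRiemannianBundle (EuclideanSpace ℝ (Fin n))
      (fun x : N => TangentSpace (𝓡 n) x) :=
    ⟨g.inner, g.contMDiff.continuous, fun _ _ _ => rfl⟩
  PseudoEMetricSpace.ofRiemannianMetric (𝓡 n) N

theorem contMDiff_of_mem_affineGroup {γ : Equiv.Perm N} (hγ : γ ∈ affineGroup n N) :
    ContMDiff (𝓡 n) (𝓡 n) ∞ γ := by
  obtain ⟨A, hA, c, hc⟩ := hγ
  have : (γ : N → N) = fun x => A x * c := funext hc
  rw [this]
  exact hA.1.mul contMDiff_const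

theorem lieGroupEDist_map_le [T2Space N]
    (g : ContMDiffRiemannianMetric (𝓡 n) ∞ (EuclideanSpace ℝ (Fin n))
      (fun x : N => TangentSpace (𝓡 n) x)) (φ : N → N) (hφ : ContMDiff (𝓡 n) (𝓡 n) ∞ φ)
    (h : PreservesMetric g φ) (x y : N) :
    (lieGroupEDist g).edist (φ x) (φ y) ≤ (lieGroupEDist g).edist x y := by
  let _ : RiemannianBundle (fun x : N => TangentSpace (𝓡 n) x) := ⟨g.toRiemannianMetric⟩
  have _ : IsManifold (𝓡 n) 1 N := IsManifold.of_le (n := ∞) (by simp)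
  change riemannianEDist (𝓡 n) (φ x) (φ y) ≤ riemannianEDist (𝓡 n) x y
  apply le_of_forall_gt (fun r hr => ?_)
  obtain ⟨c, h0, h1, hc, hlen, -, -⟩ :=
    exists_lt_locally_constant_of_riemannianEDist_lt hr zero_lt_one
  have hφ1 : ContMDiff (𝓡 n) (𝓡 n) 1 φ := hφ.of_le (by simp)
  refine (riemannianEDist_le_pathELength (γ := φ ∘ c) (a := 0) (b := 1)
    (hφ1.comp hc).contMDiffOn (by simp [h0]) (by simp [h1]) zero_le_one).trans_lt ?_
  refine lt_of_eq_of_lt ?_ hlen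
  simp only [pathELength_eq_lintegral_mfderiv_Icc]
  refine MeasureTheory.lintegral_congr fun t => ?_
  rw [mfderiv_comp t (hφ1.mdifferentiable (by simp) _) (hc.mdifferentiable (by simp) _)]
  have key : ∀ (z : N) (v : TangentSpace (𝓡 n) z), ‖mfderiv (𝓡 n) (𝓡 n) φ z v‖ₑ = ‖v‖ₑ := by
    intro z v
    have : ‖mfderiv (𝓡 n) (𝓡 n) φ z v‖ = ‖v‖ := by
      rw [norm_eq_sqrt_real_inner, norm_eq_sqrt_real_inner]
      exact congrArg Real.sqrt (h z v v)
    rw [← ofReal_norm, ← ofReal_norm, this]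
  exact key (c t) _

theorem lieGroupEDist_smul [T2Space N] (Γ : Subgroup (Equiv.Perm N)) (hΓ : Γ ≤ affineGroup n N)
    (g : ContMDiffRiemannianMetric (𝓡 n) ∞ (EuclideanSpace ℝ (Fin n))
      (fun x : N => TangentSpace (𝓡 n) x)) (hg : ∀ γ ∈ Γ, PreservesMetric g γ) :
    letI := lieGroupEDist g
    IsIsometricSMul Γ N := by
  let _ := lieGroupEDist g
  refine ⟨fun γ x y => le_antisymm ?_ ?_⟩
  · exact lieGroupEDist_map_le g _ (contMDiff_of_mem_affineGroup (hΓ γ.2)) (hg γ γ.2) x y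
  · have := lieGroupEDist_map_le g _ (contMDiff_of_mem_affineGroup (hΓ (γ⁻¹).2))
      (hg _ (γ⁻¹).2) (γ • x) (γ • y)
    have e : ∀ z : N, ((γ⁻¹ : Γ) : Equiv.Perm N) (γ • z) = z := fun z => inv_smul_smul γ z
    rwa [e, e] at this

theorem lieGroupEDist_ne_top [T2Space N] [ConnectedSpace N]
    (g : ContMDiffRiemannianMetric (𝓡 n) ∞ (EuclideanSpace ℝ (Fin n))
      (fun x : N => TangentSpace (𝓡 n) x)) (x y : N) : (lieGroupEDist g).edist x y ≠ ⊤ := by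
  let _ := lieGroupEDist g
  have h : IsClopen (Metric.eball x ⊤) := ⟨Metric.isClosed_eball_top, Metric.isOpen_eball⟩
  have h' : Metric.eball x ⊤ = univ := h.eq_univ ⟨x, by simp⟩
  have : y ∈ Metric.eball x ⊤ := h' ▸ mem_univ y
  rw [Metric.mem_eball, edist_comm] at this
  exact this.ne

/-- The metric on `N / Γ` induced by a `Γ`-invariant Riemannian metric `g` on `N`: the Riemannian
distance for which `N → N / Γ` is a local isometry, that is, the distance between `Γ`-orbits. Its
topology is by construction the quotient topology. -/
@[reducible] def infranilMetric [T2Space N] [ConnectedSpace N] (Γ : Subgroup (Equiv.Perm N))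
    (hΓ : IsInfranilGroup n Γ)
    (g : ContMDiffRiemannianMetric (𝓡 n) ∞ (EuclideanSpace ℝ (Fin n))
      (fun x : N => TangentSpace (𝓡 n) x)) (hg : ∀ γ ∈ Γ, PreservesMetric g γ) :
    MetricSpace (InfranilManifold Γ) :=
  letI : PseudoEMetricSpace N := lieGroupEDist g
  haveI : IsIsometricSMul Γ N := lieGroupEDist_smul Γ hΓ.affine g hg
  letI : PseudoEMetricSpace (InfranilManifold Γ) :=
    PseudoEMetricSpace.ofEDistOfTopology orbitEDist orbitEDist_self orbitEDist_comm
      orbitEDist_triangle nhds_hasBasis_orbitEDist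
  haveI : LocallyCompactSpace N := ChartedSpace.locallyCompactSpace (EuclideanSpace ℝ (Fin n)) N
  haveI : ProperlyDiscontinuousSMul Γ N := hΓ.properlyDiscontinuous
  haveI : T2Space (InfranilManifold Γ) := t2Space_of_properlyDiscontinuousSMul_of_t2Space
  letI : EMetricSpace (InfranilManifold Γ) := EMetricSpace.ofT0PseudoEMetricSpace _
  EMetricSpace.toMetricSpace fun a b =>
    Quotient.inductionOn₂ a b fun x y =>
      ((orbitEDist_le x y).trans_lt (lieGroupEDist_ne_top g x y).lt_top).ne

/-! ### Endomorphisms of an infranil manifold -/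

variable (n)

/-- A linear endomorphism that is semisimple and has no complex eigenvalue on the unit circle. -/
def IsSemisimpleHyperbolic {V : Type*} [AddCommGroup V] [Module ℝ V] [Module.Free ℝ V]
    [Module.Finite ℝ V] (L : Module.End ℝ V) : Prop :=
  L.IsSemisimple ∧
    ∀ z : ℂ, (L.charpoly.map (algebraMap ℝ ℂ)).IsRoot z → ‖z‖ ≠ 1

/-- The condition on the torus endomorphism induced by an automorphism `R` of `N`. The
abelianization `N / [N, N]` is identified with some `ℝ^d` by a continuous surjective homomorphism
`p : N → ℝ^d` with kernel `[N, N]` (`p` is unique up to linear automorphisms of `ℝ^d`). The linear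
map `L` induced by `R` on `ℝ^d`, which is the lift of the torus endomorphism, has to be semisimple
without eigenvalues on the unit circle. -/
def HasHyperbolicAbelianization (R : N ≃* N) : Prop :=
  ∃ (d : ℕ) (p : N →* Multiplicative (EuclideanSpace ℝ (Fin d)))
    (L : Module.End ℝ (EuclideanSpace ℝ (Fin d))),
    Continuous (fun x => (p x).toAdd) ∧ Function.Surjective p ∧ p.ker = commutator N ∧
      (∀ x, (p (R x)).toAdd = L (p x).toAdd) ∧ IsSemisimpleHyperbolic L

/-- The endomorphisms of `N / Γ` induced by those automorphisms `R` of `N` which preserve the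
`Γ`-action and whose torus endomorphism is semisimple without eigenvalues on the unit circle. -/
def hyperbolicEndomorphisms (Γ : Subgroup (Equiv.Perm N)) :
    Set (InfranilManifold Γ → InfranilManifold Γ) :=
  {ρ | ∃ R : N ≃* N, IsLieAut n R ∧
    (∀ x : N, ∀ γ ∈ Γ, ∃ γ' ∈ Γ, R (γ x) = γ' (R x)) ∧
    HasHyperbolicAbelianization R ∧
    ∀ x : N, ρ (Quotient.mk _ x) = Quotient.mk _ (R x)}

end Infranil

end

/-! ### The Schmidt game -/

section Game

variable {X : Type*} [MetricSpace X]

/-! Everything is decided in the abelianization `V` of `N`. An endomorphism of the orbit space is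
covered by an automorphism `R`, which induces a linear map `L` on `V`, so that `P (R^k x) = L^k (P
x)` for the projection `P : N → V`. If the orbit of a point accumulates at the class of a periodic
`y`, then `L^k (P x)` comes arbitrarily close to the set `orbitValues P Γ v` with `v = P y`. Hence
it suffices to keep `L^k (P x)` away from these sets, for all `L` and `v` that occur.

Each such set lies in finitely many cosets of the image of the translation lattice. That image is
discrete (`finite_image_lattice_inter`, a form of Malcev's theorem), so the sets are uniformly
discrete. Only countably many pairs `(L, v)` occur: `L` is determined by its values on a finite
spanning set of lattice vectors, and periodicity puts `L^b v - L^a v` into the lattice for some `a <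
b`, where `L^b - L^a` is injective by hyperbolicity. Countable intersections of `α`-winning sets are
`α`-winning, so one pair may be treated at a time, provided that `α` does not depend on it.

For one pair (`isAlphaWinning_avoid`) a single eigenfunctional `φ` suffices, for an eigenvalue `lam`
of maximal modulus (`exists_dominant`); `‖lam‖ > 1` because the orbit of a nonzero lattice vector
stays in a uniformly discrete set and cannot tend to `0`. Semisimplicity gives `‖L^k‖ ≤ C ‖lam‖^k`.
So in a ball of radius at most a constant times `‖lam‖^(-k)` at most one forbidden point matters at
time `k`, and the bad points lie in a slab around a level of `Re φ`, of width proportional to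
`‖lam‖^(-k)`. Alice moves up or down along `Re φ`, away from the weighted majority of the slabs,
which halves their total weight `W`. For the weights `‖lam‖^(-e k)` with small `e`, the potential
`ρ^(-e) W` stays bounded, so no time remains dangerous as the radius `ρ` tends to `0`. The move
needs only a Lipschitz bound and an ascent estimate for `P`, uniform over all functionals of norm
one; this is why `ν` is uniform.

For the dimension, Bob is given `m^n` separated replies in each turn. The outcomes form a Cantor set
whose dimension tends to `n` as `m` grows. Nonemptiness follows from positive dimension. -/

theorem IsAlphaBetaWinning.mono {α β : ℝ} {S T : Set X} (h : IsAlphaBetaWinning α β S)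
    (hST : S ⊆ T) : IsAlphaBetaWinning α β T := by
  obtain ⟨σ, hσ⟩ := h
  refine ⟨σ, fun r hr b => ⟨(hσ r hr b).1, fun hb => ?_⟩⟩
  obtain ⟨x, hx, h⟩ := (hσ r hr b).2 hb
  exact ⟨x, hST hx, h⟩

theorem IsAlphaWinning.mono {α : ℝ} {S T : Set X} (h : IsAlphaWinning α S) (hST : S ⊆ T) :
    IsAlphaWinning α T :=
  fun β h0 h1 => (h β h0 h1).mono hST

/-- Strategies may be given as functions on infinite sequences that depend only on the moves made
so far. -/
theorem IsAlphaBetaWinning.of_nonanticipating {α β : ℝ} {S : Set X}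
    (τ : ℝ → ℕ → (ℕ → X) → X)
    (hτ : ∀ r k b b', (∀ j ≤ k, b j = b' j) → τ r k b = τ r k b')
    (H : ∀ r : ℝ, 0 < r → ∀ b : ℕ → X,
      (∀ k, (∀ j < k, Metric.closedBall (b (j + 1)) ((α * β) ^ (j + 1) * r) ⊆
          Metric.closedBall (τ r j b) (α * ((α * β) ^ j * r))) →
        Metric.closedBall (τ r k b) (α * ((α * β) ^ k * r)) ⊆
          Metric.closedBall (b k) ((α * β) ^ k * r)) ∧
      ((∀ j, Metric.closedBall (b (j + 1)) ((α * β) ^ (j + 1) * r) ⊆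
          Metric.closedBall (τ r j b) (α * ((α * β) ^ j * r))) →
        ∃ x ∈ S, ⋂ k, Metric.closedBall (τ r k b) (α * ((α * β) ^ k * r)) = {x})) :
    IsAlphaBetaWinning α β S := by
  refine ⟨fun r k h => τ r k fun j => h ⟨min j k, by omega⟩, fun r hr b => ?_⟩
  have e : ∀ k, (τ r k fun j => b (min j k)) = τ r k b := fun k =>
    hτ r k _ _ fun j hj => by rw [min_eq_left hj]
  simp only [e]
  exact H r hr b

/-- In a legal play with shrinking radii the balls of Alice meet in a single point. -/
theorem exists_iInter_closedBall_eq_singleton [CompleteSpace X] {a : ℕ → X} {ρ : ℕ → ℝ}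
    (hρ : Filter.Tendsto ρ Filter.atTop (𝓝 0)) (h0 : ∀ k, 0 ≤ ρ k)
    (hanti : ∀ k, Metric.closedBall (a (k + 1)) (ρ (k + 1)) ⊆ Metric.closedBall (a k) (ρ k)) :
    ∃ x, ⋂ k, Metric.closedBall (a k) (ρ k) = {x} := by
  have hA : Antitone fun k => Metric.closedBall (a k) (ρ k) := antitone_nat_of_succ_le hanti
  have hc : CauchySeq a := by
    refine cauchySeq_of_le_tendsto_0 (fun k => ρ k + ρ k) (fun n m N hn hm => ?_)
      (by simpa using hρ.add hρ)
    have h1 := hA hn (Metric.mem_closedBall_self (h0 n))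
    have h2 := hA hm (Metric.mem_closedBall_self (h0 m))
    rw [Metric.mem_closedBall] at h1 h2
    calc dist (a n) (a m) ≤ dist (a n) (a N) + dist (a m) (a N) := dist_triangle_right _ _ _
      _ ≤ ρ N + ρ N := add_le_add h1 h2
  obtain ⟨x, hx⟩ := cauchySeq_tendsto_of_complete hc
  have hxm : ∀ k, x ∈ Metric.closedBall (a k) (ρ k) := fun k =>
    Metric.isClosed_closedBall.mem_of_tendsto hx
      (Filter.eventually_atTop.2 ⟨k, fun m hm => hA hm (Metric.mem_closedBall_self (h0 m))⟩)
  refine ⟨x, Subset.antisymm (fun y hy => ?_) (by simpa using hxm)⟩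
  rw [mem_iInter] at hy
  rw [mem_singleton_iff, ← dist_le_zero]
  have h2 : Filter.Tendsto (fun k => ρ k + ρ k) Filter.atTop (𝓝 0) := by simpa using hρ.add hρ
  refine ge_of_tendsto h2 (Filter.Eventually.of_forall fun k => ?_)
  exact (dist_triangle_right y x (a k)).trans (add_le_add (hy k) (hxm k))

theorem tendsto_radius {α β : ℝ} (hα : 0 < α) (hα1 : α < 1) (hβ : 0 < β) (hβ1 : β < 1) (r : ℝ) :
    Filter.Tendsto (fun k : ℕ => (α * β) ^ k * r) Filter.atTop (𝓝 0) := by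
  have h : α * β < 1 := by nlinarith
  simpa using (tendsto_pow_atTop_nhds_zero_of_lt_one (by positivity) h).mul_const r

/-- A legal play of the Schmidt game in which Alice moves legally has exactly one outcome. -/
theorem exists_outcome [CompleteSpace X] {α β r : ℝ} (hα : 0 < α) (hα1 : α < 1) (hβ : 0 < β)
    (hβ1 : β < 1) (hr : 0 < r) {a b : ℕ → X}
    (hA : ∀ k, Metric.closedBall (a k) (α * ((α * β) ^ k * r)) ⊆
      Metric.closedBall (b k) ((α * β) ^ k * r))
    (hB : ∀ k, Metric.closedBall (b (k + 1)) ((α * β) ^ (k + 1) * r) ⊆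
      Metric.closedBall (a k) (α * ((α * β) ^ k * r))) :
    ∃ x, ⋂ k, Metric.closedBall (a k) (α * ((α * β) ^ k * r)) = {x} :=
  exists_iInter_closedBall_eq_singleton
    (by simpa using (tendsto_radius hα hα1 hβ hβ1 r).const_mul α) (fun k => by positivity)
    fun k => (hA (k + 1)).trans (hB k)

/-- Alice wins if she can maintain an invariant that forces the outcome into `S`, from the first
ball of radius at most `r₀` on. The invariant may depend on that ball and on the current ball. -/
theorem IsAlphaBetaWinning.of_invariant [CompleteSpace X] {α β : ℝ} (hα : 0 < α) (hα1 : α < 1)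
    (hβ : 0 < β) (hβ1 : β < 1) {S : Set X} {r₀ : ℝ} (hr₀ : 0 < r₀) (I : X → ℝ → X → ℝ → Prop)
    (base : ∀ b ρ, 0 < ρ → ρ ≤ r₀ → I b ρ b ρ)
    (step : ∀ b₀ ρ₀ b ρ, 0 < ρ₀ → 0 < ρ → I b₀ ρ₀ b ρ → ∃ a, dist a b ≤ (1 - α) * ρ ∧
      ∀ b', Metric.closedBall b' (α * β * ρ) ⊆ Metric.closedBall a (α * ρ) →
        I b₀ ρ₀ b' (α * β * ρ))
    (final : ∀ b₀ ρ₀ x (b : ℕ → X), 0 < ρ₀ → (∀ j, x ∈ Metric.closedBall (b j) ((α * β) ^ j * ρ₀)) →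
      (∀ j, I b₀ ρ₀ (b j) ((α * β) ^ j * ρ₀)) → x ∈ S) : IsAlphaBetaWinning α β S := by
  classical
  have hstart : ∀ r : ℝ, ∃ k : ℕ, (α * β) ^ k * r ≤ r₀ := fun r =>
    ((tendsto_radius hα hα1 hβ hβ1 r).eventually (gt_mem_nhds hr₀)).exists.imp fun _ h => h.le
  choose k₀ hk₀ using hstart
  choose! m hm hm' using step
  -- Before turn `k₀ r`, and whenever the invariant fails, Alice copies Bob's centre. This default
  -- keeps her moves legal in every play.
  let τ : ℝ → ℕ → (ℕ → X) → X := fun r k b =>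
    if k₀ r ≤ k ∧ I (b (k₀ r)) ((α * β) ^ k₀ r * r) (b k) ((α * β) ^ k * r) then
      m (b (k₀ r)) ((α * β) ^ k₀ r * r) (b k) ((α * β) ^ k * r) else b k
  have hαβ : 0 < α * β := by positivity
  refine .of_nonanticipating τ (fun r k b b' hb => ?_) fun r hr b => ?_
  · by_cases hk : k₀ r ≤ k
    · simp only [τ, hb _ hk, hb k le_rfl]
    · simp only [τ, hk, hb k le_rfl, false_and, if_false]
  have hpos : ∀ k : ℕ, 0 < (α * β) ^ k * r := fun k => by positivity
  have legal : ∀ k, Metric.closedBall (τ r k b) (α * ((α * β) ^ k * r)) ⊆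
      Metric.closedBall (b k) ((α * β) ^ k * r) := by
    intro k
    apply Metric.closedBall_subset_closedBall'
    by_cases h : k₀ r ≤ k ∧ I (b (k₀ r)) ((α * β) ^ k₀ r * r) (b k) ((α * β) ^ k * r)
    · have := hm _ _ _ _ (hpos (k₀ r)) (hpos k) h.2
      simp only [τ, if_pos h]
      linarith
    · simp only [τ, if_neg h, dist_self, add_zero]
      nlinarith [hpos k]
  refine ⟨fun k _ => legal k, fun hB => ?_⟩
  obtain ⟨x, hx⟩ := exists_outcome hα hα1 hβ hβ1 hr legal hB
  refine ⟨x, ?_, hx⟩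
  have hxm : ∀ k, x ∈ Metric.closedBall (b k) ((α * β) ^ k * r) := fun k =>
    legal k (mem_iInter.1 (hx.symm ▸ mem_singleton x) k)
  have hI : ∀ j, I (b (k₀ r)) ((α * β) ^ k₀ r * r) (b (k₀ r + j)) ((α * β) ^ (k₀ r + j) * r) := by
    intro j
    induction j with
    | zero => exact base _ _ (hpos _) (hk₀ r)
    | succ j ih =>
      have := hm' _ _ _ _ (hpos (k₀ r)) (hpos _) ih (b (k₀ r + j + 1))
      have e : α * β * ((α * β) ^ (k₀ r + j) * r) = (α * β) ^ (k₀ r + j + 1) * r := by ring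
      rw [e] at this
      apply this
      have h := hB (k₀ r + j)
      simp only [τ, if_pos (And.intro (Nat.le_add_right (k₀ r) j) ih)] at h
      exact h
  have e : ∀ j, (α * β) ^ (k₀ r + j) * r = (α * β) ^ j * ((α * β) ^ k₀ r * r) := fun j => by ring
  refine final (b (k₀ r)) ((α * β) ^ k₀ r * r) x (fun j => b (k₀ r + j)) (hpos _) (fun j => ?_) fun j => ?_
  · rw [← e]; exact hxm _
  · rw [← e]; exact hI j

theorem isAlphaWinning_univ [CompleteSpace X] {α : ℝ} (hα : 0 < α) (hα1 : α < 1) :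
    IsAlphaWinning α (univ : Set X) := fun β hβ hβ1 =>
  .of_invariant hα hα1 hβ hβ1 one_pos (fun _ _ _ _ => True) (fun _ _ _ _ => trivial)
    (fun _ _ b ρ _ hρ _ => ⟨b, by rw [dist_self]; exact mul_nonneg (by linarith) hρ.le,
      fun _ _ => trivial⟩) fun _ _ _ _ _ _ _ => mem_univ _

end Game

/-! ### Countable intersections of winning sets -/

section GameInter

variable {X : Type*} [MetricSpace X]

/-- The 2-adic valuation recovers the exponent. This splits the turns of a game into infinitely many
disjoint arithmetic progressions, one for each set to be hit. -/
theorem two_pow_mul_odd_injective {i j s t : ℕ} (h : 2 ^ i * (2 * s + 1) = 2 ^ j * (2 * t + 1)) :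
    i = j ∧ s = t := by
  have key : ∀ i s : ℕ, padicValNat 2 (2 ^ i * (2 * s + 1)) = i := fun i s => by
    rw [padicValNat.mul (by positivity) (by omega), padicValNat.prime_pow,
      padicValNat.eq_zero_of_not_dvd (by omega), add_zero]
  obtain rfl : i = j := by rw [← key i s, h, key]
  refine ⟨rfl, ?_⟩
  have := Nat.eq_of_mul_eq_mul_left (by positivity) h
  omega

/-- For each `α`, countable intersections of `α`-winning sets are `α`-winning. -/
theorem IsAlphaWinning.iInter [CompleteSpace X] {α : ℝ} (hα : 0 < α) (hα1 : α < 1)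
    {S : ℕ → Set X} (h : ∀ i, IsAlphaWinning α (S i)) : IsAlphaWinning α (⋂ i, S i) := by
  classical
  intro β hβ hβ1
  have hαβ : 0 < α * β := by positivity
  have hαβ1 : α * β < 1 := by nlinarith
  -- The set `S i` is treated in the turns `k` with `k + 1 = 2 ^ i * (2 * t + 1)`.
  let pos : ℕ → ℕ → ℕ := fun i t => 2 ^ i * (2 * t + 1) - 1
  have hpos1 : ∀ i t, pos i t + 1 = 2 ^ i * (2 * t + 1) := fun i t =>
    Nat.sub_add_cancel (Nat.one_le_iff_ne_zero.2 (by positivity))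
  have hpos_succ : ∀ i t, pos i (t + 1) = pos i t + 2 ^ (i + 1) := fun i t => by
    have h1 := hpos1 i (t + 1)
    have h2 := hpos1 i t
    have : 2 ^ i * (2 * (t + 1) + 1) = 2 ^ i * (2 * t + 1) + 2 ^ (i + 1) := by ring
    omega
  have hpos_t : ∀ i t, pos i t = pos i 0 + 2 ^ (i + 1) * t := fun i t => by
    induction t with
    | zero => simp
    | succ t ih => rw [hpos_succ, ih]; ring
  have hmono : ∀ i s t, s ≤ t → pos i s ≤ pos i t := fun i s t hst => by
    rw [hpos_t i s, hpos_t i t]; gcongr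
  have hex : ∀ k, ∃ i t, k = pos i t := fun k => by
    obtain ⟨i, m, ⟨t, rfl⟩, hk⟩ := Nat.exists_eq_two_pow_mul_odd (n := k + 1) (by omega)
    exact ⟨i, t, by have := hpos1 i t; omega⟩
  choose I T hIT using hex
  have hI : ∀ i t, I (pos i t) = i ∧ T (pos i t) = t := fun i t => by
    have h1 := hIT (pos i t)
    have h2 := hpos1 (I (pos i t)) (T (pos i t))
    rw [← h1, hpos1] at h2
    exact ⟨(two_pow_mul_odd_injective h2).1.symm, (two_pow_mul_odd_injective h2).2.symm⟩
  -- Consecutive turns devoted to `S i` are `2 ^ (i + 1)` turns apart. Bob's parameter in this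
  -- subgame is chosen so that the radii shrink by `α * B' i = (α * β) ^ 2 ^ (i + 1)`; all moves in
  -- between count as part of Bob's reply.
  let B' : ℕ → ℝ := fun i => (α * β) ^ 2 ^ (i + 1) / α
  have hB'0 : ∀ i, 0 < B' i := fun i => by positivity
  have hB'1 : ∀ i, B' i < 1 := fun i => by
    rw [div_lt_one hα]
    calc (α * β) ^ 2 ^ (i + 1) ≤ (α * β) ^ 1 :=
          pow_le_pow_of_le_one hαβ.le hαβ1.le Nat.one_le_two_pow
      _ < α := by rw [pow_one]; nlinarith
  have hB'α : ∀ i, α * B' i = (α * β) ^ 2 ^ (i + 1) := fun i => by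
    simp only [B']; field_simp
  choose σ hσ using fun i => h i (B' i) (hB'0 i) (hB'1 i)
  let τ : ℝ → ℕ → (ℕ → X) → X := fun r k b =>
    σ (I k) ((α * β) ^ pos (I k) 0 * r) (T k) fun j => b (pos (I k) j)
  refine .of_nonanticipating τ (fun r k b b' hb => ?_) fun r hr b => ?_
  · have : (fun j : Fin (T k + 1) => b (pos (I k) j)) = fun j : Fin (T k + 1) => b' (pos (I k) j) :=
      funext fun j => hb _ (by
        conv_rhs => rw [hIT k]
        exact hmono _ _ _ (Nat.lt_succ_iff.1 j.2))
    simp only [τ, this]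
  have hτ : ∀ i t, τ r (pos i t) b
      = σ i ((α * β) ^ pos i 0 * r) t fun j => b (pos i j) := fun i t => by
    obtain ⟨h1, h2⟩ := hI i t
    simp only [τ]
    rw [h1, h2]
  have hrad : ∀ i t, (α * B' i) ^ t * ((α * β) ^ pos i 0 * r) = (α * β) ^ pos i t * r :=
    fun i t => by rw [hB'α, hpos_t i t, pow_add, pow_mul]; ring
  have game : ∀ i, _ := fun i =>
    hσ i ((α * β) ^ pos i 0 * r) (by positivity) fun t => b (pos i t)
  simp only [hrad, ← hτ] at game
  -- Bob's ball at a later turn lies in Alice's ball at an earlier one.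
  have nest : ∀ m, (∀ j < m, Metric.closedBall (b (j + 1)) ((α * β) ^ (j + 1) * r) ⊆
        Metric.closedBall (τ r j b) (α * ((α * β) ^ j * r))) →
      (∀ j < m, Metric.closedBall (τ r j b) (α * ((α * β) ^ j * r)) ⊆
        Metric.closedBall (b j) ((α * β) ^ j * r)) →
      ∀ k < m, Metric.closedBall (b m) ((α * β) ^ m * r) ⊆
        Metric.closedBall (τ r k b) (α * ((α * β) ^ k * r)) := by
    intro m hB hA k hk
    induction m with
    | zero => omega
    | succ m ih =>
      rcases Nat.lt_succ_iff_lt_or_eq.1 hk with hk' | rfl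
      · exact (hB m (by omega)).trans <| (hA m (by omega)).trans <|
          ih (fun j hj => hB j (by omega)) (fun j hj => hA j (by omega)) hk'
      · exact hB k hk
  have legal : ∀ k, (∀ j < k, Metric.closedBall (b (j + 1)) ((α * β) ^ (j + 1) * r) ⊆
        Metric.closedBall (τ r j b) (α * ((α * β) ^ j * r))) →
      Metric.closedBall (τ r k b) (α * ((α * β) ^ k * r)) ⊆
        Metric.closedBall (b k) ((α * β) ^ k * r) := by
    intro k
    induction k using Nat.strong_induction_on with
    | _ k ih =>
      intro hB
      obtain ⟨i, t, rfl⟩ : ∃ i t, k = pos i t := ⟨I k, T k, hIT k⟩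
      refine (game i).1 t fun j hj => ?_
      have hjt : pos i (j + 1) ≤ pos i t := hmono i _ _ hj
      have hjj : pos i j < pos i (j + 1) := by
        rw [hpos_succ]; exact Nat.lt_add_of_pos_right (by positivity)
      exact nest (pos i (j + 1)) (fun l hl => hB l (by omega))
        (fun l hl => ih l (by omega) fun j' hj' => hB j' (by omega)) _ hjj
  refine ⟨legal, fun hB => ?_⟩
  obtain ⟨x, hx⟩ := exists_outcome hα hα1 hβ hβ1 hr (fun k => legal k fun j _ => hB j) hB
  refine ⟨x, mem_iInter.2 fun i => ?_, hx⟩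
  obtain ⟨y, hy, hxy⟩ := (game i).2 fun j => nest (pos i (j + 1)) (fun l _ => hB l)
    (fun l _ => legal l fun j' _ => hB j') _ (by
      rw [hpos_succ]; exact Nat.lt_add_of_pos_right (by positivity))
  have : x ∈ ({y} : Set X) := hxy ▸ mem_iInter.2 fun t =>
    mem_iInter.1 (hx.symm ▸ mem_singleton x) (pos i t)
  rwa [mem_singleton_iff.1 this]

theorem IsAlphaWinning.biInter [CompleteSpace X] {α : ℝ} (hα : 0 < α) (hα1 : α < 1)
    {ι : Type*} {s : Set ι} (hs : s.Countable) {S : ι → Set X}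
    (h : ∀ i ∈ s, IsAlphaWinning α (S i)) : IsAlphaWinning α (⋂ i ∈ s, S i) := by
  rcases s.eq_empty_or_nonempty with rfl | hne
  · simpa using isAlphaWinning_univ hα hα1
  obtain ⟨f, rfl⟩ := hs.exists_eq_range hne
  rw [biInter_range]
  exact .iInter hα hα1 fun i => h _ (mem_range_self i)

end GameInter

/-! ### Hausdorff dimension of winning sets -/

section GameDim

variable {X : Type*} [MetricSpace X]

/-- A set of points coded by the sequences over `q` symbols, such that points whose codes differ
first in place `k` have distance at least `c * θ ^ k`, has dimension at least
`log q / log (1 / θ)`. -/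
theorem le_dimH_of_coding {q : ℕ} (hq : 1 < q) {θ c : ℝ} (hθ : 0 < θ) (hθ1 : θ < 1)
    (hc : 0 < c) {f : (ℕ → Fin q) → X} {S : Set X} (hS : ∀ w, f w ∈ S)
    (hf : ∀ w w' k, (∀ j < k, w j = w' j) → w k ≠ w' k → c * θ ^ k ≤ dist (f w) (f w')) :
    ENNReal.ofReal (Real.log q / Real.log (1 / θ)) ≤ dimH S := by
  have hlogq : 0 < Real.log q := Real.log_pos (by exact_mod_cast hq)
  have hlogθ : 0 < Real.log (1 / θ) := Real.log_pos (by rw [lt_div_iff₀ hθ]; linarith)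
  set t : ℝ := Real.log q / Real.log (1 / θ) with ht
  have ht0 : 0 < t := by positivity
  have hθt : θ ^ t = (q : ℝ)⁻¹ := by
    rw [Real.rpow_def_of_pos hθ, ht, one_div, Real.log_inv]
    have : Real.log θ ≠ 0 := by
      rw [one_div, Real.log_inv] at hlogθ; linarith
    rw [show Real.log θ * (Real.log q / -Real.log θ) = -Real.log q by field_simp,
      Real.exp_neg, Real.exp_log (by positivity)]
  have hdiff : ∀ w w' : ℕ → Fin q, w ≠ w' → ∃ k, (∀ j < k, w j = w' j) ∧ w k ≠ w' k := by
    intro w w' hne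
    have hex : ∃ k, w k ≠ w' k := Function.ne_iff.1 hne
    classical
    exact ⟨Nat.find hex, fun j hj => not_not.1 (Nat.find_min hex hj), Nat.find_spec hex⟩
  have hinj : Function.Injective f := by
    intro w w' h
    by_contra hne
    obtain ⟨k, h1, h2⟩ := hdiff w w' hne
    have := hf w w' k h1 h2
    rw [h, dist_self] at this
    have : 0 < c * θ ^ k := by positivity
    linarith
  have : Nonempty (ℕ → Fin q) := ⟨fun _ => ⟨0, by omega⟩⟩
  -- Decoding a point and reading its code as a base `q` expansion is Hölder with exponent `t` and
  -- maps onto `[0, 1]`, which has dimension `1`.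
  let g : X → ℝ := Real.ofDigits ∘ Function.invFun f
  have hg : ∀ w, g (f w) = Real.ofDigits w := fun w => by
    simp only [g, Function.comp, Function.leftInverse_invFun hinj w]
  have holder : HolderOnWith (Real.toNNReal ((c⁻¹) ^ t)) (Real.toNNReal t) g (range f) := by
    rintro _ ⟨w, rfl⟩ _ ⟨w', rfl⟩
    rw [hg, hg]
    rcases eq_or_ne w w' with rfl | hne
    · simp
    obtain ⟨k, h1, h2⟩ := hdiff w w' hne
    have hd := hf w w' k h1 h2
    have h3 : |Real.ofDigits w - Real.ofDigits w'| ≤ ((q : ℝ) ^ k)⁻¹ := by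
      exact_mod_cast Real.abs_ofDigits_sub_ofDigits_le h1
    have h4 : ((q : ℝ) ^ k)⁻¹ = (θ ^ k) ^ t := by
      rw [← inv_pow, ← hθt, ← Real.rpow_natCast, ← Real.rpow_natCast, ← Real.rpow_mul hθ.le,
        ← Real.rpow_mul hθ.le, mul_comm]
    have h5 : θ ^ k ≤ c⁻¹ * dist (f w) (f w') := by
      rw [le_inv_mul_iff₀ hc]; exact hd
    have h6 : |Real.ofDigits w - Real.ofDigits w'| ≤ c⁻¹ ^ t * dist (f w) (f w') ^ t := by
      rw [← Real.mul_rpow (by positivity) dist_nonneg]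
      exact (h3.trans_eq h4).trans (Real.rpow_le_rpow (by positivity) h5 ht0.le)
    rw [edist_dist, edist_dist, Real.dist_eq, ENNReal.ofReal_rpow_of_nonneg dist_nonneg (by simp),
      Real.coe_toNNReal t ht0.le, ← ENNReal.ofReal, ← ENNReal.ofReal_mul (by positivity)]
    exact ENNReal.ofReal_le_ofReal h6
  have himg : Icc (0 : ℝ) 1 ⊆ g '' range f := by
    intro y hy
    obtain ⟨w, -, rfl⟩ := Real.ofDigits_SurjOn hq hy
    exact ⟨f w, mem_range_self w, hg w⟩
  have h1 : (1 : ℝ≥0∞) ≤ dimH (range f) / (Real.toNNReal t : ℝ≥0∞) := by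
    calc (1 : ℝ≥0∞) = dimH (Icc (0 : ℝ) 1) := by
          rw [Real.dimH_of_nonempty_interior (by rw [interior_Icc]; exact ⟨1 / 2, by norm_num⟩)]
          simp
      _ ≤ dimH (g '' range f) := dimH_mono himg
      _ ≤ _ := holder.dimH_image_le (by simpa using ht0)
  have ht' : (Real.toNNReal t : ℝ≥0∞) ≠ 0 := by simpa using ht0
  rw [ENNReal.le_div_iff_mul_le (Or.inl ht') (Or.inl ENNReal.coe_ne_top), one_mul] at h1
  exact h1.trans (dimH_mono (range_subset_iff.2 hS))

/-- If balls of radius `ρ` contain `m ^ n` points of mutual distance at least `c * ρ / m`, then a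
winning set has dimension at least `n` in every nonempty open set. -/
theorem IsAlphaWinning.le_dimH_inter [CompleteSpace X] {α : ℝ} (hα : 0 < α) (hα1 : α < 1)
    {S : Set X} (hS : IsAlphaWinning α S) {n : ℕ} (hn : 0 < n) {c r₀ : ℝ} (hc : 0 < c)
    (hc1 : c ≤ 1) (hr₀ : 0 < r₀)
    (packing : ∀ (b : X) (ρ : ℝ) (m : ℕ), 0 < ρ → ρ ≤ r₀ → 0 < m → ∃ ξ : Fin (m ^ n) → X,
      (∀ i, dist (ξ i) b ≤ ρ) ∧ ∀ i j, i ≠ j → c * ρ / m ≤ dist (ξ i) (ξ j))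
    {U : Set X} (hU : IsOpen U) (hne : U.Nonempty) : (n : ℝ≥0∞) ≤ dimH (S ∩ U) := by
  classical
  obtain ⟨u, hu⟩ := hne
  obtain ⟨r, hr, hrU⟩ : ∃ r, 0 < r ∧ r ≤ r₀ ∧ Metric.closedBall u r ⊆ U := by
    obtain ⟨ε, hε, h⟩ := Metric.isOpen_iff.1 hU u hu
    refine ⟨min (ε / 2) r₀, by positivity, min_le_right _ _, fun x hx => h ?_⟩
    rw [Metric.mem_closedBall] at hx
    exact hx.trans_lt ((min_le_left _ _).trans_lt (by linarith))
  obtain ⟨hrr₀, hrU⟩ := hrU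
  have key : ∀ m : ℕ, 1 < m →
      ENNReal.ofReal (Real.log (m ^ n : ℕ) / Real.log (1 / (α * (c / (8 * m))))) ≤
        dimH (S ∩ U) := by
    intro m hm
    have hm0 : (0 : ℝ) < m := by positivity
    have hm1 : (1 : ℝ) < m := by exact_mod_cast hm
    -- With this `β`, the packing at half the radius of Alice's ball has separation four times Bob's
    -- next radius. His balls lie inside Alice's ball, and outcomes in different ones are at least
    -- two radii apart.
    set β := c / (8 * m) with hβdef
    have hβ : 0 < β := by positivity
    have hβ1 : β < 1 / 8 := by
      rw [hβdef, div_lt_div_iff₀ (by positivity) (by norm_num)]; linarith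
    have hαβ : 0 < α * β := by positivity
    have hαβ1 : α * β < 1 := by nlinarith
    obtain ⟨σ, hσ⟩ := hS β hβ (by linarith)
    choose! ξ hξ hξ' using fun (b : X) (ρ : ℝ) (h : 0 < ρ ∧ ρ ≤ r₀) =>
      packing b ρ m h.1 h.2 (by omega)
    let q := m ^ n
    -- The history of the play coded by `w`, after `k` moves of Bob.
    let H : (ℕ → Fin q) → ℕ → ℕ → X := fun w k => Nat.rec (fun _ => u)
      (fun k h => Function.update h (k + 1)
        (ξ (σ r k fun i => h i) (α * ((α * β) ^ k * r) / 2) (w k))) k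
    have Hsucc : ∀ w k, H w (k + 1) = Function.update (H w k) (k + 1)
        (ξ (σ r k fun i => H w k i) (α * ((α * β) ^ k * r) / 2) (w k)) := fun w k => rfl
    let b : (ℕ → Fin q) → ℕ → X := fun w k => H w k k
    have Hb : ∀ w k i, i ≤ k → H w k i = b w i := by
      intro w k i hi
      induction k with
      | zero => obtain rfl : i = 0 := by omega
                rfl
      | succ k ih =>
        rcases Nat.lt_or_eq_of_le hi with hi' | rfl
        · rw [Hsucc, Function.update_of_ne (by omega), ih (by omega)]
        · rfl
    let a : (ℕ → Fin q) → ℕ → X := fun w k => σ r k fun i => b w i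
    have bsucc : ∀ w k, b w (k + 1) = ξ (a w k) (α * ((α * β) ^ k * r) / 2) (w k) := by
      intro w k
      simp only [b]
      rw [Hsucc, Function.update_self]
      have : (fun i : Fin (k + 1) => H w k i) = fun i : Fin (k + 1) => b w i :=
        funext fun i => Hb w k i (Nat.lt_succ_iff.1 i.2)
      rw [this]
    have hrad : ∀ k : ℕ, 0 < α * ((α * β) ^ k * r) / 2 ∧ α * ((α * β) ^ k * r) / 2 ≤ r₀ := by
      intro k
      refine ⟨by positivity, ?_⟩
      have h1 : (α * β) ^ k ≤ 1 := pow_le_one₀ hαβ.le hαβ1.le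
      have h2 : (α * β) ^ k * r ≤ r := by nlinarith
      have h3 : 0 < (α * β) ^ k * r := by positivity
      nlinarith
    have legal : ∀ w k, Metric.closedBall (b w (k + 1)) ((α * β) ^ (k + 1) * r) ⊆
        Metric.closedBall (a w k) (α * ((α * β) ^ k * r)) := by
      intro w k
      apply Metric.closedBall_subset_closedBall'
      have h1 := hξ (a w k) _ (hrad k) (w k)
      rw [bsucc, pow_succ]
      have h3 : 0 < α * ((α * β) ^ k * r) := by positivity
      nlinarith
    have agree : ∀ w w' k, (∀ j < k, w j = w' j) → ∀ i ≤ k, b w i = b w' i := by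
      intro w w' k hk i
      induction i using Nat.strong_induction_on with
      | _ i ih =>
        intro hi
        cases i with
        | zero => rfl
        | succ i =>
          have : a w i = a w' i := by
            simp only [a]
            congr 1
            exact funext fun j => ih j j.2 (by omega)
          rw [bsucc, bsucc, this, hk i (by omega)]
    choose x hxS hx using fun w => (hσ r hr (b w)).2 (legal w)
    have hxA : ∀ w k, x w ∈ Metric.closedBall (a w k) (α * ((α * β) ^ k * r)) := fun w k =>
      mem_iInter.1 ((hx w).symm ▸ mem_singleton (x w)) k
    have hxB : ∀ w k, x w ∈ Metric.closedBall (b w k) ((α * β) ^ k * r) := fun w k =>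
      (hσ r hr (b w)).1 k (fun j _ => legal w j) (hxA w k)
    have hxU : ∀ w, x w ∈ S ∩ U := fun w => ⟨hxS w, hrU (by simpa [b, H] using hxB w 0)⟩
    refine le_dimH_of_coding (c := 2 * (α * β) * r) (Nat.one_lt_pow hn.ne' hm) hαβ hαβ1
      (by positivity) hxU fun w w' k h1 h2 => ?_
    have h3 : a w k = a w' k := by
      simp only [a]
      congr 1
      exact funext fun j => agree w w' k h1 j (Nat.lt_succ_iff.1 j.2)
    have h4 := hξ' (a w k) _ (hrad k) _ _ h2
    have h5 := hxB w (k + 1)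
    have h6 := hxB w' (k + 1)
    rw [bsucc, Metric.mem_closedBall] at h5 h6
    rw [← h3] at h6
    have h7 : c * (α * ((α * β) ^ k * r) / 2) / m = 4 * ((α * β) ^ (k + 1) * r) := by
      have : c = β * (8 * m) := by rw [hβdef]; field_simp
      rw [this]
      field_simp
      ring
    have h8 := dist_triangle4 (ξ (a w k) (α * ((α * β) ^ k * r) / 2) (w k)) (x w) (x w')
      (ξ (a w k) (α * ((α * β) ^ k * r) / 2) (w' k))
    rw [dist_comm _ (x w)] at h8
    have h9 : (α * β) ^ (k + 1) * r = (α * β) * r * (α * β) ^ k := by ring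
    linarith
  have hlim : Filter.Tendsto (fun m : ℕ =>
      ENNReal.ofReal (Real.log (m ^ n : ℕ) / Real.log (1 / (α * (c / (8 * m))))))
      Filter.atTop (𝓝 (ENNReal.ofReal n)) := by
    apply ENNReal.tendsto_ofReal
    have h1 : Filter.Tendsto (fun m : ℕ => Real.log m) Filter.atTop Filter.atTop :=
      Real.tendsto_log_atTop.comp tendsto_natCast_atTop_atTop
    have h2 : Filter.Tendsto (fun m : ℕ => n / (1 + Real.log (8 / (α * c)) / Real.log m))
        Filter.atTop (𝓝 (n / (1 + 0))) :=
      tendsto_const_nhds.div (tendsto_const_nhds.add (h1.const_div_atTop _)) (by norm_num)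
    rw [add_zero, div_one] at h2
    refine h2.congr' ?_
    filter_upwards [Filter.eventually_gt_atTop 1] with m hm
    have hm0 : (0 : ℝ) < m := by positivity
    have hl : 0 < Real.log m := Real.log_pos (by exact_mod_cast hm)
    have e : 1 / (α * (c / (8 * m))) = m * (8 / (α * c)) := by field_simp
    rw [e, Real.log_mul hm0.ne' (by positivity), Nat.cast_pow, Real.log_pow]
    have : 1 + Real.log (8 / (α * c)) / Real.log m
        = (Real.log m + Real.log (8 / (α * c))) / Real.log m := by field_simp
    rw [this, div_div_eq_mul_div]
  have := le_of_tendsto hlim (Filter.eventually_atTop.2 ⟨2, fun m hm => key m (by omega)⟩)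
  simpa using this

end GameDim

/-! ### Avoiding a uniformly discrete set along a linear orbit -/

section Avoidance

theorem summable_indicator_geometric {q : ℝ} (hq : 0 ≤ q) (hq1 : q < 1) (K : Set ℕ) :
    Summable (K.indicator fun k => q ^ k) :=
  (summable_geometric_of_lt_one hq hq1).indicator K

/-- The part of a geometric series over the exponents with `(s⁻¹) ^ k < x`. -/
theorem tsum_indicator_geometric_le {q s e x : ℝ} (hs : 1 < s) (hx : 0 ≤ x) (he : 0 < e)
    (hq : q = s⁻¹ ^ e) :
    ∑' k, ({k : ℕ | s⁻¹ ^ k < x}.indicator (fun k => q ^ k) k) ≤ x ^ e / (1 - q) := by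
  classical
  have hs0 : 0 < s⁻¹ := inv_pos.2 (by linarith)
  have hq0 : 0 < q := hq ▸ Real.rpow_pos_of_pos hs0 e
  have hq1 : q < 1 := hq ▸ Real.rpow_lt_one hs0.le (inv_lt_one_of_one_lt₀ hs) he
  by_cases h : ∃ k : ℕ, s⁻¹ ^ k < x
  · set m := Nat.find h with hm
    have hsum := summable_indicator_geometric hq0.le hq1 {k : ℕ | s⁻¹ ^ k < x}
    rw [← hsum.sum_add_tsum_nat_add m]
    have h0 : ∑ k ∈ Finset.range m, ({k : ℕ | s⁻¹ ^ k < x}.indicator (fun k => q ^ k) k) = 0 :=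
      Finset.sum_eq_zero fun k hk =>
        indicator_of_notMem (s := {k : ℕ | s⁻¹ ^ k < x}) (Nat.find_min h (Finset.mem_range.1 hk)) _
    rw [h0, zero_add]
    have hgeo : HasSum (fun k : ℕ => q ^ m * q ^ k) (q ^ m * (1 - q)⁻¹) :=
      (hasSum_geometric_of_lt_one hq0.le hq1).mul_left _
    calc ∑' k, ({k : ℕ | s⁻¹ ^ k < x}.indicator (fun k => q ^ k) (k + m))
        ≤ q ^ m * (1 - q)⁻¹ := by
          refine hasSum_le (fun k => ?_) ((summable_nat_add_iff m).2 hsum).hasSum hgeo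
          rw [← pow_add, add_comm m k]
          exact indicator_le_self' (fun _ _ => by positivity) _
      _ ≤ x ^ e / (1 - q) := by
          rw [div_eq_mul_inv]
          have h1 : q ^ m = (s⁻¹ ^ m) ^ e := by
            rw [hq, ← Real.rpow_natCast, ← Real.rpow_natCast, ← Real.rpow_mul hs0.le,
              ← Real.rpow_mul hs0.le, mul_comm]
          rw [h1]
          exact mul_le_mul_of_nonneg_right
            (Real.rpow_le_rpow (by positivity) (Nat.find_spec h).le he.le)
            (inv_nonneg.2 (by linarith))
  · have : {k : ℕ | s⁻¹ ^ k < x} = ∅ := eq_empty_of_forall_notMem fun k hk => h ⟨k, hk⟩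
    rw [this]
    simp only [indicator_empty, tsum_zero]
    exact div_nonneg (Real.rpow_nonneg hx e) (by linarith)

variable {X V : Type*} [MetricSpace X] [NormedAddCommGroup V] [NormedSpace ℝ V]

/-- The times `k` at which some point of the ball is mapped by `L ^ k ∘ F` into the
`δ`-neighbourhood of `Y`, among those for which the image of the ball has bounded size. -/
def dangerousTimes (F : X → V) (L : Module.End ℝ V) (Y : Set V) (s κ δ : ℝ) (b : X) (ρ : ℝ) :
    Set ℕ :=
  {k | ρ ≤ κ * s⁻¹ ^ k ∧ ∃ ξ ∈ Metric.closedBall b ρ, ∃ y ∈ Y, ‖(L ^ k) (F ξ) - y‖ < δ}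

/-- Alice can move so that the weighted number of dangerous times is halved, up to the times that
become relevant only now. -/
theorem exists_move_halving {F : X → V} {L : Module.End ℝ V} {Y : Set V} {C₁ C c κ δ η α q : ℝ}
    {b : X} {ρ : ℝ} {φ : V →L[ℝ] ℂ} {lam : ℂ} (hlam : 1 < ‖lam‖)
    (hre : ∀ v, |(φ v).re| ≤ ‖v‖) (hφ : ∀ v, φ (L v) = lam * φ v) (hC : ∀ k v, ‖(L ^ k) v‖ ≤ C * ‖lam‖ ^ k * ‖v‖)
    (hC0 : 0 ≤ C) (hC₁ : 0 ≤ C₁)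
    (hY : ∀ y ∈ Y, ∀ y' ∈ Y, y ≠ y' → η ≤ ‖y - y'‖)
    (hq : 0 ≤ q) (hq1 : q < 1) (hρ : 0 < ρ) (hα : 0 < α) (hα2 : α ≤ 1 / 2) (hαc : C₁ * α ≤ c / 4)
    (hLip : ∀ x ∈ Metric.closedBall b ρ, ∀ y ∈ Metric.closedBall b ρ,
      ‖F x - F y‖ ≤ C₁ * dist x y)
    (hup : ∃ y, dist y b ≤ (1 - α) * ρ ∧ (φ (F b)).re + c * ((1 - α) * ρ) ≤ (φ (F y)).re)
    (hdown : ∃ y, dist y b ≤ (1 - α) * ρ ∧ (φ (F y)).re ≤ (φ (F b)).re - c * ((1 - α) * ρ))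
    (hηκ : 2 * δ + 2 * C * C₁ * κ < η) (hc : 0 < c) (hκ : 0 < κ)
    (hkill : ∀ k ∈ dangerousTimes F L Y ‖lam‖ κ δ b ρ, ‖φ‖ * δ * ‖lam‖⁻¹ ^ k < c / 4 * ρ) :
    ∃ a, dist a b ≤ (1 - α) * ρ ∧ ∀ b' ρ', Metric.closedBall b' ρ' ⊆ Metric.closedBall a (α * ρ) →
      ∑' k, (dangerousTimes F L Y ‖lam‖ κ δ b' ρ').indicator (fun k => q ^ k) k ≤
        (∑' k, (dangerousTimes F L Y ‖lam‖ κ δ b ρ).indicator (fun k => q ^ k) k) / 2 +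
          ∑' k, ({k : ℕ | ‖lam‖⁻¹ ^ k < ρ / κ}.indicator (fun k => q ^ k) k) := by
  classical
  set K := dangerousTimes F L Y ‖lam‖ κ δ b ρ with hK
  have hs0 : 0 < ‖lam‖⁻¹ := inv_pos.2 (by linarith)
  have hlam0 : lam ≠ 0 := norm_pos_iff.1 (by linarith)
  have hφk : ∀ k v, φ ((L ^ k) v) = lam ^ k * φ v := by
    intro k
    induction k with
    | zero => simp
    | succ k ih => intro v; rw [pow_succ', Module.End.mul_apply, hφ, ih, pow_succ]; ring
  have : Nonempty X := ⟨b⟩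
  choose! ξ hξ y hyY hy using fun k (hk : k ∈ K) => hk.2
  -- Applied to `L^k (F x) = y k`, the eigenfunctional gives `φ (F x) = φ (y k) / lam ^ k`. The real
  -- part is the level of the `k`-th slab.
  let t : ℕ → ℝ := fun k => (φ (y k) / lam ^ k).re
  -- A dangerous time that persists stays close to its threshold.
  have persist : ∀ a, dist a b ≤ (1 - α) * ρ → ∀ b' ρ',
      Metric.closedBall b' ρ' ⊆ Metric.closedBall a (α * ρ) →
      ∀ k ∈ dangerousTimes F L Y ‖lam‖ κ δ b' ρ', ρ ≤ κ * ‖lam‖⁻¹ ^ k →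
        k ∈ K ∧ ∃ x ∈ Metric.closedBall a (α * ρ), |(φ (F x)).re - t k| < c / 4 * ρ := by
    rintro a ha b' ρ' hb' k ⟨-, x, hx, z, hzY, hz⟩ hk
    have hab : Metric.closedBall a (α * ρ) ⊆ Metric.closedBall b ρ :=
      Metric.closedBall_subset_closedBall' (by linarith)
    have hxb : x ∈ Metric.closedBall b ρ := hab (hb' hx)
    have hkK : k ∈ K := ⟨hk, x, hxb, z, hzY, hz⟩
    refine ⟨hkK, x, hb' hx, ?_⟩
    -- The image of the ball under `L^k ∘ F` is smaller than the gaps of `Y`, so only one point of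
    -- `Y` can be `δ`-close to it.
    have hzy : z = y k := by
      by_contra hne
      have h1 := hY z hzY (y k) (hyY k hkK) hne
      have h2 : ‖(L ^ k) (F x) - (L ^ k) (F (ξ k))‖ ≤ 2 * C * C₁ * κ := by
        rw [← map_sub]
        refine (hC k _).trans ?_
        have h3 := hLip x hxb (ξ k) (hξ k hkK)
        have h4 : dist x (ξ k) ≤ 2 * ρ := by
          have := dist_triangle_right x (ξ k) b
          have h5 := Metric.mem_closedBall.1 hxb
          have h6 := Metric.mem_closedBall.1 (hξ k hkK)
          linarith
        have h5 : ‖lam‖ ^ k * ρ ≤ κ := by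
          calc ‖lam‖ ^ k * ρ ≤ ‖lam‖ ^ k * (κ * ‖lam‖⁻¹ ^ k) := by gcongr
            _ = κ := by rw [inv_pow]; field_simp
        calc C * ‖lam‖ ^ k * ‖F x - F (ξ k)‖ ≤ C * ‖lam‖ ^ k * (C₁ * (2 * ρ)) := by
              gcongr
              exact h3.trans (by gcongr)
          _ = 2 * C * C₁ * (‖lam‖ ^ k * ρ) := by ring
          _ ≤ 2 * C * C₁ * κ := by gcongr
      have h3 : ‖z - y k‖ ≤ ‖(L ^ k) (F x) - z‖ + ‖(L ^ k) (F x) - (L ^ k) (F (ξ k))‖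
          + ‖(L ^ k) (F (ξ k)) - y k‖ := by
        have : z - y k = -((L ^ k) (F x) - z) + ((L ^ k) (F x) - (L ^ k) (F (ξ k)))
          + ((L ^ k) (F (ξ k)) - y k) := by abel
        rw [this]
        refine (norm_add_le _ _).trans (add_le_add_left ((norm_add_le _ _).trans ?_) _)
        rw [norm_neg]
      have := hy k hkK
      linarith
    have h1 : (φ (F x)).re - t k = ((φ ((L ^ k) (F x) - z)) / lam ^ k).re := by
      rw [map_sub, hφk, hzy, ← Complex.sub_re, sub_div, mul_div_cancel_left₀ _ (pow_ne_zero k hlam0)]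
    rw [h1]
    refine (Complex.abs_re_le_norm _).trans_lt (lt_of_le_of_lt ?_ (hkill k hkK))
    rw [norm_div, norm_pow, inv_pow, div_eq_mul_inv]
    gcongr
    exact (φ.le_opNorm _).trans (by gcongr)
  -- A time that is dangerous after the move either was already relevant, and then persists in the
  -- set `J` that Alice did not eliminate, or has `‖lam‖⁻¹ ^ k < ρ / κ` and is newly relevant.
  have compare : ∀ (J K' : Set ℕ), (∀ k ∈ K', ρ ≤ κ * ‖lam‖⁻¹ ^ k → k ∈ J) →
      ∑' k, K'.indicator (fun k => q ^ k) k ≤ ∑' k, J.indicator (fun k => q ^ k) k +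
        ∑' k, ({k : ℕ | ‖lam‖⁻¹ ^ k < ρ / κ}.indicator (fun k => q ^ k) k) := by
    intro J K' h
    rw [← (summable_indicator_geometric hq hq1 _).tsum_add (summable_indicator_geometric hq hq1 _)]
    refine (summable_indicator_geometric hq hq1 _).tsum_le_tsum (fun k => ?_)
      ((summable_indicator_geometric hq hq1 _).add (summable_indicator_geometric hq hq1 _))
    have hnn : ∀ A : Set ℕ, 0 ≤ A.indicator (fun k => q ^ k) k := fun A =>
      indicator_nonneg (fun _ _ => by positivity) _
    by_cases hk : k ∈ K'
    · rw [indicator_of_mem hk]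
      by_cases hk2 : ρ ≤ κ * ‖lam‖⁻¹ ^ k
      · rw [indicator_of_mem (h k hk hk2)]
        exact le_add_of_nonneg_right (hnn _)
      · have : k ∈ {k : ℕ | ‖lam‖⁻¹ ^ k < ρ / κ} := by
          rw [mem_ofPred_eq, lt_div_iff₀ hκ, mul_comm]; exact not_le.1 hk2
        rw [indicator_of_mem this]
        exact le_add_of_nonneg_left (hnn _)
    · rw [indicator_of_notMem hk]
      exact add_nonneg (hnn _) (hnn _)
  have hsplit : ∑' k, K.indicator (fun k => q ^ k) k =
      ∑' k, (K ∩ {k | t k ≤ (φ (F b)).re}).indicator (fun k => q ^ k) k +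
        ∑' k, (K \ {k | t k ≤ (φ (F b)).re}).indicator (fun k => q ^ k) k := by
    rw [← (summable_indicator_geometric hq hq1 _).tsum_add (summable_indicator_geometric hq hq1 _)]
    refine tsum_congr fun k => ?_
    by_cases h1 : k ∈ K <;> by_cases h2 : t k ≤ (φ (F b)).re <;> simp [indicator, h1, h2]
  have near : ∀ a, dist a b ≤ (1 - α) * ρ → ∀ x ∈ Metric.closedBall a (α * ρ),
      |(φ (F x)).re - (φ (F a)).re| ≤ c / 4 * ρ := by
    intro a ha x hx
    have hab : Metric.closedBall a (α * ρ) ⊆ Metric.closedBall b ρ :=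
      Metric.closedBall_subset_closedBall' (by linarith)
    rw [← Complex.sub_re, ← map_sub]
    refine (hre _).trans <| (hLip x (hab hx) a (hab (Metric.mem_closedBall_self
      (by positivity)))).trans ?_
    calc C₁ * dist x a ≤ C₁ * (α * ρ) := by gcongr; exact hx
      _ = C₁ * α * ρ := by ring
      _ ≤ c / 4 * ρ := by gcongr
  have hstep : c / 2 * ρ ≤ c * ((1 - α) * ρ) := by
    have : 0 < c * ρ := by positivity
    nlinarith
  -- Alice climbs if the slabs at or below the current level carry at least half the weight, and
  -- descends otherwise. The move changes the level by at least `c / 2 * ρ`; the variation over her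
  -- ball and the slab half-width each use at most `c / 4 * ρ`, the latter strictly less, so the
  -- majority is missed.
  by_cases hmaj : (∑' k, K.indicator (fun k => q ^ k) k) / 2 ≤
      ∑' k, (K ∩ {k | t k ≤ (φ (F b)).re}).indicator (fun k => q ^ k) k
  · obtain ⟨a, ha, hfa⟩ := hup
    refine ⟨a, ha, fun b' ρ' hb' => ?_⟩
    have := compare (K \ {k | t k ≤ (φ (F b)).re}) (dangerousTimes F L Y ‖lam‖ κ δ b' ρ')
      fun k hk hk2 => by
        obtain ⟨hkK, x, hx, hxt⟩ := persist a ha b' ρ' hb' k hk hk2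
        refine ⟨hkK, fun ht => ?_⟩
        have h1 := abs_le.1 (near a ha x hx)
        have h2 := abs_lt.1 hxt
        have h3 : t k ≤ (φ (F b)).re := ht
        linarith [h1.1, h2.2]
    linarith
  · obtain ⟨a, ha, hfa⟩ := hdown
    refine ⟨a, ha, fun b' ρ' hb' => ?_⟩
    have := compare (K ∩ {k | t k ≤ (φ (F b)).re}) (dangerousTimes F L Y ‖lam‖ κ δ b' ρ')
      fun k hk hk2 => by
        obtain ⟨hkK, x, hx, hxt⟩ := persist a ha b' ρ' hb' k hk hk2
        refine ⟨hkK, ?_⟩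
        by_contra ht
        have h1 := abs_le.1 (near a ha x hx)
        have h2 := abs_lt.1 hxt
        have h3 : (φ (F b)).re < t k := not_le.1 ht
        linarith [h1.2, h2.1]
    linarith

/-- Points whose `L`-orbit, read off in local coordinates `F b`, stays away from a uniformly discrete
set `Y` form a winning set. -/
theorem isAlphaWinning_avoid [CompleteSpace X] {C₁ c r₀ : ℝ} (hC₁ : 0 < C₁) (hc : 0 < c)
    (hr₀ : 0 < r₀) {F : X → X → V}
    (hLip : ∀ b, ∀ x ∈ Metric.closedBall b r₀, ∀ y ∈ Metric.closedBall b r₀,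
      ‖F b x - F b y‖ ≤ C₁ * dist x y)
    (hasc : ∀ b, ∀ x ∈ Metric.closedBall b r₀, ∀ ℓ : V →L[ℝ] ℝ, ‖ℓ‖ = 1 → ∀ s, 0 < s → s ≤ r₀ →
      ∃ y, dist y x ≤ s ∧ ℓ (F b x) + c * s ≤ ℓ (F b y))
    {L : Module.End ℝ V} {φ : V →L[ℝ] ℂ} {lam : ℂ} (hlam : 1 < ‖lam‖)
    (hφ1 : ‖Complex.reCLM ∘L φ‖ = 1) (hφ : ∀ v, φ (L v) = lam * φ v) {C : ℝ} (hC0 : 0 < C)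
    (hC : ∀ k v, ‖(L ^ k) v‖ ≤ C * ‖lam‖ ^ k * ‖v‖) {Y : Set V} {η : ℝ} (hη : 0 < η)
    (hY : ∀ y ∈ Y, ∀ y' ∈ Y, y ≠ y' → η ≤ ‖y - y'‖) {α : ℝ} (hα : 0 < α) (hα2 : α ≤ 1 / 2)
    (hαc : C₁ * α ≤ c / 4) :
    IsAlphaWinning α {x | ∃ b, dist x b ≤ r₀ ∧ ∃ δ > 0, ∀ k, ∀ y ∈ Y,
      δ ≤ ‖(L ^ k) (F b x) - y‖} := by
  intro β hβ hβ1
  have hαβ : 0 < α * β := by positivity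
  have hαβ1 : α * β < 1 := by nlinarith
  have hs0 : 0 < ‖lam‖⁻¹ := inv_pos.2 (by linarith)
  have hre : ∀ v, |(φ v).re| ≤ ‖v‖ := fun v => by
    simpa [hφ1] using (Complex.reCLM ∘L φ).le_opNorm v
  -- the exponent `e` of the weights, normalized by `(α * β) ^ (-e) = 3 / 2`
  obtain ⟨e, he, heαβ⟩ : ∃ e : ℝ, 0 < e ∧ (α * β) ^ (-e) = 3 / 2 := by
    have h1 : Real.log (α * β) < 0 := Real.log_neg hαβ hαβ1
    refine ⟨-(Real.log (3 / 2) / Real.log (α * β)), ?_, ?_⟩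
    · exact neg_pos.2 (div_neg_of_pos_of_neg (Real.log_pos (by norm_num)) h1)
    · rw [neg_neg, Real.rpow_def_of_pos hαβ, mul_div_cancel₀ _ h1.ne, Real.exp_log (by norm_num)]
  set q : ℝ := ‖lam‖⁻¹ ^ e with hq
  have hq0 : 0 < q := Real.rpow_pos_of_pos hs0 e
  have hq1 : q < 1 := Real.rpow_lt_one hs0.le (inv_lt_one_of_one_lt₀ hlam) he
  have hqk : ∀ k : ℕ, q ^ k = (‖lam‖⁻¹ ^ k) ^ e := fun k => by
    rw [hq, ← Real.rpow_natCast, ← Real.rpow_natCast, ← Real.rpow_mul hs0.le,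
      ← Real.rpow_mul hs0.le, mul_comm]
  -- Relevant times are those for which the image of the ball has diameter at most `2 * C * C₁ * κ =
  -- η / 2`.
  set κ : ℝ := η / (4 * C * C₁) with hκdef
  have hκ : 0 < κ := by positivity
  -- the bound for the potential, and the size of the gaps, in terms of the initial radius
  let P : ℝ → ℝ := fun ρ₀ => max (ρ₀ ^ (-e) / (1 - q)) (6 * (κ ^ (-e) / (1 - q)))
  have hP : ∀ ρ₀, 0 < P ρ₀ := fun ρ₀ => lt_max_of_lt_right (by
    have : 0 < 1 - q := by linarith
    have := Real.rpow_pos_of_pos hκ (-e)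
    positivity)
  let Hh : ℝ → ℝ := fun ρ₀ => P ρ₀ ^ e⁻¹
  have hHh : ∀ ρ₀, 0 < Hh ρ₀ := fun ρ₀ => Real.rpow_pos_of_pos (hP ρ₀) _
  -- The first bound leaves room for the separation argument. The second makes a slab of half-width
  -- `‖φ‖ * δ * ‖lam‖⁻¹ ^ k` thinner than `c / 4 * ρ` as soon as `‖lam‖⁻¹ ^ k ≤ Hh ρ₀ * ρ`. The gap
  -- may depend on the initial radius, since the target set only asks for some `δ`.
  let δ : ℝ → ℝ := fun ρ₀ => min (η / 8) (c / (8 * (‖φ‖ + 1) * Hh ρ₀))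
  have hδ : ∀ ρ₀, 0 < δ ρ₀ := fun ρ₀ => by
    have := hHh ρ₀
    exact lt_min (by positivity) (by positivity)
  let W : X → ℝ → X → ℝ → ℝ := fun b₀ ρ₀ b ρ =>
    ∑' k, (dangerousTimes (F b₀) L Y ‖lam‖ κ (δ ρ₀) b ρ).indicator (fun k => q ^ k) k
  have hWk : ∀ b₀ ρ₀ b ρ, ∀ k ∈ dangerousTimes (F b₀) L Y ‖lam‖ κ (δ ρ₀) b ρ,
      q ^ k ≤ W b₀ ρ₀ b ρ := fun b₀ ρ₀ b ρ k hk => by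
    have := (summable_indicator_geometric hq0.le hq1 (dangerousTimes (F b₀) L Y ‖lam‖ κ (δ ρ₀)
      b ρ)).le_tsum k fun j _ => indicator_nonneg (fun _ _ => by positivity) _
    rwa [indicator_of_mem hk] at this
  -- a dangerous time is not too old
  have hold : ∀ b₀ ρ₀ b ρ, 0 < ρ → ρ ^ (-e) * W b₀ ρ₀ b ρ ≤ P ρ₀ →
      ∀ k ∈ dangerousTimes (F b₀) L Y ‖lam‖ κ (δ ρ₀) b ρ, ‖lam‖⁻¹ ^ k ≤ Hh ρ₀ * ρ := by
    intro b₀ ρ₀ b ρ hρ hW k hk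
    have h1 : (‖lam‖⁻¹ ^ k / ρ) ^ e ≤ P ρ₀ := by
      refine le_trans ?_ hW
      rw [Real.div_rpow (by positivity) hρ.le, ← hqk, Real.rpow_neg hρ.le, div_eq_inv_mul]
      gcongr
      exact hWk _ _ _ _ k hk
    have h2 := Real.rpow_le_rpow (by positivity) h1 (inv_nonneg.2 he.le)
    rw [Real.rpow_rpow_inv (by positivity) he.ne'] at h2
    rwa [div_le_iff₀ hρ] at h2
  refine .of_invariant hα (by linarith) hβ hβ1 hr₀
    (fun b₀ ρ₀ b ρ => Metric.closedBall b ρ ⊆ Metric.closedBall b₀ r₀ ∧ ρ ≤ r₀ ∧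
      ρ ^ (-e) * W b₀ ρ₀ b ρ ≤ P ρ₀) ?_ ?_ ?_
  · intro b ρ hρ hρr
    refine ⟨Metric.closedBall_subset_closedBall hρr, hρr, le_max_of_le_left ?_⟩
    rw [div_eq_mul_inv]
    gcongr
    rw [← tsum_geometric_of_lt_one hq0.le hq1]
    exact (summable_indicator_geometric hq0.le hq1 _).tsum_le_tsum
      (fun k => indicator_le_self' (fun _ _ => by positivity) _)
      (summable_geometric_of_lt_one hq0.le hq1)
  · rintro b₀ ρ₀ b ρ hρ₀ hρ ⟨hb, hρr, hW⟩
    have hbm : b ∈ Metric.closedBall b₀ r₀ := hb (Metric.mem_closedBall_self hρ.le)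
    have hs : 0 < (1 - α) * ρ := by nlinarith
    have hs' : (1 - α) * ρ ≤ r₀ := by nlinarith
    obtain ⟨a, ha, H⟩ := exists_move_halving (F := F b₀) (L := L) (Y := Y) (C₁ := C₁) (C := C)
      (c := c) (κ := κ) (δ := δ ρ₀) (η := η) (α := α) (q := q) (b := b) (ρ := ρ) (φ := φ) hlam
      hre hφ hC hC0.le hC₁.le hY hq0.le hq1 hρ hα hα2 hαc
      (fun x hx y hy => hLip b₀ x (hb hx) y (hb hy))
      (by simpa using hasc b₀ b hbm _ hφ1 _ hs hs')
      (by
        obtain ⟨y, hy, hy'⟩ := hasc b₀ b hbm (-(Complex.reCLM ∘L φ)) (by rwa [norm_neg]) _ hs hs'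
        refine ⟨y, hy, ?_⟩
        simp only [neg_apply, ContinuousLinearMap.comp_apply,
          Complex.reCLM_apply] at hy'
        linarith)
      (by
        have h1 : δ ρ₀ ≤ η / 8 := min_le_left _ _
        have h2 : 2 * C * C₁ * κ = η / 2 := by rw [hκdef]; field_simp; norm_num
        linarith) hc hκ
      (fun k hk => by
        have h1 := hold b₀ ρ₀ b ρ hρ hW k hk
        have h2 : δ ρ₀ ≤ c / (8 * (‖φ‖ + 1) * Hh ρ₀) := min_le_right _ _
        have h3 := hHh ρ₀
        have h4 := hδ ρ₀
        calc ‖φ‖ * δ ρ₀ * ‖lam‖⁻¹ ^ k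
            ≤ (‖φ‖ + 1) * (c / (8 * (‖φ‖ + 1) * Hh ρ₀)) * (Hh ρ₀ * ρ) := by
              gcongr; linarith
          _ = c / 8 * ρ := by field_simp
          _ < c / 4 * ρ := by nlinarith)
    refine ⟨a, ha, fun b' hb' => ⟨hb'.trans <| (Metric.closedBall_subset_closedBall' ?_).trans hb,
      ?_, ?_⟩⟩
    · linarith
    · nlinarith
    · have h1 := H b' _ hb'
      have h2 : ∑' k, ({k : ℕ | ‖lam‖⁻¹ ^ k < ρ / κ}.indicator (fun k => q ^ k) k) ≤
          (ρ / κ) ^ e / (1 - q) := tsum_indicator_geometric_le hlam (by positivity) he hq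
      have h3 : (α * β * ρ) ^ (-e) = 3 / 2 * ρ ^ (-e) := by
        rw [Real.mul_rpow hαβ.le hρ.le, heαβ]
      have h4 : W b₀ ρ₀ b' (α * β * ρ) ≤ W b₀ ρ₀ b ρ / 2 + (ρ / κ) ^ e / (1 - q) :=
        h1.trans (add_le_add_right h2 _)
      have hρe : 0 < ρ ^ (-e) := Real.rpow_pos_of_pos hρ _
      have h5 : ρ ^ (-e) * ((ρ / κ) ^ e / (1 - q)) = κ ^ (-e) / (1 - q) := by
        rw [Real.div_rpow hρ.le hκ.le, Real.rpow_neg hρ.le, Real.rpow_neg hκ.le]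
        have := (Real.rpow_pos_of_pos hρ e).ne'
        field_simp
      -- Halving against the factor `3 / 2` leaves `3 / 4` of the old potential. The new times add
      -- at most `3 / 2 * (P ρ₀ / 6)`, that is, the missing quarter.
      have h6 : 6 * (κ ^ (-e) / (1 - q)) ≤ P ρ₀ := le_max_right _ _
      rw [h3]
      calc 3 / 2 * ρ ^ (-e) * W b₀ ρ₀ b' (α * β * ρ)
          ≤ 3 / 2 * ρ ^ (-e) * (W b₀ ρ₀ b ρ / 2 + (ρ / κ) ^ e / (1 - q)) := by gcongr
        _ = 3 / 4 * (ρ ^ (-e) * W b₀ ρ₀ b ρ) +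
            3 / 2 * (ρ ^ (-e) * ((ρ / κ) ^ e / (1 - q))) := by ring
        _ ≤ P ρ₀ := by rw [h5]; linarith
  · intro b₀ ρ₀ x b hρ₀ hx hI
    refine ⟨b₀, (hI 0).1 (hx 0), δ ρ₀, hδ ρ₀, fun k y hy => ?_⟩
    -- A violation at time `k` makes `k` dangerous for all sufficiently small balls of the play,
    -- whereas `hold` excludes this once `Hh ρ₀ * ρ < ‖lam‖⁻¹ ^ k`.
    by_contra hlt
    have hlim := tendsto_radius hα (by linarith) hβ hβ1 ρ₀
    have h1 := hlim.eventually (gt_mem_nhds (show 0 < κ * ‖lam‖⁻¹ ^ k by positivity))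
    have h2 := (hlim.const_mul (Hh ρ₀)).eventually (gt_mem_nhds
      (show Hh ρ₀ * 0 < ‖lam‖⁻¹ ^ k by rw [mul_zero]; positivity))
    obtain ⟨j, hj1, hj2⟩ := (h1.and h2).exists
    exact absurd (hold b₀ ρ₀ (b j) _ (by positivity) (hI j).2.2 k
      ⟨hj1.le, x, hx j, y, hy, not_le.1 hlt⟩) (not_le.2 hj2)

end Avoidance

/-! ### Spectral theory of semisimple hyperbolic maps -/

section LinearAlgebra

open Polynomial

variable {V : Type*} [NormedAddCommGroup V] [NormedSpace ℝ V]

/-- The transpose of a real endomorphism, acting on the complex-valued functionals. -/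
noncomputable def complexTranspose (L : Module.End ℝ V) : Module.End ℂ (V →ₗ[ℝ] ℂ) where
  toFun φ := φ ∘ₗ L
  map_add' _ _ := rfl
  map_smul' _ _ := rfl

theorem complexTranspose_apply (L : Module.End ℝ V) (φ : V →ₗ[ℝ] ℂ) (v : V) :
    complexTranspose L φ v = φ (L v) := rfl

theorem complexTranspose_pow_apply (L : Module.End ℝ V) (k : ℕ) (φ : V →ₗ[ℝ] ℂ) (v : V) :
    (complexTranspose L ^ k) φ v = φ ((L ^ k) v) := by
  induction k generalizing φ with
  | zero => rfl
  | succ k ih => rw [pow_succ, Module.End.mul_apply, ih, complexTranspose_apply, pow_succ',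
      Module.End.mul_apply]

theorem aeval_complexTranspose_apply (L : Module.End ℝ V) (P : ℝ[X]) (φ : V →ₗ[ℝ] ℂ) (v : V) :
    aeval (complexTranspose L) (P.map (algebraMap ℝ ℂ)) φ v = φ (aeval L P v) := by
  induction P using Polynomial.induction_on' with
  | add p q hp hq => rw [Polynomial.map_add, map_add, map_add, LinearMap.add_apply,
      LinearMap.add_apply, LinearMap.add_apply, map_add, hp, hq]
  | monomial k a =>
    simp [aeval_monomial, complexTranspose_pow_apply, Module.algebraMap_end_apply]

variable [FiniteDimensional ℝ V]

/-- The minimal polynomial over `ℝ` is squarefree, hence separable, hence still squarefree over `ℂ`,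
and it annihilates the transpose. Working with complex-valued functionals gives complex eigenvectors
without complexifying `V`. -/
theorem isSemisimple_complexTranspose {L : Module.End ℝ V} (hL : L.IsSemisimple) :
    (complexTranspose L).IsSemisimple := by
  have hsep : (minpoly ℝ L).Separable :=
    PerfectField.separable_iff_squarefree.2 hL.minpoly_squarefree
  refine Module.End.isSemisimple_of_squarefree_aeval_eq_zero
    (p := (minpoly ℝ L).map (algebraMap ℝ ℂ)) hsep.map.squarefree ?_
  ext φ v
  rw [aeval_complexTranspose_apply, minpoly.aeval]
  simp

theorem iSup_eigenspace_complexTranspose {L : Module.End ℝ V} (hL : L.IsSemisimple) :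
    ⨆ μ : ℂ, (complexTranspose L).eigenspace μ = ⊤ := by
  rw [← Module.End.iSup_maxGenEigenspace_eq_top (complexTranspose L)]
  exact iSup_congr fun μ =>
    ((isSemisimple_complexTranspose hL).isFinitelySemisimple.maxGenEigenspace_eq_eigenspace μ).symm

theorem isRoot_charpoly_of_hasEigenvector {L : Module.End ℝ V} {μ : ℂ} {φ : V →ₗ[ℝ] ℂ}
    (h : (complexTranspose L).HasEigenvector μ φ) :
    (L.charpoly.map (algebraMap ℝ ℂ)).IsRoot μ := by
  have h1 := Module.End.aeval_apply_of_hasEigenvector (p := L.charpoly.map (algebraMap ℝ ℂ)) h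
  have h2 : aeval (complexTranspose L) (L.charpoly.map (algebraMap ℝ ℂ)) φ = 0 := by
    ext v
    rw [aeval_complexTranspose_apply, LinearMap.aeval_self_charpoly]
    simp
  rw [h2] at h1
  exact (smul_eq_zero.1 h1.symm).resolve_right h.2

/-- An eigenfunctional that does not vanish on `v` would have an eigenvalue `μ` with `μ ^ m = 1`, on
the unit circle. Eigenfunctionals span the dual, so all functionals vanish on `v`. -/
theorem IsSemisimpleHyperbolic.eq_zero_of_pow_apply_eq_self {L : Module.End ℝ V}
    (hL : IsSemisimpleHyperbolic L) {m : ℕ} (hm : m ≠ 0) {v : V} (hv : (L ^ m) v = v) : v = 0 := by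
  have key : ∀ φ : V →ₗ[ℝ] ℂ, φ v = 0 := by
    intro φ
    have hφ : φ ∈ ⨆ μ : ℂ, (complexTranspose L).eigenspace μ := by
      rw [iSup_eigenspace_complexTranspose hL.1]; trivial
    refine Submodule.iSup_induction _ (motive := fun φ : V →ₗ[ℝ] ℂ => φ v = 0) hφ ?_ (by simp)
      (fun φ ψ h1 h2 => by simp [h1, h2])
    intro μ ψ hψ
    by_contra hne
    have hev : (complexTranspose L).HasEigenvector μ ψ := ⟨hψ, fun h => hne (by simp [h])⟩
    have h1 : ψ ((L ^ m) v) = μ ^ m * ψ v := by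
      rw [← complexTranspose_pow_apply, hev.pow_apply]; simp
    rw [hv] at h1
    have h2 : μ ^ m = 1 := by
      have : (μ ^ m - 1) * ψ v = 0 := by rw [sub_mul, ← h1]; ring
      exact sub_eq_zero.1 ((mul_eq_zero.1 this).resolve_right hne)
    exact hL.2 μ (isRoot_charpoly_of_hasEigenvector hev)
      (by have := norm_pow μ m; rw [h2, norm_one] at this
          exact (pow_eq_one_iff_of_nonneg (norm_nonneg _) hm).1 this.symm)
  refine (Module.forall_dual_apply_eq_zero_iff ℝ v).1 fun f => ?_
  have := key (Complex.ofRealLI.toLinearMap ∘ₗ f)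
  simpa using this

/-- A semisimple hyperbolic endomorphism with an orbit that does not tend to `0` has an eigenvalue
outside the unit circle that bounds the growth of all orbits. -/
theorem IsSemisimpleHyperbolic.exists_dominant {L : Module.End ℝ V}
    (hL : IsSemisimpleHyperbolic L) {w : V}
    (hw : ¬ Filter.Tendsto (fun k : ℕ => (L ^ k) w) Filter.atTop (𝓝 0)) :
    ∃ (φ : V →L[ℝ] ℂ) (lam : ℂ) (C : ℝ), 1 < ‖lam‖ ∧ ‖Complex.reCLM ∘L φ‖ = 1 ∧
      (∀ v, φ (L v) = lam * φ v) ∧ 0 < C ∧ ∀ k v, ‖(L ^ k) v‖ ≤ C * ‖lam‖ ^ k * ‖v‖ := by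
  set T := complexTranspose L with hT
  have hfin : {μ | T.HasEigenvalue μ}.Finite := Module.End.finite_hasEigenvalue T
  have hVnt : Nontrivial V := by
    by_contra h
    rw [not_nontrivial_iff_subsingleton] at h
    exact hw (by simp [Subsingleton.elim _ (0 : V)])
  have hne : {μ | T.HasEigenvalue μ}.Nonempty := by
    have : Nontrivial (V →ₗ[ℝ] ℂ) := by
      obtain ⟨v, hv⟩ := exists_ne (0 : V)
      obtain ⟨f, hf⟩ := not_forall.1 (mt (Module.forall_dual_apply_eq_zero_iff ℝ v).1 hv)
      refine ⟨Complex.ofRealLI.toLinearMap ∘ₗ f, 0, fun h => hf ?_⟩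
      simpa using LinearMap.congr_fun h v
    exact Module.End.exists_eigenvalue T
  -- Since eigenfunctionals span, maximal modulus bounds the growth of every functional along orbits
  -- by `‖lam‖ ^ k`, without polynomial factors.
  obtain ⟨lam, hlam, hmax⟩ := Set.exists_max_image _ (fun μ : ℂ => ‖μ‖) hfin hne
  have hbound : ∀ φ : V →ₗ[ℝ] ℂ, ∃ C, 0 ≤ C ∧ ∀ k v, ‖φ ((L ^ k) v)‖ ≤ C * ‖lam‖ ^ k * ‖v‖ := by
    intro φ
    have hφ : φ ∈ ⨆ μ : ℂ, T.eigenspace μ := by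
      rw [iSup_eigenspace_complexTranspose hL.1]; trivial
    refine Submodule.iSup_induction _ (motive := fun φ : V →ₗ[ℝ] ℂ =>
      ∃ C, 0 ≤ C ∧ ∀ k v, ‖φ ((L ^ k) v)‖ ≤ C * ‖lam‖ ^ k * ‖v‖) hφ ?_ ⟨0, le_rfl, by simp⟩ ?_
    · intro μ ψ hψ
      rcases eq_or_ne ψ 0 with rfl | hψ0
      · exact ⟨0, le_rfl, by simp⟩
      have hev : T.HasEigenvector μ ψ := ⟨hψ, hψ0⟩
      have hμ : ‖μ‖ ≤ ‖lam‖ := hmax μ (Module.End.hasEigenvalue_of_hasEigenvector hev)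
      refine ⟨‖ψ.toContinuousLinearMap‖, norm_nonneg _, fun k v => ?_⟩
      have h1 : ψ ((L ^ k) v) = μ ^ k * ψ v := by
        rw [← complexTranspose_pow_apply, hev.pow_apply]; simp
      rw [h1, norm_mul, norm_pow]
      calc ‖μ‖ ^ k * ‖ψ v‖ ≤ ‖lam‖ ^ k * (‖ψ.toContinuousLinearMap‖ * ‖v‖) := by
            gcongr
            exact ψ.toContinuousLinearMap.le_opNorm v
        _ = _ := by ring
    · rintro φ ψ ⟨C, hC, h⟩ ⟨C', hC', h'⟩
      refine ⟨C + C', by positivity, fun k v => ?_⟩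
      calc ‖(φ + ψ) ((L ^ k) v)‖ ≤ ‖φ ((L ^ k) v)‖ + ‖ψ ((L ^ k) v)‖ := norm_add_le _ _
        _ ≤ _ := add_le_add (h k v) (h' k v)
        _ = _ := by ring
  obtain ⟨C, hC0, hC⟩ : ∃ C, 0 < C ∧ ∀ k v, ‖(L ^ k) v‖ ≤ C * ‖lam‖ ^ k * ‖v‖ := by
    let B := Module.finBasis ℝ V
    choose D hD0 hD using fun i => hbound (Complex.ofRealLI.toLinearMap ∘ₗ B.coord i)
    refine ⟨∑ i, D i * ‖B i‖ + 1, by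
      have : 0 ≤ ∑ i, D i * ‖B i‖ := Finset.sum_nonneg fun i _ => mul_nonneg (hD0 i) (norm_nonneg _)
      linarith, fun k v => ?_⟩
    calc ‖(L ^ k) v‖ = ‖∑ i, B.repr ((L ^ k) v) i • B i‖ := by rw [B.sum_repr]
      _ ≤ ∑ i, ‖B.repr ((L ^ k) v) i • B i‖ := norm_sum_le _ _
      _ ≤ ∑ i, (D i * ‖lam‖ ^ k * ‖v‖) * ‖B i‖ := by
          gcongr with i
          rw [norm_smul]
          gcongr
          simpa using hD i k v
      _ = (∑ i, D i * ‖B i‖) * (‖lam‖ ^ k * ‖v‖) := by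
          rw [Finset.sum_mul]; exact Finset.sum_congr rfl fun i _ => by ring
      _ ≤ (∑ i, D i * ‖B i‖ + 1) * (‖lam‖ ^ k * ‖v‖) := by gcongr; linarith
      _ = _ := by ring
  obtain ⟨ψ, hψ⟩ := Module.End.HasEigenvalue.exists_hasEigenvector hlam
  -- Modulus one is excluded by hyperbolicity, and modulus less than one would make the orbit of `w`
  -- tend to `0`.
  have hlam1 : 1 < ‖lam‖ := by
    refine lt_of_le_of_ne ?_ (hL.2 lam (isRoot_charpoly_of_hasEigenvector hψ)).symm
    by_contra hlt
    apply hw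
    have h1 : Filter.Tendsto (fun k : ℕ => C * ‖lam‖ ^ k * ‖w‖) Filter.atTop (𝓝 0) := by
      simpa using ((tendsto_pow_atTop_nhds_zero_of_lt_one (norm_nonneg lam)
        (not_le.1 hlt)).const_mul C).mul_const ‖w‖
    exact squeeze_zero_norm (fun k => hC k w) h1
  have hψL : ∀ v, ψ (L v) = lam * ψ v := fun v => by
    rw [← complexTranspose_apply, hψ.apply_eq_smul]; rfl
  -- If the real part of `ψ` vanishes, that of `I • ψ` does not.
  obtain ⟨χ, hχL, hχ⟩ : ∃ χ : V →L[ℝ] ℂ, (∀ v, χ (L v) = lam * χ v) ∧ Complex.reCLM ∘L χ ≠ 0 := by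
    by_cases hre : Complex.reCLM ∘L ψ.toContinuousLinearMap = 0
    · refine ⟨Complex.I • ψ.toContinuousLinearMap, fun v => ?_, fun him => hψ.2 ?_⟩
      · simp [hψL]; ring
      · ext v
        have h1 := DFunLike.congr_fun hre v
        have h2 := DFunLike.congr_fun him v
        simp at h1 h2
        exact Complex.ext (by simpa using h1) (by simpa using h2)
    · exact ⟨_, hψL, hre⟩
  refine ⟨‖Complex.reCLM ∘L χ‖⁻¹ • χ, lam, C, hlam1, ?_, fun v => ?_, hC0, hC⟩
  · rw [ContinuousLinearMap.comp_smul, norm_smul, norm_inv, norm_norm,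
      inv_mul_cancel₀ (norm_ne_zero_iff.2 hχ)]
  · simp [hχL]; ring

end LinearAlgebra

/-! ### Lattices in nilpotent groups -/

open scoped commutatorElement

section Commutators

theorem commutatorElement_mul_left_of_central {Q : Type*} [Group Q] {x x' y : Q}
    (h : ∀ z, Commute ⁅x', y⁆ z) : ⁅x * x', y⁆ = ⁅x, y⁆ * ⁅x', y⁆ := by
  have : ⁅x * x', y⁆ = x * ⁅x', y⁆ * (y * x⁻¹ * y⁻¹) := by
    simp only [commutatorElement_def]; group
  rw [this, ← (h x).eq, mul_assoc, (h _).eq]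
  simp only [commutatorElement_def]; group

theorem commutatorElement_mul_right_of_central {Q : Type*} [Group Q] {x y y' : Q}
    (h : ∀ z, Commute ⁅x, y'⁆ z) : ⁅x, y * y'⁆ = ⁅x, y⁆ * ⁅x, y'⁆ := by
  have : ⁅x, y * y'⁆ = ⁅x, y⁆ * (y * ⁅x, y'⁆ * y⁻¹) := by
    simp only [commutatorElement_def]; group
  rw [this, ← (h y).eq, mul_inv_cancel_right]

/-- Scalars can be moved across a separately continuous biadditive map into a Hausdorff group. -/
theorem biadditive_smul_comm {V Q : Type*} [NormedAddCommGroup V] [NormedSpace ℝ V] [Group Q]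
    [TopologicalSpace Q] [T2Space Q] {f : V → V → Q}
    (hl : ∀ u u' w, f (u + u') w = f u w * f u' w) (hr : ∀ u w w', f u (w + w') = f u w * f u w')
    (cl : ∀ w, Continuous fun u => f u w) (cr : ∀ u, Continuous (f u)) (t : ℝ) (u w : V) :
    f (t • u) w = f u (t • w) := by
  have zl : ∀ (n : ℤ) u w, f (n • u) w = f u w ^ n := fun n u w => by
    let g : Multiplicative V →* Q := MonoidHom.mk' (fun u => f u.toAdd w) fun a b => hl _ _ _
    simpa [g] using map_zpow g (Multiplicative.ofAdd u) n
  have zr : ∀ (n : ℤ) u w, f u (n • w) = f u w ^ n := fun n u w => by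
    let g : Multiplicative V →* Q := MonoidHom.mk' (fun w => f u w.toAdd) fun a b => hr _ _ _
    simpa [g] using map_zpow g (Multiplicative.ofAdd w) n
  -- Biadditivity settles rational `t`; density and continuity into a Hausdorff space give all real
  -- `t`.
  have hdense : DenseRange ((↑) : ℚ → ℝ) := Rat.denseRange_cast
  have c1 : Continuous fun t : ℝ => f (t • u) w := (cl w).comp (by fun_prop)
  have c2 : Continuous fun t : ℝ => f u (t • w) := (cr u).comp (by fun_prop)
  refine congrFun (hdense.equalizer c1 c2 (funext fun a => ?_)) t
  have hden : ((a.den : ℤ) : ℝ) ≠ 0 := by exact_mod_cast a.den_ne_zero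
  have key : ∀ v : V, (a.den : ℤ) • (((a.den : ℤ) : ℝ)⁻¹ • v) = v := fun v => by
    rw [← Int.cast_smul_eq_zsmul ℝ, smul_smul, mul_inv_cancel₀ hden, one_smul]
  have key2 : ∀ v : V, (a : ℝ) • v = a.num • (((a.den : ℤ) : ℝ)⁻¹ • v) := fun v => by
    rw [← Int.cast_smul_eq_zsmul ℝ, smul_smul]
    congr 1
    rw [Rat.cast_def, div_eq_mul_inv]
    norm_cast
  simp only [Function.comp_apply]
  rw [key2, key2]
  conv_lhs => rw [← key w]
  conv_rhs => rw [← key u]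
  rw [zl, zr, zl, zr, ← zpow_mul, ← zpow_mul, mul_comm]

variable {G ι : Type*} [Group G]

/-- The iterated commutators `⁅…⁅⁅y, e k₁⁆, e k₂⁆, …⁆`, the last index first. -/
def iterComm (e : ι → G) : List ι → G → G
  | [], y => y
  | k :: l, y => ⁅iterComm e l y, e k⁆

theorem iterComm_mem (e : ι → G) (l : List ι) (y : G) : iterComm e l y ∈ (⊤ : Subgroup G).lowerCentralSeries l.length := by
  induction l with
  | nil => exact Subgroup.mem_top y
  | cons k l ih => exact Subgroup.commutator_mem_commutator ih (Subgroup.mem_top _)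

theorem iterComm_mem_subgroup {e : ι → G} {H : Subgroup G} (he : ∀ k, e k ∈ H) (l : List ι) {y : G}
    (hy : y ∈ H) : iterComm e l y ∈ H := by
  induction l with
  | nil => exact hy
  | cons k l ih =>
    simp only [iterComm, commutatorElement_def]
    exact H.mul_mem (H.mul_mem (H.mul_mem ih (he k)) (H.inv_mem ih)) (H.inv_mem (he k))

end Commutators

/-! ### Closed lower central series and iterated commutators -/

section Lattice

variable {G : Type*} [Group G] [TopologicalSpace G] [IsTopologicalGroup G]

variable (G) in
/-- The closures of the terms of the lower central series. -/
def closedLowerCentralSeries (j : ℕ) : Subgroup G :=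
  ((⊤ : Subgroup G).lowerCentralSeries j).topologicalClosure

instance closedLowerCentralSeries_normal (j : ℕ) : (closedLowerCentralSeries G j).Normal :=
  Subgroup.is_normal_topologicalClosure _

instance closedLowerCentralSeries_isClosed (j : ℕ) :
    IsClosed (closedLowerCentralSeries G j : Set G) :=
  Subgroup.isClosed_topologicalClosure _

theorem lowerCentralSeries_le_closed (j : ℕ) : (⊤ : Subgroup G).lowerCentralSeries j ≤ closedLowerCentralSeries G j :=
  Subgroup.le_topologicalClosure _

theorem closedLowerCentralSeries_succ_le (j : ℕ) : closedLowerCentralSeries G (j + 1) ≤ closedLowerCentralSeries G j :=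
  Subgroup.topologicalClosure_mono (Subgroup.lowerCentralSeries_antitone _ (Nat.le_succ j))

/-- The inclusion passes from the terms of the lower central series to their closures because `z ↦
⁅z, y⁆` is continuous. Closed terms are used so that the quotients are Hausdorff, as
`biadditive_smul_comm` requires. -/
theorem commutatorElement_mem_closed {j : ℕ} {x : G} (hx : x ∈ closedLowerCentralSeries G j) (y : G) : ⁅x, y⁆ ∈ closedLowerCentralSeries G (j + 1) := by
  have hc : Continuous fun z : G => ⁅z, y⁆ := by
    simp only [commutatorElement_def]; fun_prop
  exact map_mem_closure (f := fun z : G => ⁅z, y⁆) hc hx fun z hz =>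
    Subgroup.commutator_mem_commutator hz (Subgroup.mem_top y)

theorem commute_mk_closed {j : ℕ} {x : G} (hx : x ∈ closedLowerCentralSeries G j) (z : G ⧸ closedLowerCentralSeries G (j + 1)) :
    Commute (x : G ⧸ closedLowerCentralSeries G (j + 1)) z := by
  induction z using QuotientGroup.induction_on with
  | H z =>
    rw [← commutatorElement_eq_one_iff_commute]
    exact (QuotientGroup.eq_one_iff _).2 (commutatorElement_mem_closed hx z)

theorem mk_commutator_mul_left {j : ℕ} {x x' : G} (hx' : x' ∈ closedLowerCentralSeries G j) (y : G) :
    ((⁅x * x', y⁆ : G) : G ⧸ closedLowerCentralSeries G (j + 2)) = (⁅x, y⁆ : G) * (⁅x', y⁆ : G) :=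
  commutatorElement_mul_left_of_central
    (x := (x : G ⧸ closedLowerCentralSeries G (j + 2))) (x' := x') (y := y)
    fun z => commute_mk_closed (commutatorElement_mem_closed hx' y) z

theorem mk_commutator_mul_right {j : ℕ} {x : G} (hx : x ∈ closedLowerCentralSeries G j) (y y' : G) :
    ((⁅x, y * y'⁆ : G) : G ⧸ closedLowerCentralSeries G (j + 2)) = (⁅x, y⁆ : G) * (⁅x, y'⁆ : G) :=
  commutatorElement_mul_right_of_central
    (x := (x : G ⧸ closedLowerCentralSeries G (j + 2))) (y := y) (y' := y')
    fun z => commute_mk_closed (commutatorElement_mem_closed hx y') z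

theorem mk_commutator_congr {j : ℕ} {x x' : G} (h : (x : G ⧸ closedLowerCentralSeries G (j + 1)) = x') (y : G) :
    ((⁅x, y⁆ : G) : G ⧸ closedLowerCentralSeries G (j + 2)) = (⁅x', y⁆ : G) := by
  have hd : x⁻¹ * x' ∈ closedLowerCentralSeries G (j + 1) := QuotientGroup.eq.1 h
  have h1 := mk_commutator_mul_left (x := x) (closedLowerCentralSeries_succ_le j hd) y
  rw [mul_inv_cancel_left] at h1
  rw [h1, (QuotientGroup.eq_one_iff _).2 (commutatorElement_mem_closed hd y), mul_one]

/-- Modulo the next closed term but one, `v ↦ ⁅x, v⁆` is a homomorphism with central values, so it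
kills commutators. Thus the commutator pairing depends on its second argument only through the
abelianization. -/
theorem mk_commutator_eq_one_of_mem_commutator {j : ℕ} {x w : G} (hx : x ∈ closedLowerCentralSeries G j)
    (hw : w ∈ commutator G) : ((⁅x, w⁆ : G) : G ⧸ closedLowerCentralSeries G (j + 2)) = 1 := by
  let f : G →* G ⧸ closedLowerCentralSeries G (j + 2) :=
    MonoidHom.mk' (fun v => ((⁅x, v⁆ : G) : G ⧸ closedLowerCentralSeries G (j + 2))) (mk_commutator_mul_right hx)
  have : commutator G ≤ f.ker := by
    rw [commutator_def, Subgroup.commutator_le]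
    intro a _ b _
    rw [MonoidHom.mem_ker, map_commutatorElement, commutatorElement_eq_one_iff_commute]
    exact commute_mk_closed (commutatorElement_mem_closed hx a) _
  exact this hw

variable {ι : Type*}

theorem continuous_iterComm (e : ι → G) (l : List ι) : Continuous (iterComm e l) := by
  induction l with
  | nil => exact continuous_id
  | cons k l ih =>
    simp only [iterComm, commutatorElement_def]
    fun_prop

theorem mk_iterComm_mul (e : ι → G) (l : List ι) (y y' : G) :
    ((iterComm e l (y * y') : G) : G ⧸ closedLowerCentralSeries G (l.length + 1)) =
      (iterComm e l y : G) * (iterComm e l y' : G) := by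
  induction l with
  | nil => rfl
  | cons k l ih =>
    have h1 : ((⁅iterComm e l (y * y'), e k⁆ : G) : G ⧸ closedLowerCentralSeries G (l.length + 2))
        = (⁅iterComm e l y * iterComm e l y', e k⁆ : G) :=
      mk_commutator_congr (by rw [ih]; rfl) _
    exact h1.trans (mk_commutator_mul_left
      (lowerCentralSeries_le_closed _ (iterComm_mem e l y')) _)

theorem iterComm_mem_of_mem_commutator (e : ι → G) (l : List ι) {w : G} (hw : w ∈ commutator G) :
    iterComm e l w ∈ closedLowerCentralSeries G (l.length + 1) := by
  induction l with
  | nil => exact lowerCentralSeries_le_closed 1 hw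
  | cons k l ih => exact commutatorElement_mem_closed ih _

/-- Iterated commutators as homomorphisms into the quotients of the closed lower central series. -/
def iterCommHom (e : ι → G) {j : ℕ} (l : List.Vector ι j) : G →* G ⧸ closedLowerCentralSeries G (j + 1) :=
  MonoidHom.mk' (fun y => ((iterComm e l.1 y : G) : G ⧸ closedLowerCentralSeries G (j + 1))) (by
    obtain ⟨l, rfl⟩ := l
    exact mk_iterComm_mul e l)

variable {V : Type*} [NormedAddCommGroup V] [NormedSpace ℝ V] {P : G → V}

/-- The lower central series is spanned by iterated commutators with a spanning set of the
abelianization. -/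
theorem mk_mem_iSup_range_iterCommHom (hmul : ∀ x y, P (x * y) = P x + P y) (hcont : Continuous P)
    (hsurj : Function.Surjective P) (hopen : IsOpenMap P) (hker : ∀ x, P x = 0 ↔ x ∈ commutator G)
    {e : ι → G} (he : Submodule.span ℝ (range fun k => P (e k)) = ⊤) (j : ℕ) {x : G}
    (hx : x ∈ (⊤ : Subgroup G).lowerCentralSeries j) : (x : G ⧸ closedLowerCentralSeries G (j + 1)) ∈ ⨆ l : List.Vector ι j, (iterCommHom e l).range := by
  have hP1 : P 1 = 0 := by have := hmul 1 1; rw [mul_one] at this; simpa using this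
  have hPeq : ∀ x y, P x = P y → x⁻¹ * y ∈ commutator G := fun x y h => by
    have h1 := hmul x⁻¹ x
    rw [inv_mul_cancel, hP1] at h1
    rw [← hker, hmul, ← h, ← h1]
  have hquot : IsOpenQuotientMap P := ⟨hsurj, hcont, hopen⟩
  induction j generalizing x with
  | zero =>
    exact Subgroup.mem_iSup_of_mem (⟨[], rfl⟩ : List.Vector ι 0) ⟨x, rfl⟩
  | succ j ih =>
    set A : Subgroup (G ⧸ closedLowerCentralSeries G (j + 2)) := ⨆ l : List.Vector ι (j + 1), (iterCommHom e l).range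
    have hgen : ∀ (l : List.Vector ι j) (y v : G),
        ((⁅iterComm e l.1 y, v⁆ : G) : G ⧸ closedLowerCentralSeries G (j + 2)) ∈ A := by
      rintro ⟨l, rfl⟩ y v
      let B : G → G → G ⧸ closedLowerCentralSeries G (l.length + 2) := fun y v => ((⁅iterComm e l y, v⁆ : G) : _)
      have hmem : ∀ y, iterComm e l y ∈ closedLowerCentralSeries G l.length := fun y =>
        lowerCentralSeries_le_closed _ (iterComm_mem e l y)
      have hBl : ∀ y y' v, B (y * y') v = B y v * B y' v := fun y y' v =>
        (mk_commutator_congr (x' := iterComm e l y * iterComm e l y')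
          (mk_iterComm_mul e l y y') v).trans (mk_commutator_mul_left (hmem y') v)
      have hBr : ∀ y v v', B y (v * v') = B y v * B y v' := fun y v v' =>
        mk_commutator_mul_right (hmem y) v v'
      have hBl' : ∀ y y' v, P y = P y' → B y v = B y' v := fun y y' v h => by
        have h1 : B (y⁻¹ * y') v = 1 := (QuotientGroup.eq_one_iff _).2
          (commutatorElement_mem_closed (iterComm_mem_of_mem_commutator e l (hPeq y y' h)) v)
        rw [← mul_inv_cancel_left y y', hBl, h1, mul_one]
      have hBr' : ∀ y v v', P v = P v' → B y v = B y v' := fun y v v' h => by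
        have h1 : B y (v⁻¹ * v') = 1 :=
          mk_commutator_eq_one_of_mem_commutator (hmem y) (hPeq v v' h)
        rw [← mul_inv_cancel_left v v', hBr, h1, mul_one]
      let s : V → G := Function.surjInv hsurj
      have hs : ∀ v, P (s v) = v := Function.surjInv_eq hsurj
      have hBcl : ∀ v, Continuous fun y => B y v := fun v => by
        have h1 := continuous_iterComm e l
        have h2 : Continuous fun y => ⁅iterComm e l y, v⁆ := by
          simp only [commutatorElement_def]; fun_prop
        exact QuotientGroup.continuous_mk.comp h2
      have hBcr : ∀ y, Continuous fun v => B y v := fun y => by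
        have h2 : Continuous fun v : G => ⁅iterComm e l y, v⁆ := by
          simp only [commutatorElement_def]; fun_prop
        exact QuotientGroup.continuous_mk.comp h2
      -- Both arguments of `B` matter only through `P`, so `B` descends to a separately continuous
      -- biadditive map on `V × V`, and real scalars can be moved across it.
      have hswap := biadditive_smul_comm (f := fun u w => B (s u) (s w))
        (fun u u' w => by
          rw [← hBl]; exact hBl' _ _ _ (by rw [hmul, hs, hs, hs]))
        (fun u w w' => by
          rw [← hBr]; exact hBr' _ _ _ (by rw [hmul, hs, hs, hs]))
        (fun w => by
          rw [hquot.isQuotientMap.continuous_iff]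
          exact (hBcl (s w)).congr fun y => hBl' _ _ _ (by simp [hs]))
        (fun u => by
          rw [hquot.isQuotientMap.continuous_iff]
          exact (hBcr (s u)).congr fun y => hBr' _ _ _ (by simp [hs]))
      -- The induction over the real span keeps `u` arbitrary, because a scalar on `w` is absorbed
      -- by `u`. In this way finitely or infinitely many spanning vectors `P (e k)` suffice although
      -- `A` is only a group.
      have hall : ∀ w u : V, B (s u) (s w) ∈ A := by
        intro w
        have hw : w ∈ Submodule.span ℝ (range fun k => P (e k)) := by rw [he]; trivial
        induction hw using Submodule.span_induction with
        | mem w hw =>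
          obtain ⟨k, rfl⟩ := hw
          intro u
          rw [hBr' (s u) (s (P (e k))) (e k) (hs _)]
          exact Subgroup.mem_iSup_of_mem (⟨k :: l, rfl⟩ : List.Vector ι (l.length + 1)) ⟨s u, rfl⟩
        | zero =>
          intro u
          rw [hBr' (s u) (s 0) 1 (by rw [hs, hP1])]
          have : B (s u) 1 = 1 := by simp [B]
          rw [this]
          exact A.one_mem
        | add w w' _ _ h h' =>
          intro u
          rw [hBr' (s u) (s (w + w')) (s w * s w') (by rw [hmul, hs, hs, hs]), hBr]
          exact A.mul_mem (h u) (h' u)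
        | smul t w _ h =>
          intro u
          rw [← hswap]
          exact h _
      change B y v ∈ A
      rw [hBl' y (s (P y)) v (hs _).symm, hBr' _ v (s (P v)) (hs _).symm]
      exact hall _ _
    have hle : (⊤ : Subgroup G).lowerCentralSeries (j + 1) ≤ A.comap (QuotientGroup.mk' (closedLowerCentralSeries G (j + 2))) := by
      rw [Subgroup.lowerCentralSeries_succ, Subgroup.commutator_le]
      intro x hx v _
      obtain ⟨x₀, hx₀, hxx₀, h⟩ : ∃ x₀ ∈ closedLowerCentralSeries G j, (x₀ : G ⧸ closedLowerCentralSeries G (j + 1)) = x ∧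
          ((⁅x₀, v⁆ : G) : G ⧸ closedLowerCentralSeries G (j + 2)) ∈ A := by
        refine Subgroup.iSup_induction _ (C := fun z => ∃ x₀ ∈ closedLowerCentralSeries G j, (x₀ : G ⧸ closedLowerCentralSeries G (j + 1)) = z ∧
          ((⁅x₀, v⁆ : G) : G ⧸ closedLowerCentralSeries G (j + 2)) ∈ A) (ih hx) ?_ ?_ ?_
        · rintro l _ ⟨y, rfl⟩
          refine ⟨iterComm e l.1 y, ?_, rfl, hgen l y v⟩
          obtain ⟨l, rfl⟩ := l
          exact lowerCentralSeries_le_closed _ (iterComm_mem e l y)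
        · exact ⟨1, one_mem _, rfl, by simp⟩
        · rintro z z' ⟨x, hx, rfl, h⟩ ⟨x', hx', rfl, h'⟩
          exact ⟨x * x', mul_mem hx hx', rfl, by
            rw [mk_commutator_mul_left hx']; exact A.mul_mem h h'⟩
      change ((⁅x, v⁆ : G) : G ⧸ closedLowerCentralSeries G (j + 2)) ∈ A
      rwa [← mk_commutator_congr hxx₀]
    exact hle hx

end Lattice

/-! ### Cocompactness along the lower central series and discreteness of the image lattice -/

section LatticeCompact

open scoped Pointwise

variable {G : Type*} [Group G] [TopologicalSpace G]

theorem isClosed_of_finite_inter_isCompact {X : Type*} [TopologicalSpace X] [T2Space X]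
    [WeaklyLocallyCompactSpace X] {A : Set X} (hA : ∀ K, IsCompact K → (A ∩ K).Finite) :
    IsClosed A := by
  refine isClosed_of_closure_subset fun x hx => ?_
  obtain ⟨K, hK, hKx⟩ := exists_compact_mem_nhds x
  have h1 : x ∈ closure (A ∩ K) := by
    rw [mem_closure_iff_nhds] at hx ⊢
    intro t ht
    obtain ⟨y, ⟨hy1, hy2⟩, hy3⟩ := hx (t ∩ K) (Filter.inter_mem ht hKx)
    exact ⟨y, hy1, hy3, hy2⟩
  rw [(hA K hK).isClosed.closure_eq] at h1
  exact h1.1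

variable {V : Type*} [NormedAddCommGroup V] [NormedSpace ℝ V] {P : G → V}

/-- Discrete cocompact subgroups span the abelianization. -/
theorem span_image_eq_top_of_cocompact [FiniteDimensional ℝ V]
    (hmul : ∀ x y, P (x * y) = P x + P y) (hcont : Continuous P) (hsurj : Function.Surjective P)
    {Λ : Subgroup G} {K : Set G} (hK : IsCompact K) (hKΛ : ∀ y, ∃ k ∈ K, ∃ l ∈ Λ, y = k * l) :
    Submodule.span ℝ (P '' Λ) = ⊤ := by
  by_contra hne
  obtain ⟨f, hf, hle⟩ := Submodule.exists_le_ker_of_lt_top _ (lt_top_iff_ne_top.2 hne)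
  obtain ⟨v, hv⟩ : ∃ v, f v ≠ 0 := by
    by_contra h
    exact hf (LinearMap.ext fun v => not_not.1 fun h' => h ⟨v, h'⟩)
  have hc : Continuous fun x => f (P x) := f.continuous_of_finiteDimensional.comp hcont
  obtain ⟨C, hC⟩ := hK.exists_bound_of_continuousOn hc.continuousOn
  have hbound : ∀ w, ‖f w‖ ≤ C := by
    intro w
    obtain ⟨y, rfl⟩ := hsurj w
    obtain ⟨k, hk, l, hl, rfl⟩ := hKΛ y
    have : f (P l) = 0 := hle (Submodule.subset_span ⟨l, hl, rfl⟩)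
    rw [hmul, map_add, this, add_zero]
    exact hC k hk
  have h1 := hbound (((|C| + 1) / f v) • v)
  rw [map_smul, smul_eq_mul, div_mul_cancel₀ _ hv, Real.norm_eq_abs,
    abs_of_pos (by positivity)] at h1
  linarith [le_abs_self C]

variable [IsTopologicalGroup G]

/-- A subgroup of a quotient of `G` by the closed lower central series is covered by a compact set
and lattice elements. -/
def IsTame (Λ : Subgroup G) {j : ℕ} (A : Subgroup (G ⧸ closedLowerCentralSeries G (j + 1))) :
    Prop :=
  (∀ a ∈ A, ∀ z, Commute a z) ∧ ∃ K : Set G, IsCompact K ∧ ∀ a ∈ A, ∃ k ∈ K, ∃ l ∈ Λ,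
    l ∈ (⊤ : Subgroup G).lowerCentralSeries j ∧
      a = (k : G ⧸ closedLowerCentralSeries G (j + 1)) * l

/-- The subgroups are central, so the supremum consists of products `a * b`. In `k * l * k' * l'`
the element `l` is central modulo the next term, so the lattice factors can be gathered on the
right. -/
theorem IsTame.sup {Λ : Subgroup G} {j : ℕ}
    {A B : Subgroup (G ⧸ closedLowerCentralSeries G (j + 1))} (hA : IsTame Λ A)
    (hB : IsTame Λ B) : IsTame Λ (A ⊔ B) := by
  obtain ⟨hA, K, hK, hAK⟩ := hA
  obtain ⟨hB, K', hK', hBK⟩ := hB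
  have : B.Normal := ⟨fun b hb g => by rwa [← (hB b hb g).eq, mul_inv_cancel_right]⟩
  refine ⟨fun x hx z => ?_, K * K', hK.mul hK', fun x hx => ?_⟩
  all_goals obtain ⟨a, ha, b, hb, rfl⟩ := Subgroup.mem_sup_of_normal_right.1 hx
  · exact (hA a ha z).mul_left (hB b hb z)
  · obtain ⟨k, hk, l, hl, hlj, rfl⟩ := hAK a ha
    obtain ⟨k', hk', l', hl', hlj', rfl⟩ := hBK b hb
    refine ⟨k * k', Set.mul_mem_mul hk hk', l * l', mul_mem hl hl', mul_mem hlj hlj', ?_⟩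
    rw [QuotientGroup.mk_mul, QuotientGroup.mk_mul, mul_assoc, mul_assoc,
      (commute_mk_closed (lowerCentralSeries_le_closed j hlj) _).left_comm]

theorem isTame_bot (Λ : Subgroup G) (j : ℕ) :
    IsTame Λ (⊥ : Subgroup (G ⧸ closedLowerCentralSeries G (j + 1))) :=
  ⟨fun a ha z => by rw [Subgroup.mem_bot.1 ha]; exact Commute.one_left z, {1}, isCompact_singleton,
    fun a ha => ⟨1, rfl, 1, one_mem _, one_mem _, by rw [Subgroup.mem_bot.1 ha]; simp⟩⟩

theorem isTame_iSup {Λ : Subgroup G} {j : ℕ} {κ : Type*} [Finite κ]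
    {A : κ → Subgroup (G ⧸ closedLowerCentralSeries G (j + 1))} (hA : ∀ i, IsTame Λ (A i)) :
    IsTame Λ (⨆ i, A i) := by
  have := Fintype.ofFinite κ
  rw [← Finset.sup_univ_eq_iSup]
  exact Finset.sup_induction (isTame_bot Λ j) (fun _ ha _ hb => ha.sup hb) fun i _ => hA i

/-- For `y = k * m` with `m` in the lattice, the homomorphism property splits the iterated
commutator into one depending continuously on `k` and one formed from lattice elements only. -/
theorem isTame_range_iterCommHom {ι : Type*} {Λ : Subgroup G} {e : ι → G} (he : ∀ k, e k ∈ Λ)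
    {K : Set G} (hK : IsCompact K) (hKΛ : ∀ y, ∃ k ∈ K, ∃ l ∈ Λ, y = k * l) {j : ℕ}
    (l : List.Vector ι j) : IsTame Λ (iterCommHom e l).range := by
  have hmem : ∀ y, iterComm e l.1 y ∈ (⊤ : Subgroup G).lowerCentralSeries j := fun y => by
    obtain ⟨l, rfl⟩ := l
    exact iterComm_mem e l y
  refine ⟨?_, iterComm e l.1 '' K, hK.image (continuous_iterComm e l.1), ?_⟩
  · rintro _ ⟨y, rfl⟩ z
    exact commute_mk_closed (lowerCentralSeries_le_closed j (hmem y)) z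
  · rintro _ ⟨y, rfl⟩
    obtain ⟨k, hk, m, hm, rfl⟩ := hKΛ y
    exact ⟨_, ⟨k, hk, rfl⟩, iterComm e l.1 m, iterComm_mem_subgroup he l.1 hm, hmem m,
      map_mul (iterCommHom e l) k m⟩

/-- In a nilpotent group, a discrete cocompact subgroup meets the closed lower central series in
cocompact subgroups. -/
theorem exists_compact_closedLowerCentralSeries [T2Space G] [WeaklyLocallyCompactSpace G]
    [Group.IsNilpotent G] [FiniteDimensional ℝ V]
    (hmul : ∀ x y, P (x * y) = P x + P y) (hcont : Continuous P) (hsurj : Function.Surjective P)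
    (hopen : IsOpenMap P) (hker : ∀ x, P x = 0 ↔ x ∈ commutator G)
    {Λ : Subgroup G} (hΛ : ∀ K, IsCompact K → ((Λ : Set G) ∩ K).Finite) {K : Set G}
    (hK : IsCompact K) (hKΛ : ∀ y, ∃ k ∈ K, ∃ l ∈ Λ, y = k * l) (j : ℕ) :
    ∃ K' : Set G, IsCompact K' ∧ ∀ x ∈ closedLowerCentralSeries G j, ∃ k ∈ K', ∃ l ∈ Λ,
      l ∈ (⊤ : Subgroup G).lowerCentralSeries j ∧ x = k * l := by
  obtain ⟨c, hc⟩ := Subgroup.nilpotent_iff_lowerCentralSeries.1 ‹Group.IsNilpotent G›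
  obtain ⟨f, hfΛ, hf, -⟩ := Submodule.exists_fun_fin_finrank_span_eq ℝ (P '' (Λ : Set G))
  choose e he hef using hfΛ
  have hspan : Submodule.span ℝ (range fun k => P (e k)) = ⊤ := by
    simp only [hef]
    rw [← span_image_eq_top_of_cocompact hmul hcont hsurj hK hKΛ]
    exact hf
  -- Descending induction on `j`, starting where the lower central series has become trivial.
  suffices H : ∀ m j, c ≤ j + m → ∃ K' : Set G, IsCompact K' ∧
      ∀ x ∈ closedLowerCentralSeries G j, ∃ k ∈ K', ∃ l ∈ Λ,
        l ∈ (⊤ : Subgroup G).lowerCentralSeries j ∧ x = k * l from H c j (Nat.le_add_left c j)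
  intro m
  induction m with
  | zero =>
    intro j hj
    refine ⟨{1}, isCompact_singleton, fun x hx => ⟨1, rfl, 1, one_mem _, one_mem _, ?_⟩⟩
    have h1 : (⊤ : Subgroup G).lowerCentralSeries j = ⊥ :=
      le_bot_iff.1 (hc ▸ Subgroup.lowerCentralSeries_antitone _ hj)
    have h2 : x ∈ closure (((⊤ : Subgroup G).lowerCentralSeries j : Subgroup G) : Set G) := hx
    rw [h1, Subgroup.coe_bot, closure_singleton, mem_singleton_iff] at h2
    rw [h2, mul_one]
  | succ m ih =>
    intro j hj
    obtain ⟨K₁, hK₁, h₁⟩ := ih (j + 1) (by omega)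
    obtain ⟨-, K₂, hK₂, h₂⟩ := isTame_iSup (isTame_range_iterCommHom he hK hKΛ (j := j))
    set Λj : Set G := (Λ : Set G) ∩ ((⊤ : Subgroup G).lowerCentralSeries j : Subgroup G)
    -- A compact set times a closed set is closed, so the covering obtained for the lower central
    -- series extends to its closure.
    have hΛj : IsClosed Λj := isClosed_of_finite_inter_isCompact fun C hC =>
      (hΛ C hC).subset (inter_subset_inter_left _ inter_subset_left)
    have hsub : (((⊤ : Subgroup G).lowerCentralSeries j : Subgroup G) : Set G) ⊆
        (K₂ * K₁) * Λj := by
      intro x hx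
      obtain ⟨k, hk, l, hl, hlj, hkl⟩ := h₂ _
        (mk_mem_iSup_range_iterCommHom hmul hcont hsurj hopen hker hspan j hx)
      have hd : (k * l)⁻¹ * x ∈ closedLowerCentralSeries G (j + 1) :=
        QuotientGroup.eq.1 (by rw [hkl]; rfl)
      -- The remainder is conjugated past `l`, so that its own lattice factor ends up on the right
      -- next to `l`.
      have hd' : l * ((k * l)⁻¹ * x) * l⁻¹ ∈ closedLowerCentralSeries G (j + 1) :=
        (closedLowerCentralSeries_normal (j + 1)).conj_mem _ hd l
      obtain ⟨k', hk', l', hl', hlj', hkl'⟩ := h₁ _ hd'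
      refine ⟨k * k', Set.mul_mem_mul hk hk', l' * l, ⟨mul_mem hl' hl,
        mul_mem (Subgroup.lowerCentralSeries_antitone _ (Nat.le_succ j) hlj') hlj⟩, ?_⟩
      have : k * k' * (l' * l) = k * (k' * l') * l := by group
      change k * k' * (l' * l) = x
      rw [this, ← hkl']
      group
    refine ⟨K₂ * K₁, hK₂.mul hK₁, fun x hx => ?_⟩
    have h3 := closure_minimal hsub (hΛj.mul_left_of_isCompact (hK₂.mul hK₁)) hx
    obtain ⟨k, hk, l, hl, rfl⟩ := h3
    exact ⟨k, hk, l, hl.1, hl.2, rfl⟩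

theorem IsOpenMap.exists_compact_subset_image {X Y : Type*} [TopologicalSpace X]
    [TopologicalSpace Y] [WeaklyLocallyCompactSpace X] {f : X → Y} (hf : IsOpenMap f)
    (hsurj : Function.Surjective f) {C : Set Y} (hC : IsCompact C) :
    ∃ K, IsCompact K ∧ C ⊆ f '' K := by
  refine hC.induction_on (p := fun s => ∃ K, IsCompact K ∧ s ⊆ f '' K) ⟨∅, isCompact_empty, by simp⟩
    (fun s t hst ⟨K, hK, h⟩ => ⟨K, hK, hst.trans h⟩)
    (fun s t ⟨K, hK, h⟩ ⟨K', hK', h'⟩ => ⟨K ∪ K', hK.union hK', by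
      rw [image_union]; exact union_subset_union h h'⟩) fun y _ => ?_
  obtain ⟨x, rfl⟩ := hsurj y
  obtain ⟨K, hK, hKx⟩ := exists_compact_mem_nhds x
  exact ⟨f '' K, mem_nhdsWithin_of_mem_nhds (hf.image_mem_nhds hKx), K, hK, Subset.rfl⟩

/-- The image of a discrete cocompact subgroup of a nilpotent group in the abelianization is
discrete. -/
theorem finite_image_lattice_inter [T2Space G] [WeaklyLocallyCompactSpace G]
    [Group.IsNilpotent G] [FiniteDimensional ℝ V]
    (hmul : ∀ x y, P (x * y) = P x + P y) (hcont : Continuous P) (hsurj : Function.Surjective P)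
    (hopen : IsOpenMap P) (hker : ∀ x, P x = 0 ↔ x ∈ commutator G)
    {Λ : Subgroup G} (hΛ : ∀ K, IsCompact K → ((Λ : Set G) ∩ K).Finite) {K : Set G}
    (hK : IsCompact K) (hKΛ : ∀ y, ∃ k ∈ K, ∃ l ∈ Λ, y = k * l) {C : Set V} (hC : IsCompact C) :
    (P '' Λ ∩ C).Finite := by
  obtain ⟨K₁, hK₁, h₁⟩ := exists_compact_closedLowerCentralSeries hmul hcont hsurj hopen hker hΛ hK
    hKΛ 1
  obtain ⟨K₂, hK₂, h₂⟩ := hopen.exists_compact_subset_image hsurj hC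
  refine ((hΛ _ (hK₂.mul hK₁)).image P).subset ?_
  rintro _ ⟨⟨l, hl, rfl⟩, hlC⟩
  obtain ⟨u, hu, hul⟩ := h₂ hlC
  have hP1 : P 1 = 0 := by have := hmul 1 1; rw [mul_one] at this; simpa using this
  have hmem : u⁻¹ * l ∈ commutator G := by
    have h1 := hmul u⁻¹ u
    rw [inv_mul_cancel, hP1] at h1
    rw [← hker, hmul, ← hul, ← h1]
  obtain ⟨k, hk, m, hm, hm1, hkm⟩ := h₁ _ (lowerCentralSeries_le_closed 1 hmem)
  have hPm : P m = 0 := (hker m).2 hm1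
  -- The element `u * k = l * m⁻¹` lies in the lattice and in the compact set `K₂ * K₁`, and has the
  -- same image as `l`. This leaves finitely many images.
  have e : l = u * k * m := by rw [mul_assoc, ← hkm]; group
  refine ⟨u * k, ⟨?_, Set.mul_mem_mul hu hk⟩, ?_⟩
  · have : u * k = l * m⁻¹ := by rw [e]; group
    rw [this]
    exact mul_mem hl (inv_mem hm)
  · rw [e, hmul _ m, hPm, add_zero]

end LatticeCompact

/-! ### Metric geometry of the group -/

section Uniform

/-- A local property with a decreasing parameter that is transported from a compact set to the whole
space holds with a uniform parameter. -/
theorem exists_uniform_of_local {X : Type*} [TopologicalSpace X] {K : Set X} (hK : IsCompact K)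
    {Q : ℝ → X → Prop} (hmono : ∀ x c c', 0 < c' → c' ≤ c → Q c x → Q c' x)
    (hKQ : ∀ y, ∃ k ∈ K, ∀ c, 0 < c → Q c k → Q c y)
    (hloc : ∀ x₀, ∃ c > 0, ∀ᶠ x in 𝓝 x₀, Q c x) : ∃ c > 0, ∀ x, Q c x := by
  obtain ⟨c, hc, h⟩ := hK.induction_on (p := fun s => ∃ c > 0, ∀ x ∈ s, Q c x)
    ⟨1, one_pos, by simp⟩ (fun s t hst ⟨c, hc, h⟩ => ⟨c, hc, fun x hx => h x (hst hx)⟩)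
    (fun s t ⟨c, hc, h⟩ ⟨c', hc', h'⟩ => ⟨min c c', lt_min hc hc', fun x hx => hx.elim
      (fun hx => hmono x c _ (lt_min hc hc') (min_le_left _ _) (h x hx))
      (fun hx => hmono x c' _ (lt_min hc hc') (min_le_right _ _) (h' x hx))⟩)
    (fun x₀ _ => by
      obtain ⟨c, hc, h⟩ := hloc x₀
      exact ⟨{x | Q c x}, mem_nhdsWithin_of_mem_nhds h, c, hc, fun x hx => hx⟩)
  exact ⟨c, hc, fun y => by
    obtain ⟨k, hk, hky⟩ := hKQ y
    exact hky c hc (h k hk)⟩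

end Uniform

/-! ### Lipschitz and ascent estimates for homomorphisms to a vector space -/

section MetricGroup

variable {N : Type*} [MetricSpace N]

/-- The space has bi-Lipschitz charts in `ℝ^n`. -/
def HasBiLipschitzCharts (n : ℕ) (N : Type*) [MetricSpace N] : Prop :=
  ∀ x₀ : N, ∃ e : OpenPartialHomeomorph N (EuclideanSpace ℝ (Fin n)), x₀ ∈ e.source ∧
    ∃ C : ℝ, 0 < C ∧ ∀ x ∈ e.source, ∀ y ∈ e.source,
      dist x y ≤ C * dist (e x) (e y) ∧ dist (e x) (e y) ≤ C * dist x y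

/-- Balls contain `m ^ n` points of mutual distance comparable to `1 / m` times the radius. -/
theorem HasBiLipschitzCharts.exists_packing {n : ℕ} (h : HasBiLipschitzCharts n N) (x₀ : N) :
    ∃ c > 0, ∀ᶠ x in 𝓝 x₀, ∀ (ρ : ℝ) (m : ℕ), 0 < ρ → ρ ≤ c → 0 < m → ∃ ξ : Fin (m ^ n) → N,
      (∀ i, dist (ξ i) x ≤ ρ) ∧ ∀ i j, i ≠ j → c * ρ / m ≤ dist (ξ i) (ξ j) := by
  obtain ⟨e, hx₀, C, hC, he⟩ := h x₀
  obtain ⟨R, hR, hRe⟩ : ∃ R > 0, Metric.ball (e x₀) (2 * R) ⊆ e.target := by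
    obtain ⟨R, hR, h⟩ := Metric.isOpen_iff.1 e.open_target (e x₀) (e.map_source hx₀)
    exact ⟨R / 2, by positivity, by rwa [mul_div_cancel₀ _ two_ne_zero]⟩
  refine ⟨min (C * R) (C ^ 2 * (n + 1))⁻¹, by positivity, ?_⟩
  have h1 : ∀ᶠ x in 𝓝 x₀, e x ∈ Metric.ball (e x₀) R :=
    (e.continuousAt hx₀).eventually (Metric.ball_mem_nhds _ hR)
  filter_upwards [h1, e.open_source.mem_nhds hx₀] with x hx hxs ρ m hρ hρc hm
  have hm0 : (0 : ℝ) < m := by exact_mod_cast hm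
  -- The cubic grid with `m` points per axis has integer vectors of norm at most `n * m`; scaled by
  -- `s` it has radius at most `ρ / C` in the chart, hence at most `ρ` in the space.
  set s : ℝ := ρ / (C * (n + 1) * m) with hs
  have hs0 : 0 < s := by positivity
  let v : (Fin n → Fin m) → EuclideanSpace ℝ (Fin n) := fun i =>
    WithLp.toLp 2 fun k => ((i k : ℕ) : ℝ)
  have hv : ∀ i, ‖v i‖ ≤ n * m := by
    intro i
    have h2 : v i = ∑ k, ((i k : ℕ) : ℝ) • EuclideanSpace.single k (1 : ℝ) := by
      ext k
      simp [v, Finset.sum_apply, Pi.single_apply]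
    rw [h2]
    refine (norm_sum_le _ _).trans ?_
    calc ∑ k, ‖((i k : ℕ) : ℝ) • EuclideanSpace.single k (1 : ℝ)‖ ≤ ∑ _k : Fin n, (m : ℝ) := by
          gcongr with k
          rw [norm_smul]
          simp only [PiLp.norm_single, norm_one, mul_one, Real.norm_natCast]
          exact_mod_cast (i k).2.le
      _ = n * m := by simp
  have hsep : ∀ i j, i ≠ j → 1 ≤ ‖v i - v j‖ := by
    intro i j hij
    obtain ⟨k, hk⟩ := Function.ne_iff.1 hij
    refine le_trans ?_ (PiLp.norm_apply_le (v i - v j) k)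
    have h3 : ((i k : ℕ) : ℤ) - ((j k : ℕ) : ℤ) ≠ 0 := by
      rw [sub_ne_zero]; exact_mod_cast fun h => hk (Fin.ext h)
    have h4 : (1 : ℝ) ≤ |(((i k : ℕ) : ℤ) - ((j k : ℕ) : ℤ) : ℤ)| := by
      exact_mod_cast Int.one_le_abs h3
    simpa [v] using h4
  have hnorm : ∀ i, ‖s • v i‖ ≤ ρ / C := by
    intro i
    rw [norm_smul, Real.norm_of_nonneg hs0.le]
    calc s * ‖v i‖ ≤ s * ((n + 1) * m) := by
          gcongr; exact (hv i).trans (by gcongr; linarith)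
      _ = ρ / C := by rw [hs]; field_simp
  have htarget : ∀ i, e x + s • v i ∈ e.target := by
    intro i
    apply hRe
    rw [Metric.mem_ball, dist_eq_norm, add_sub_right_comm]
    refine (norm_add_le _ _).trans_lt ?_
    have h5 : ρ / C ≤ R := by
      rw [div_le_iff₀ hC, mul_comm]; exact hρc.trans (min_le_left _ _)
    have := hnorm i
    rw [Metric.mem_ball, dist_eq_norm] at hx
    linarith
  refine ⟨fun i => e.symm (e x + s • v (finFunctionFinEquiv.symm i)), fun i => ?_,
    fun i j hij => ?_⟩
  · have h6 := (he _ (e.map_target (htarget (finFunctionFinEquiv.symm i))) x hxs).1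
    rw [e.right_inv (htarget _), dist_eq_norm, add_sub_cancel_left] at h6
    calc _ ≤ C * ‖s • v (finFunctionFinEquiv.symm i)‖ := h6
      _ ≤ C * (ρ / C) := by gcongr; exact hnorm _
      _ = ρ := by field_simp
  · have h6 := (he _ (e.map_target (htarget (finFunctionFinEquiv.symm i))) _
      (e.map_target (htarget (finFunctionFinEquiv.symm j)))).2
    rw [e.right_inv (htarget _), e.right_inv (htarget _), dist_eq_norm, add_sub_add_left_eq_sub,
      ← smul_sub, norm_smul, Real.norm_of_nonneg hs0.le] at h6
    have h7 := hsep _ _ (fun h => hij (finFunctionFinEquiv.symm.injective h))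
    have h8 : s ≤ C * dist (e.symm (e x + s • v (finFunctionFinEquiv.symm i)))
        (e.symm (e x + s • v (finFunctionFinEquiv.symm j))) := by nlinarith
    calc _ ≤ (C ^ 2 * (n + 1))⁻¹ * ρ / m := by gcongr; exact min_le_right _ _
      _ = s / C := by rw [hs]; field_simp
      _ ≤ _ := by rw [div_le_iff₀ hC, mul_comm]; exact h8

variable [Group N]

/-- Left translations are Lipschitz, locally uniformly. -/
def IsLocallyLipschitzMul (N : Type*) [MetricSpace N] [Group N] : Prop :=
  ∀ a₀ y₀ : N, ∃ C : ℝ, 1 ≤ C ∧ ∀ᶠ q : N × N × N in 𝓝 (a₀, y₀, y₀),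
    dist (q.1 * q.2.1) (q.1 * q.2.2) ≤ C * dist q.2.1 q.2.2

variable {V : Type*} [NormedAddCommGroup V] [NormedSpace ℝ V] {P : N → V}

/-- The distance of `y ^ m` from `1` is at most `C * m * dist y 1` while this stays small, and there
`‖P (y ^ m)‖ = m * ‖P y‖ < 1` by continuity. Taking `m` of the order of `1 / dist y 1` turns
continuity into a linear bound. -/
theorem norm_le_dist_one (h : IsLocallyLipschitzMul N) (hmul : ∀ x y, P (x * y) = P x + P y)
    (hcont : Continuous P) : ∃ c > 0, ∀ y, dist y 1 ≤ c → ‖P y‖ ≤ c⁻¹ * dist y 1 := by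
  have hP1 : P 1 = 0 := by have := hmul 1 1; rw [mul_one] at this; simpa using this
  have hPpow : ∀ y (m : ℕ), P (y ^ m) = (m : ℝ) • P y := by
    intro y m
    induction m with
    | zero => simp [hP1]
    | succ m ih => rw [pow_succ, hmul, ih, Nat.cast_succ, add_smul, one_smul]
  obtain ⟨C, hC, h⟩ := h 1 1
  obtain ⟨ε, hε, hball⟩ := Metric.eventually_nhds_iff.1 h
  have hC0 : 0 < C := by linarith
  obtain ⟨ε', hε', hball'⟩ := Metric.eventually_nhds_iff.1
    (hcont.continuousAt.eventually (Metric.ball_mem_nhds (P 1) one_pos))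
  set r := min ε ε' with hr
  have hr0 : 0 < r := lt_min hε hε'
  refine ⟨r / (4 * C), by positivity, fun y hy => ?_⟩
  rcases eq_or_ne y 1 with rfl | hy1
  · simp [hP1]
  have ht : 0 < dist y 1 := dist_pos.2 hy1
  set t := dist y 1 with htdef
  rw [le_div_iff₀ (by positivity)] at hy
  have htr : t < r := by nlinarith
  have hpow : ∀ m : ℕ, C * m * t < r → dist (y ^ m) 1 ≤ C * m * t := by
    intro m
    induction m with
    | zero => intro _; simp
    | succ m ih =>
      intro hm
      push_cast at hm ⊢
      have h1 : C * m * t < r := by nlinarith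
      have h2 := ih h1
      have h3 := hball (y := (y ^ m, y, 1)) (by
        simp only [Prod.dist_eq, dist_self]
        refine max_lt ((h2.trans_lt h1).trans_le (min_le_left _ _)) (max_lt ?_ hε)
        exact htr.trans_le (min_le_left _ _))
      simp only [mul_one] at h3
      rw [pow_succ]
      have := dist_triangle (y ^ m * y) (y ^ m) 1
      nlinarith
  set m := ⌊r / (2 * C * t)⌋₊ with hm
  have hm1 : (m : ℝ) ≤ r / (2 * C * t) := Nat.floor_le (by positivity)
  have hm2 : r / (2 * C * t) < m + 1 := Nat.lt_floor_add_one _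
  rw [le_div_iff₀ (by positivity)] at hm1
  rw [div_lt_iff₀ (by positivity)] at hm2
  have hlt : C * m * t < r := by nlinarith
  have h4 : ‖P (y ^ m)‖ < 1 := by
    have := hball' (((hpow m hlt).trans_lt hlt).trans_le (min_le_right _ _))
    rwa [hP1, dist_zero_right] at this
  rw [hPpow, norm_smul, Real.norm_natCast] at h4
  rw [inv_div, div_mul_eq_mul_div, le_div_iff₀ hr0]
  have h5 : r ≤ 4 * C * t * m := by nlinarith
  have := norm_nonneg (P y)
  calc ‖P y‖ * r ≤ ‖P y‖ * (4 * C * t * m) := by gcongr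
    _ = 4 * C * t * (m * ‖P y‖) := by ring
    _ ≤ 4 * C * t * 1 := by gcongr
    _ = 4 * C * t := mul_one _

variable [IsTopologicalGroup N]

theorem IsLocallyLipschitzMul.dist_inv_mul_le (h : IsLocallyLipschitzMul N) (x₀ : N) :
    ∃ C : ℝ, 1 ≤ C ∧ ∃ ε > 0, ∀ x ∈ Metric.ball x₀ ε, ∀ y ∈ Metric.ball x₀ ε,
      dist (x⁻¹ * y) 1 ≤ C * dist x y := by
  obtain ⟨C, hC, h⟩ := h x₀⁻¹ x₀
  refine ⟨C, hC, ?_⟩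
  have hc : Filter.Tendsto (fun q : N × N => (q.1⁻¹, q.1, q.2)) (𝓝 (x₀, x₀))
      (𝓝 (x₀⁻¹, x₀, x₀)) :=
    Continuous.tendsto' (by fun_prop) _ _ rfl
  obtain ⟨ε, hε, hball⟩ := Metric.eventually_nhds_iff.1 (hc.eventually h)
  refine ⟨ε, hε, fun x hx y hy => ?_⟩
  have := hball (y := (x, y)) (by rw [Prod.dist_eq]; exact max_lt hx hy)
  simpa [dist_comm] using this

theorem norm_sub_le_dist_local (h : IsLocallyLipschitzMul N) (hmul : ∀ x y, P (x * y) = P x + P y)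
    (hcont : Continuous P) (x₀ : N) :
    ∃ c > 0, ∀ᶠ x in 𝓝 x₀, ∀ y, dist x y ≤ c → ‖P x - P y‖ ≤ c⁻¹ * dist x y := by
  obtain ⟨c, hc, hP⟩ := norm_le_dist_one h hmul hcont
  obtain ⟨C, hC, ε, hε, hinv⟩ := h.dist_inv_mul_le x₀
  have hC0 : 0 < C := by linarith
  refine ⟨min (c / C) (ε / 4), by positivity, ?_⟩
  filter_upwards [Metric.ball_mem_nhds x₀ (half_pos hε)] with x hx y hxy
  have hy : y ∈ Metric.ball x₀ ε := by
    rw [Metric.mem_ball] at hx ⊢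
    have h1 := dist_triangle_left y x₀ x
    have h2 := min_le_right (c / C) (ε / 4)
    linarith
  have h1 := hinv x (Metric.ball_subset_ball (by linarith) hx) y hy
  have h2 : dist (x⁻¹ * y) 1 ≤ c := h1.trans (by
    rw [mul_comm, ← le_div_iff₀ hC0]; exact hxy.trans (min_le_left _ _))
  have h3 : P (x⁻¹ * y) = P y - P x := by
    rw [eq_sub_iff_add_eq', ← hmul, mul_inv_cancel_left]
  rw [norm_sub_rev, ← h3]
  calc ‖P (x⁻¹ * y)‖ ≤ c⁻¹ * dist (x⁻¹ * y) 1 := hP _ h2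
    _ ≤ c⁻¹ * (C * dist x y) := by gcongr
    _ = (c / C)⁻¹ * dist x y := by rw [inv_div]; ring
    _ ≤ _ := by
      gcongr
      exact min_le_left _ _

/-- Openness of `P` provides a point near `1` at which `ℓ ∘ P` is bounded below by a fixed amount.
The chart segment from `1` to it is cut into about `A / s` pieces. The quotients `(y i)⁻¹ * y (i +
1)` lie within `s` of `1`, and their values telescope, so one of them gains at least the average. -/
theorem exists_ascent_one {n : ℕ} (hch : HasBiLipschitzCharts n N) (h : IsLocallyLipschitzMul N)
    (hmul : ∀ x y, P (x * y) = P x + P y) (hopen : IsOpenMap P) :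
    ∃ c > 0, ∀ ℓ : V →L[ℝ] ℝ, ‖ℓ‖ = 1 → ∀ s, 0 < s → s ≤ c → ∃ z, dist z 1 ≤ s ∧ c * s ≤ ℓ (P z) := by
  have hP1 : P 1 = 0 := by have := hmul 1 1; rw [mul_one] at this; simpa using this
  obtain ⟨e, h1e, Ce, hCe, he⟩ := hch 1
  obtain ⟨C, hC, ε, hε, hinv⟩ := h.dist_inv_mul_le 1
  have hC0 : 0 < C := by linarith
  have hnhds : ∀ᶠ v in 𝓝 (e 1), v ∈ e.target ∧ e.symm v ∈ Metric.ball (1 : N) ε := by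
    refine Filter.Eventually.and (e.open_target.mem_nhds (e.map_source h1e)) ?_
    have := (e.continuousAt_symm (e.map_source h1e))
    apply this.eventually
    rw [e.left_inv h1e]
    exact Metric.ball_mem_nhds _ hε
  obtain ⟨R, hR, hball⟩ := Metric.eventually_nhds_iff.1 hnhds
  have hW : e.symm '' Metric.ball (e 1) R ∈ 𝓝 (1 : N) := by
    have h1 : e.source ∩ e ⁻¹' Metric.ball (e 1) R ∈ 𝓝 (1 : N) :=
      Filter.inter_mem (e.open_source.mem_nhds h1e)
        ((e.continuousAt h1e).preimage_mem_nhds (Metric.ball_mem_nhds _ hR))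
    exact Filter.mem_of_superset h1 fun x hx => ⟨e x, hx.2, e.left_inv hx.1⟩
  obtain ⟨τ, hτ, hτP⟩ := Metric.mem_nhds_iff.1 (hopen.image_mem_nhds hW)
  rw [hP1] at hτP
  set A := C * (Ce * R) with hA
  have hA0 : 0 < A := by positivity
  refine ⟨min A (τ / (8 * A)), by positivity, fun ℓ hℓ s hs hsc => ?_⟩
  obtain ⟨u, hu, hℓu⟩ : ∃ u : V, ‖u‖ < τ ∧ τ / 4 ≤ ℓ u := by
    obtain ⟨v, hv, hv2⟩ := ℓ.exists_lt_apply_of_lt_opNorm (r := 1 / 2) (by rw [hℓ]; norm_num)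
    rw [Real.norm_eq_abs, lt_abs] at hv2
    have hn : ∀ w : V, ‖w‖ < 1 → ‖(τ / 2) • w‖ < τ := fun w hw => by
      rw [norm_smul, Real.norm_of_nonneg (by positivity)]; nlinarith
    rcases hv2 with hv2 | hv2
    · exact ⟨(τ / 2) • v, hn v hv, by rw [map_smul, smul_eq_mul]; nlinarith⟩
    · exact ⟨(τ / 2) • (-v), hn _ (by rwa [norm_neg]), by
        rw [map_smul, map_neg, smul_eq_mul]; nlinarith⟩
  obtain ⟨_, ⟨w, hw, rfl⟩, hyu⟩ := hτP (mem_ball_zero_iff.2 hu)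
  set m := ⌈A / s⌉₊ with hm
  have hAs : 0 < A / s := by positivity
  have hm0 : 0 < m := Nat.ceil_pos.2 hAs
  have hm0' : (0 : ℝ) < m := by exact_mod_cast hm0
  have hm1 : A / s ≤ m := Nat.le_ceil _
  have hm2 : (m : ℝ) < A / s + 1 := Nat.ceil_lt_add_one hAs.le
  let q : ℕ → EuclideanSpace ℝ (Fin n) := fun i => e 1 + ((i : ℝ) / m) • (w - e 1)
  have hwR : ‖w - e 1‖ < R := by rwa [Metric.mem_ball, dist_eq_norm] at hw
  have hq : ∀ i ≤ m, dist (q i) (e 1) < R := fun i hi => by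
    rw [dist_eq_norm, add_sub_cancel_left, norm_smul, Real.norm_of_nonneg (by positivity)]
    have : (i : ℝ) / m ≤ 1 := (div_le_one hm0').2 (by exact_mod_cast hi)
    have := norm_nonneg (w - e 1)
    nlinarith
  let y : ℕ → N := fun i => e.symm (q i)
  have hy0 : y 0 = 1 := by simp [y, q, e.left_inv h1e]
  have hym : y m = e.symm w := by
    simp only [y, q]; rw [div_self hm0'.ne', one_smul, add_sub_cancel]
  have hdist : ∀ i < m, dist (y i) (y (i + 1)) ≤ Ce * (R / m) := by
    intro i hi
    have h1 := hball (hq i hi.le)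
    have h2 := hball (hq (i + 1) hi)
    have h3 := (he _ (e.map_target h1.1) _ (e.map_target h2.1)).1
    rw [e.right_inv h1.1, e.right_inv h2.1] at h3
    refine h3.trans ?_
    gcongr
    have : q i - q (i + 1) = (-(1 / m : ℝ)) • (w - e 1) := by
      simp only [q]; rw [add_sub_add_left_eq_sub, ← sub_smul]; congr 1; push_cast; ring
    rw [dist_eq_norm, this, norm_smul, norm_neg, Real.norm_of_nonneg (by positivity), one_div,
      ← div_eq_inv_mul]
    gcongr
  have hz : ∀ i < m, dist ((y i)⁻¹ * y (i + 1)) 1 ≤ s := by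
    intro i hi
    have h1 := hball (hq i hi.le)
    have h2 := hball (hq (i + 1) hi)
    refine (hinv _ h1.2 _ h2.2).trans ?_
    calc C * dist (y i) (y (i + 1)) ≤ C * (Ce * (R / m)) := by gcongr; exact hdist i hi
      _ = A / m := by rw [hA]; ring
      _ ≤ s := by rw [div_le_iff₀ hm0']; rwa [div_le_iff₀ hs, mul_comm] at hm1
  have hPz : ∀ i, P ((y i)⁻¹ * y (i + 1)) = P (y (i + 1)) - P (y i) := fun i => by
    rw [eq_sub_iff_add_eq', ← hmul, mul_inv_cancel_left]
  have hsum : ∑ i ∈ Finset.range m, ℓ (P ((y i)⁻¹ * y (i + 1))) = ℓ u := by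
    simp only [hPz, map_sub]
    rw [Finset.sum_range_sub (fun i => ℓ (P (y i))), hy0, hP1, map_zero, sub_zero, hym, hyu]
  obtain ⟨i, hi, hi2⟩ : ∃ i ∈ Finset.range m, τ / (4 * m) ≤ ℓ (P ((y i)⁻¹ * y (i + 1))) := by
    apply Finset.exists_le_of_sum_le (Finset.nonempty_range_iff.2 hm0.ne')
    rw [hsum, Finset.sum_const, Finset.card_range, nsmul_eq_mul]
    calc (m : ℝ) * (τ / (4 * m)) = τ / 4 := by field_simp
      _ ≤ ℓ u := hℓu
  refine ⟨_, hz i (Finset.mem_range.1 hi), le_trans ?_ hi2⟩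
  have h5 : m * s ≤ 2 * A := by
    have h6 : s ≤ A := hsc.trans (min_le_left _ _)
    have h7 : m * s < A + s := by
      calc (m : ℝ) * s < (A / s + 1) * s := by gcongr
        _ = A + s := by field_simp
    linarith
  calc min A (τ / (8 * A)) * s ≤ τ / (8 * A) * s := by gcongr; exact min_le_right _ _
    _ ≤ τ / (4 * m) := by
      rw [div_mul_eq_mul_div, div_le_div_iff₀ (by positivity) (by positivity)]
      nlinarith

/-- Left translation by `x` carries the ascent at `1` to `x`. It may stretch distances by `C`, so
the step at `1` is taken of size `s / C`. -/
theorem exists_ascent_local {n : ℕ} (hch : HasBiLipschitzCharts n N) (h : IsLocallyLipschitzMul N)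
    (hmul : ∀ x y, P (x * y) = P x + P y) (hopen : IsOpenMap P) (x₀ : N) :
    ∃ c > 0, ∀ᶠ x in 𝓝 x₀, ∀ ℓ : V →L[ℝ] ℝ, ‖ℓ‖ = 1 → ∀ s, 0 < s → s ≤ c →
      ∃ y, dist y x ≤ s ∧ ℓ (P x) + c * s ≤ ℓ (P y) := by
  obtain ⟨c, hc, hasc⟩ := exists_ascent_one hch h hmul hopen
  obtain ⟨C, hC, hl⟩ := h x₀ 1
  have hC0 : 0 < C := by linarith
  obtain ⟨ε, hε, hball⟩ := Metric.eventually_nhds_iff.1 hl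
  refine ⟨min (c / C) (ε / 2), by positivity, ?_⟩
  filter_upwards [Metric.ball_mem_nhds x₀ hε] with x hx ℓ hℓ s hs hsc
  have hs1 : s ≤ c / C := hsc.trans (min_le_left _ _)
  have hs2 : s / C ≤ s := div_le_self hs.le hC
  have hs3 : s / C ≤ c := by
    refine hs2.trans (hs1.trans (div_le_self hc.le hC))
  obtain ⟨z, hz, hzℓ⟩ := hasc ℓ hℓ (s / C) (by positivity) hs3
  have h1 := hball (y := (x, z, 1)) (by
    simp only [Prod.dist_eq, dist_self]
    have := min_le_right (c / C) (ε / 2)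
    exact max_lt hx (max_lt (by linarith) hε))
  simp only [mul_one] at h1
  refine ⟨x * z, h1.trans ?_, ?_⟩
  · calc C * dist z 1 ≤ C * (s / C) := by gcongr
      _ = s := by field_simp
  · rw [hmul, map_add]
    have : min (c / C) (ε / 2) * s ≤ c * (s / C) := by
      calc min (c / C) (ε / 2) * s ≤ c / C * s := by gcongr; exact min_le_left _ _
        _ = c * (s / C) := by ring
    linarith

end MetricGroup

/-! ### Charts are bi-Lipschitz for a Riemannian distance -/

section Riemannian

open MeasureTheory Metric Filter
open scoped NNReal

variable {E : Type*} [NormedAddCommGroup E] [NormedSpace ℝ E]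
  {H : Type*} [TopologicalSpace H] (I : ModelWithCorners ℝ E H)
  {M : Type*} [TopologicalSpace M] [ChartedSpace H M]
  [RiemannianBundle (fun (x : M) => TangentSpace I x)]
  [IsManifold I 1 M] [IsContinuousRiemannianBundle E (fun (x : M) => TangentSpace I x)]

theorem eventually_enorm_mfderiv_extChartAt_apply_le (x : M) :
    ∃ C : ℝ≥0, 0 < C ∧ ∀ᶠ y in 𝓝 x, ∀ v : TangentSpace I y,
      ‖(show E from mfderiv I 𝓘(ℝ, E) (extChartAt I x) y v)‖ₑ ≤ C * ‖v‖ₑ := by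
  obtain ⟨C, hC, h⟩ := eventually_norm_trivializationAt_lt E (fun (x : M) => TangentSpace I x) x
  refine ⟨⟨C, hC.le⟩, hC, ?_⟩
  filter_upwards [h, chart_source_mem_nhds H x] with y hy h'y v
  have h1 := DFunLike.congr_fun (TangentBundle.continuousLinearMapAt_trivializationAt (I := I) h'y) v
  have h2 := ContinuousLinearMap.le_opNorm
    (Trivialization.continuousLinearMapAt ℝ
      (trivializationAt E (fun (x : M) => TangentSpace I x) x) y) v
  have h3 : ‖(show E from mfderiv I 𝓘(ℝ, E) (extChartAt I x) y v)‖ ≤ C * ‖v‖ := by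
    rw [h1] at h2
    exact h2.trans (mul_le_mul_of_nonneg_right hy.le (norm_nonneg _))
  rw [← ofReal_norm, ← ofReal_norm]
  refine (ENNReal.ofReal_le_ofReal h3).trans_eq ?_
  rw [ENNReal.ofReal_mul hC.le]
  congr 1
  exact ENNReal.ofReal_eq_coe_nnreal hC.le

theorem eventually_enorm_mfderivWithin_symm_extChartAt_apply_le (x : M) :
    ∃ C : ℝ≥0, 0 < C ∧ ∀ᶠ y in 𝓝[range I] (extChartAt I x x), ∀ v : E,
      ‖mfderivWithin 𝓘(ℝ, E) I (extChartAt I x).symm (range I) y v‖ₑ ≤ C * ‖v‖ₑ := by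
  obtain ⟨C, hC, h⟩ := eventually_norm_symmL_trivializationAt_lt E
    (fun (x : M) => TangentSpace I x) x
  refine ⟨⟨C, hC.le⟩, hC, ?_⟩
  have hcont : Tendsto (extChartAt I x).symm (𝓝 (extChartAt I x x)) (𝓝 x) := by
    have := continuousAt_extChartAt_symm (I := I) x
    rwa [ContinuousAt, extChartAt_to_inv] at this
  have h0 := inter_mem h (chart_source_mem_nhds H x)
  filter_upwards [nhdsWithin_le_nhds (hcont h0),
    extChartAt_target_mem_nhdsWithin x] with y hy h'y v
  have h1 := DFunLike.congr_fun (TangentBundle.symmL_trivializationAt (I := I) hy.2) v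
  have h2 := ContinuousLinearMap.le_opNorm
    (Trivialization.symmL ℝ
      (trivializationAt E (fun (x : M) => TangentSpace I x) x) ((extChartAt I x).symm y)) v
  rw [h1, (extChartAt I x).right_inv h'y] at h2
  have h3 := h2.trans (mul_le_mul_of_nonneg_right (le_of_lt hy.1) (norm_nonneg _))
  rw [← ofReal_norm, ← ofReal_norm]
  refine (ENNReal.ofReal_le_ofReal h3).trans_eq ?_
  rw [ENNReal.ofReal_mul hC.le]
  congr 1
  exact ENNReal.ofReal_eq_coe_nnreal hC.le

/-- The straight segment in the chart is pulled back to a path, whose length is controlled by the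
derivative of the inverse chart. -/
theorem eventually_riemannianEDist_le_mul_edist_extChartAt (x : M) :
    ∃ C : ℝ≥0, ∃ u ∈ 𝓝 x, ∀ y ∈ u, ∀ z ∈ u,
      riemannianEDist I y z ≤ C * edist (extChartAt I x y) (extChartAt I x z) := by
  obtain ⟨C, -, hC⟩ := eventually_enorm_mfderivWithin_symm_extChartAt_apply_le I x
  obtain ⟨r, r_pos, hr⟩ : ∃ r > 0,
      ball (extChartAt I x x) r ∩ range I ⊆ (extChartAt I x).target ∩
        {y | ∀ v : E,
          ‖mfderivWithin 𝓘(ℝ, E) I (extChartAt I x).symm (range I) y v‖ₑ ≤ C * ‖v‖ₑ} :=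
    mem_nhdsWithin_iff.1 (inter_mem (extChartAt_target_mem_nhdsWithin x) hC)
  have A : (extChartAt I x) ⁻¹' (ball (extChartAt I x x) r ∩ range I) ∈ 𝓝 x := by
    apply extChartAt_preimage_mem_nhds_of_mem_nhdsWithin (by simp)
    rw [inter_comm]
    exact inter_mem_nhdsWithin _ (ball_mem_nhds _ r_pos)
  refine ⟨C, _, inter_mem A (chart_source_mem_nhds H x), fun y hy z hz => ?_⟩
  let η := ContinuousAffineMap.lineMap (R := ℝ) (extChartAt I x y) (extChartAt I x z)
  set γ := (extChartAt I x).symm ∘ η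
  have hη : Icc 0 1 ⊆ ⇑η ⁻¹' ((extChartAt I x).target ∩
        {y | ∀ v : E,
          ‖mfderivWithin 𝓘(ℝ, E) I (extChartAt I x).symm (range I) y v‖ₑ ≤ C * ‖v‖ₑ}) := by
    simp only [← image_subset_iff, ContinuousAffineMap.coe_lineMap_eq,
     ← segment_eq_image_lineMap, η]
    exact (((convex_ball _ _).inter I.convex_range).segment_subset hy.1 hz.1).trans hr
  simp only [preimage_inter, subset_inter_iff] at hη
  have η_smooth : ContMDiffOn 𝓘(ℝ, ℝ) 𝓘(ℝ, E) 1 η (Icc 0 1) := by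
    apply ContMDiff.contMDiffOn
    rw [contMDiff_iff_contDiff]
    exact ContinuousAffineMap.contDiff _
  have : riemannianEDist I y z ≤ pathELength I γ 0 1 := by
    apply riemannianEDist_le_pathELength _ _ _ zero_le_one
    · exact (contMDiffOn_extChartAt_symm x).comp η_smooth hη.1
    · simp [γ, η, ContinuousAffineMap.coe_lineMap_eq, hy.2]
    · simp [γ, η, ContinuousAffineMap.coe_lineMap_eq, hz.2]
  apply this.trans
  rw [← lintegral_fderiv_lineMap_eq_edist, pathELength_eq_lintegral_mfderivWithin_Icc,
    ← lintegral_const_mul' _ _ ENNReal.coe_ne_top]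
  apply setLIntegral_mono' measurableSet_Icc (fun t ht => ?_)
  have : mfderivWithin 𝓘(ℝ, ℝ) I γ (Icc 0 1) t =
      (mfderivWithin 𝓘(ℝ, E) I (extChartAt I x).symm (range I) (η t)) ∘L
        (mfderivWithin 𝓘(ℝ, ℝ) 𝓘(ℝ, E) η (Icc 0 1) t) := by
    apply mfderivWithin_comp
    · exact mdifferentiableWithinAt_extChartAt_symm (hη.1 ht)
    · exact η_smooth.mdifferentiableOn one_ne_zero t ht
    · exact hη.1.trans (preimage_mono (extChartAt_target_subset_range x))
    · rw [uniqueMDiffWithinAt_iff_uniqueDiffWithinAt]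
      exact uniqueDiffOn_Icc zero_lt_one t ht
  have : mfderivWithin 𝓘(ℝ, ℝ) I γ (Icc 0 1) t 1 =
      (mfderivWithin 𝓘(ℝ, E) I (extChartAt I x).symm (range I) (η t))
        (mfderivWithin 𝓘(ℝ, ℝ) 𝓘(ℝ, E) η (Icc 0 1) t 1) := DFunLike.congr_fun this 1
  rw [this]
  refine (hη.2 ht _).trans_eq ?_
  rw [mfderivWithin_eq_fderivWithin]
  rfl

/-- Almost shortest paths between points close to `x` stay where the derivative of the chart is
bounded: the end points are within `c / 4` of `x` and the paths have length less than `c / 2`. Their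
images bound the chart distance from above. -/
theorem eventually_edist_extChartAt_le_mul_riemannianEDist [RegularSpace M] (x : M) :
    ∃ C : ℝ≥0, ∃ u ∈ 𝓝 x, ∀ y ∈ u, ∀ z ∈ u,
      edist (extChartAt I x y) (extChartAt I x z) ≤ C * riemannianEDist I y z := by
  obtain ⟨C, C_pos, hC⟩ := eventually_enorm_mfderiv_extChartAt_apply_le I x
  obtain ⟨c, hc, hcu⟩ := setOfPred_riemannianEDist_lt_subset_nhds I
    (inter_mem hC (chart_source_mem_nhds H x))
  have hc4 : (0 : ℝ≥0∞) < (c / 4 : ℝ≥0) := by exact_mod_cast (by positivity : (0 : ℝ≥0) < c / 4)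
  refine ⟨C, _, eventually_riemannianEDist_lt I x hc4, fun y hy z hz => ?_⟩
  have hyz : riemannianEDist I y z < (c / 2 : ℝ≥0) := by
    refine (riemannianEDist_triangle (y := x)).trans_lt ?_
    rw [riemannianEDist_comm (x := y)]
    refine (ENNReal.add_lt_add hy hz).trans_eq ?_
    norm_cast
    rw [← NNReal.coe_inj]; push_cast; ring
  have key : ∀ r, riemannianEDist I y z < r → r < (c / 2 : ℝ≥0) →
      edist (extChartAt I x y) (extChartAt I x z) ≤ C * r := by
    intro r hr hrc
    obtain ⟨γ, hγx, hγy, γ_smooth, hγ, -⟩ :=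
      exists_lt_locally_constant_of_riemannianEDist_lt hr zero_lt_one
    have hu : ∀ t ∈ Icc (0 : ℝ) 1, γ t ∈ {y | ∀ v : TangentSpace I y,
          ‖(show E from mfderiv I 𝓘(ℝ, E) (extChartAt I x) y v)‖ₑ ≤ C * ‖v‖ₑ} ∩
        (chartAt H x).source := by
      intro t ht
      apply hcu
      have h1 : riemannianEDist I y (γ t) ≤ pathELength I γ 0 t :=
        riemannianEDist_le_pathELength γ_smooth.contMDiffOn hγx rfl ht.1
      have h2 : riemannianEDist I y (γ t) < (c / 2 : ℝ≥0) :=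
        ((h1.trans (pathELength_mono le_rfl ht.2)).trans_lt hγ).trans hrc
      refine (riemannianEDist_triangle (y := y)).trans_lt ((ENNReal.add_lt_add hy h2).trans_le ?_)
      norm_cast
      rw [← NNReal.coe_le_coe]; push_cast
      have : (0 : ℝ) ≤ c := c.2
      linarith
    let γ' := extChartAt I x ∘ γ
    have hC' : ContMDiffOn 𝓘(ℝ, ℝ) 𝓘(ℝ, E) 1 γ' (Icc 0 1) :=
      contMDiffOn_extChartAt.comp (I' := I) (t := (chartAt H x).source)
        γ_smooth.contMDiffOn (fun t' ht' => (hu t' ht').2)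
    rw [edist_comm, edist_eq_enorm_sub]
    calc ‖extChartAt I x z - extChartAt I x y‖ₑ = ‖γ' 1 - γ' 0‖ₑ := by simp [γ', hγx, hγy]
      _ ≤ ∫⁻ t' in Icc 0 1, ‖derivWithin γ' (Icc 0 1) t'‖ₑ := by
        apply enorm_sub_le_lintegral_derivWithin_Icc_of_contDiffOn_Icc _ zero_le_one
        rwa [← contMDiffOn_iff_contDiffOn]
      _ = ∫⁻ t' in Icc 0 1, ‖(show E from mfderivWithin 𝓘(ℝ, ℝ) 𝓘(ℝ, E) γ' (Icc 0 1) t' 1)‖ₑ := by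
        simp_rw [← fderivWithin_derivWithin, mfderivWithin_eq_fderivWithin]
        rfl
      _ ≤ ∫⁻ t' in Icc 0 1, C * ‖mfderivWithin 𝓘(ℝ, ℝ) I γ (Icc 0 1) t' 1‖ₑ := by
        apply setLIntegral_mono' measurableSet_Icc (fun t' ht' => ?_)
        have : mfderivWithin 𝓘(ℝ, ℝ) 𝓘(ℝ, E) γ' (Icc 0 1) t' =
            (mfderiv I 𝓘(ℝ, E) (extChartAt I x) (γ t')) ∘L
              (mfderivWithin 𝓘(ℝ, ℝ) I γ (Icc 0 1) t') := by
          apply mfderiv_comp_mfderivWithin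
          · exact mdifferentiableAt_extChartAt (hu t' ht').2
          · exact (γ_smooth.mdifferentiable one_ne_zero).mdifferentiableOn _ ht'
          · rw [uniqueMDiffWithinAt_iff_uniqueDiffWithinAt]
            exact uniqueDiffOn_Icc zero_lt_one _ ht'
        have : mfderivWithin 𝓘(ℝ, ℝ) 𝓘(ℝ, E) γ' (Icc 0 1) t' 1 =
            (mfderiv I 𝓘(ℝ, E) (extChartAt I x) (γ t'))
              (mfderivWithin 𝓘(ℝ, ℝ) I γ (Icc 0 1) t' 1) :=
          DFunLike.congr_fun this 1
        rw [this]
        exact (hu t' ht').1 _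
      _ = C * pathELength I γ 0 1 := by
        rw [lintegral_const_mul' _ _ ENNReal.coe_ne_top,
            pathELength_eq_lintegral_mfderivWithin_Icc]
      _ ≤ C * r := by gcongr
  by_contra! hlt
  have hC0 : (C : ℝ≥0∞) ≠ 0 := by exact_mod_cast C_pos.ne'
  have h1 : riemannianEDist I y z < edist (extChartAt I x y) (extChartAt I x z) / C := by
    rw [ENNReal.lt_div_iff_mul_lt (Or.inl hC0) (Or.inl ENNReal.coe_ne_top), mul_comm]
    exact hlt
  obtain ⟨r, hr1, hr2⟩ := exists_between (lt_min h1 hyz)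
  have h2 := key r hr1 (hr2.trans_le (min_le_right _ _))
  have h3 := hr2.trans_le (min_le_left _ _)
  rw [ENNReal.lt_div_iff_mul_lt (Or.inl hC0) (Or.inl ENNReal.coe_ne_top), mul_comm] at h3
  exact absurd h2 h3.not_ge

end Riemannian

/-! ### Riemannian distances on Lie groups -/

section RiemannianLieGroup

open Filter

variable {n : ℕ} {N : Type*} [MetricSpace N] [ChartedSpace (EuclideanSpace ℝ (Fin n)) N]
  [RiemannianBundle (fun x : N => TangentSpace (𝓡 n) x)] [IsManifold (𝓡 n) 1 N]
  [IsContinuousRiemannianBundle (EuclideanSpace ℝ (Fin n)) (fun x : N => TangentSpace (𝓡 n) x)]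

theorem exists_dist_extChartAt_le (hN : ∀ x y : N, edist x y = riemannianEDist (𝓡 n) x y) (x : N) :
    ∃ C : ℝ, 0 < C ∧ ∃ u ∈ 𝓝 x, ∀ y ∈ u, ∀ z ∈ u,
      dist y z ≤ C * dist (extChartAt (𝓡 n) x y) (extChartAt (𝓡 n) x z) ∧
      dist (extChartAt (𝓡 n) x y) (extChartAt (𝓡 n) x z) ≤ C * dist y z := by
  obtain ⟨C₁, u₁, hu₁, h₁⟩ := eventually_riemannianEDist_le_mul_edist_extChartAt (𝓡 n) x
  obtain ⟨C₂, u₂, hu₂, h₂⟩ := eventually_edist_extChartAt_le_mul_riemannianEDist (𝓡 n) x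
  refine ⟨C₁ + C₂ + 1, by positivity, _, inter_mem hu₁ hu₂, fun y hy z hz => ?_⟩
  have h3 := h₁ y hy.1 z hz.1
  have h4 := h₂ y hy.2 z hz.2
  rw [← hN, edist_nndist, edist_nndist] at h3 h4
  have h5 : dist y z ≤ C₁ * dist (extChartAt (𝓡 n) x y) (extChartAt (𝓡 n) x z) := by
    exact_mod_cast h3
  have h6 : dist (extChartAt (𝓡 n) x y) (extChartAt (𝓡 n) x z) ≤ C₂ * dist y z := by
    exact_mod_cast h4
  have h7 : (0 : ℝ) ≤ C₁ := C₁.2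
  have h8 : (0 : ℝ) ≤ C₂ := C₂.2
  constructor
  · refine h5.trans ?_
    gcongr
    linarith
  · refine h6.trans ?_
    gcongr
    linarith

theorem hasBiLipschitzCharts_of_riemannian
    (hN : ∀ x y : N, edist x y = riemannianEDist (𝓡 n) x y) : HasBiLipschitzCharts n N := by
  intro x
  obtain ⟨C, hC, u, hu, h⟩ := exists_dist_extChartAt_le hN x
  refine ⟨(chartAt (EuclideanSpace ℝ (Fin n)) x).restr u, ?_, C, hC, fun y hy z hz => ?_⟩
  · rw [OpenPartialHomeomorph.restr_source]
    exact ⟨mem_chart_source _ x, mem_interior_iff_mem_nhds.2 hu⟩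
  · rw [OpenPartialHomeomorph.restr_source] at hy hz
    simpa using h y (interior_subset hy.2) z (interior_subset hz.2)

/-- Multiplication is continuously differentiable in charts, hence locally Lipschitz there. For two
pairs with the same first entry only the distance of the second entries remains. -/
theorem isLocallyLipschitzMul_of_riemannian [Group N] [LieGroup (𝓡 n) ∞ N]
    (hN : ∀ x y : N, edist x y = riemannianEDist (𝓡 n) x y) : IsLocallyLipschitzMul N := by
  intro a₀ y₀
  obtain ⟨C₁, hC₁, u₁, hu₁, h₁⟩ := exists_dist_extChartAt_le hN (a₀ * y₀)
  obtain ⟨C₂, hC₂, u₂, hu₂, h₂⟩ := exists_dist_extChartAt_le hN y₀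
  have hmul : ContMDiffAt ((𝓡 n).prod (𝓡 n)) (𝓡 n) ∞ (fun q : N × N => q.1 * q.2) (a₀, y₀) :=
    (contMDiff_mul (𝓡 n) ∞).contMDiffAt
  have hcd := (contMDiffAt_iff.1 hmul).2
  rw [ModelWithCorners.range_eq_univ, contDiffWithinAt_univ] at hcd
  obtain ⟨K, t, ht, hK⟩ := (hcd.of_le (m := 1) (by simp)).exists_lipschitzOnWith
  have : ContinuousMul N := continuousMul_of_contMDiffMul (𝓡 n) ∞
  refine ⟨C₁ * K * C₂ + 1, ?_, ?_⟩
  · have : (0 : ℝ) ≤ K := K.2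
    have : 0 ≤ C₁ * K * C₂ := by positivity
    linarith
  have ht' : ∀ᶠ q : N × N in 𝓝 (a₀, y₀),
      q ∈ (extChartAt ((𝓡 n).prod (𝓡 n)) (a₀, y₀)).source ∧
        extChartAt ((𝓡 n).prod (𝓡 n)) (a₀, y₀) q ∈ t ∧ q.1 * q.2 ∈ u₁ ∧ q.2 ∈ u₂ := by
    refine Filter.Eventually.and (extChartAt_source_mem_nhds _) (Filter.Eventually.and
      ((continuousAt_extChartAt _).preimage_mem_nhds ht) (Filter.Eventually.and ?_ ?_))
    · exact (continuous_mul.continuousAt (x := (a₀, y₀))).preimage_mem_nhds hu₁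
    · exact (continuous_snd.continuousAt (x := (a₀, y₀))).preimage_mem_nhds hu₂
  have hp1 : Tendsto (fun q : N × N × N => (q.1, q.2.1)) (𝓝 (a₀, y₀, y₀)) (𝓝 (a₀, y₀)) :=
    Continuous.tendsto' (by fun_prop) _ _ rfl
  have hp2 : Tendsto (fun q : N × N × N => (q.1, q.2.2)) (𝓝 (a₀, y₀, y₀)) (𝓝 (a₀, y₀)) :=
    Continuous.tendsto' (by fun_prop) _ _ rfl
  filter_upwards [hp1.eventually ht', hp2.eventually ht'] with ⟨a, y, z⟩ hy hz
  obtain ⟨hy1, hy2, hy3, hy4⟩ := hy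
  obtain ⟨hz1, hz2, hz3, hz4⟩ := hz
  have h3 := (h₁ _ hy3 _ hz3).1
  have h4 := hK.dist_le_mul _ hy2 _ hz2
  simp only [Function.comp_apply] at h4
  rw [PartialEquiv.left_inv _ hy1, PartialEquiv.left_inv _ hz1] at h4
  have h5 : dist (extChartAt ((𝓡 n).prod (𝓡 n)) (a₀, y₀) (a, y))
      (extChartAt ((𝓡 n).prod (𝓡 n)) (a₀, y₀) (a, z)) =
      dist (extChartAt (𝓡 n) y₀ y) (extChartAt (𝓡 n) y₀ z) := by
    rw [extChartAt_prod]
    simp [Prod.dist_eq]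
  rw [h5] at h4
  have h6 := (h₂ _ hy4 _ hz4).2
  calc dist (a * y) (a * z) ≤ _ := h3
    _ ≤ C₁ * (K * (C₂ * dist y z)) := by
      gcongr
      exact h4.trans (by gcongr)
    _ = C₁ * K * C₂ * dist y z := by ring
    _ ≤ _ := by gcongr; linarith

end RiemannianLieGroup

section LieGroupMetric

variable {n : ℕ} {N : Type*} [TopologicalSpace N] [T2Space N]
  [ChartedSpace (EuclideanSpace ℝ (Fin n)) N] [Group N] [LieGroup (𝓡 n) ∞ N] [ConnectedSpace N]

/-- The Riemannian distance on a connected Lie group. -/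
@[reducible] noncomputable def lieGroupMetric
    (g : ContMDiffRiemannianMetric (𝓡 n) ∞ (EuclideanSpace ℝ (Fin n))
      (fun x : N => TangentSpace (𝓡 n) x)) : MetricSpace N :=
  letI : PseudoEMetricSpace N := lieGroupEDist g
  letI : EMetricSpace N := EMetricSpace.ofT0PseudoEMetricSpace N
  EMetricSpace.toMetricSpace (lieGroupEDist_ne_top g)

theorem hasBiLipschitzCharts_lieGroupMetric
    (g : ContMDiffRiemannianMetric (𝓡 n) ∞ (EuclideanSpace ℝ (Fin n))
      (fun x : N => TangentSpace (𝓡 n) x)) : @HasBiLipschitzCharts n N (lieGroupMetric g) := by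
  let _ : RiemannianBundle (fun x : N => TangentSpace (𝓡 n) x) := ⟨g.toRiemannianMetric⟩
  have _ : IsManifold (𝓡 n) 1 N := IsManifold.of_le (n := ∞) (by simp)
  have _ : IsContinuousRiemannianBundle (EuclideanSpace ℝ (Fin n))
      (fun x : N => TangentSpace (𝓡 n) x) :=
    ⟨g.inner, g.contMDiff.continuous, fun _ _ _ => rfl⟩
  exact @hasBiLipschitzCharts_of_riemannian n N (lieGroupMetric g) _ _ _ _ fun x y => rfl

theorem isLocallyLipschitzMul_lieGroupMetric
    (g : ContMDiffRiemannianMetric (𝓡 n) ∞ (EuclideanSpace ℝ (Fin n))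
      (fun x : N => TangentSpace (𝓡 n) x)) : @IsLocallyLipschitzMul N (lieGroupMetric g) _ := by
  let _ : RiemannianBundle (fun x : N => TangentSpace (𝓡 n) x) := ⟨g.toRiemannianMetric⟩
  have _ : IsManifold (𝓡 n) 1 N := IsManifold.of_le (n := ∞) (by simp)
  have _ : IsContinuousRiemannianBundle (EuclideanSpace ℝ (Fin n))
      (fun x : N => TangentSpace (𝓡 n) x) :=
    ⟨g.inner, g.contMDiff.continuous, fun _ _ _ => rfl⟩
  exact @isLocallyLipschitzMul_of_riemannian n N (lieGroupMetric g) _ _ _ _ _ _ fun x y => rfl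

end LieGroupMetric

/-! ### Quotients by free isometric actions -/

section OrbitQuotient

open Filter Metric

variable {N X : Type*} [MetricSpace N] [MetricSpace X] {Γ : Subgroup (Equiv.Perm N)} {pr : N → X}

/-- `pr` is the quotient map for the isometric action of `Γ`, and the target carries the distance
between orbits. -/
structure IsOrbitMetricMap (Γ : Subgroup (Equiv.Perm N)) (pr : N → X) : Prop where
  surjective : Function.Surjective pr
  eq_iff : ∀ x y, pr x = pr y ↔ ∃ γ ∈ Γ, γ y = x
  isometry : ∀ γ ∈ Γ, ∀ x y, dist (γ x) (γ y) = dist x y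
  dist_le : ∀ x y, dist (pr x) (pr y) ≤ dist x y
  exists_lt : ∀ x y c, dist (pr x) (pr y) < c → ∃ γ ∈ Γ, dist x (γ y) < c

/-- Near a point only finitely many group elements can have small displacement, by proper
discontinuity, and freeness makes the displacement of the nontrivial ones positive. Conjugation
transports the bound along orbits, and compactness makes it uniform. -/
theorem IsOrbitMetricMap.exists_injectivityRadius [LocallyCompactSpace N]
    (h : IsOrbitMetricMap Γ pr) (hfree : ∀ γ ∈ Γ, ∀ x, γ x = x → γ = 1)
    (hpd : ∀ K : Set N, IsCompact K → {γ | γ ∈ Γ ∧ (γ '' K ∩ K).Nonempty}.Finite)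
    {K : Set N} (hK : IsCompact K) (hKΓ : ∀ y, ∃ k ∈ K, ∃ γ ∈ Γ, y = γ k) :
    ∃ r > 0, ∀ γ ∈ Γ, γ ≠ 1 → ∀ x, r ≤ dist x (γ x) := by
  suffices H : ∃ r > 0, ∀ x, ∀ γ ∈ Γ, γ ≠ 1 → r ≤ dist x (γ x) by
    obtain ⟨r, hr, hQ⟩ := H
    exact ⟨r, hr, fun γ hγ hγ1 x => hQ x γ hγ hγ1⟩
  refine exists_uniform_of_local hK
    (Q := fun c x => ∀ γ ∈ Γ, γ ≠ 1 → c ≤ dist x (γ x))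
    (fun x c c' _ hcc h γ hγ hγ1 => hcc.trans (h γ hγ hγ1)) ?_ ?_
  · intro y
    obtain ⟨k, hk, δ, hδ, rfl⟩ := hKΓ y
    refine ⟨k, hk, fun c _ hc γ hγ hγ1 => ?_⟩
    have h1 := hc (δ⁻¹ * γ * δ) (Γ.mul_mem (Γ.mul_mem (Γ.inv_mem hδ) hγ) hδ) (by
      intro h1
      apply hγ1
      have : γ = δ * (δ⁻¹ * γ * δ) * δ⁻¹ := by group
      rw [this, h1, mul_one, mul_inv_cancel])
    rw [← h.isometry δ hδ] at h1
    simpa using h1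
  · intro x₀
    obtain ⟨K', hK', hx₀⟩ := exists_compact_mem_nhds x₀
    obtain ⟨ε, hε, hεK⟩ := nhds_basis_closedBall.mem_iff.1 hx₀
    have hfin : {γ | γ ∈ Γ ∧ (γ '' closedBall x₀ ε ∩ closedBall x₀ ε).Nonempty}.Finite :=
      (hpd K' hK').subset fun γ hγ =>
        ⟨hγ.1, hγ.2.mono (inter_subset_inter (image_mono hεK) hεK)⟩
    have hmin : ∃ δ > 0, ∀ γ ∈ {γ | γ ∈ Γ ∧ (γ '' closedBall x₀ ε ∩ closedBall x₀ ε).Nonempty},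
        γ ≠ 1 → δ ≤ dist x₀ (γ x₀) := by
      refine hfin.induction_on_subset
        (motive := fun s _ => ∃ δ > 0, ∀ γ ∈ s, γ ≠ 1 → δ ≤ dist x₀ (γ x₀)) _
        ⟨1, one_pos, by simp⟩ ?_
      rintro γ s hγ - - ⟨δ, hδ, hs⟩
      by_cases hγ1 : γ = 1
      · refine ⟨δ, hδ, fun γ' hγ' hne => ?_⟩
        rcases hγ' with rfl | hγ'
        · exact absurd hγ1 hne
        · exact hs γ' hγ' hne
      · have hpos : 0 < dist x₀ (γ x₀) :=
          dist_pos.2 fun h0 => hγ1 (hfree γ hγ.1 x₀ h0.symm)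
        refine ⟨min δ (dist x₀ (γ x₀)), lt_min hδ hpos, fun γ' hγ' hne => ?_⟩
        rcases hγ' with rfl | hγ'
        · exact min_le_right _ _
        · exact (min_le_left _ _).trans (hs γ' hγ' hne)
    obtain ⟨δ, hδ, hmin⟩ := hmin
    refine ⟨min (ε / 2) (δ / 2), by positivity, ?_⟩
    filter_upwards [ball_mem_nhds x₀ (show 0 < min (ε / 2) (δ / 4) by positivity)]
      with x hx γ hγ hγ1
    rw [mem_ball] at hx
    have hx1 := hx.trans_le (min_le_left _ _)
    have hx2 := hx.trans_le (min_le_right _ _)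
    by_cases hm : γ x ∈ closedBall x₀ ε
    · have h1 := hmin γ ⟨hγ, γ x, ⟨x, mem_closedBall.2 (by linarith), rfl⟩, hm⟩ hγ1
      refine (min_le_right _ _).trans ?_
      have h2 := dist_triangle4 x₀ x (γ x) (γ x₀)
      rw [h.isometry γ hγ, dist_comm x₀ x] at h2
      linarith
    · refine (min_le_left _ _).trans ?_
      rw [mem_closedBall, not_le] at hm
      have := dist_triangle_left (γ x) x₀ x
      linarith

variable {r : ℝ}

/-- If another lift `γ y` were closer to `x` than `y`, then `y` would be moved by less than `r`. -/
theorem IsOrbitMetricMap.dist_eq (h : IsOrbitMetricMap Γ pr)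
    (hr : ∀ γ ∈ Γ, γ ≠ 1 → ∀ x, r ≤ dist x (γ x)) {x y : N} (hxy : dist x y ≤ r / 2) :
    dist (pr x) (pr y) = dist x y := by
  refine le_antisymm (h.dist_le x y) (not_lt.1 fun hlt => ?_)
  obtain ⟨γ, hγ, h1⟩ := h.exists_lt x y _ hlt
  have hγ1 : γ ≠ 1 := by rintro rfl; exact lt_irrefl _ h1
  have h2 := hr γ hγ hγ1 y
  have h3 := dist_triangle_left y (γ y) x
  linarith

theorem IsOrbitMetricMap.eq_of_dist_lt (h : IsOrbitMetricMap Γ pr)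
    (hr : ∀ γ ∈ Γ, γ ≠ 1 → ∀ x, r ≤ dist x (γ x)) {x y : N} (hxy : dist x y < r)
    (hpr : pr x = pr y) : x = y := by
  obtain ⟨γ, hγ, rfl⟩ := (h.eq_iff x y).1 hpr
  by_contra hne
  have hγ1 : γ ≠ 1 := by rintro rfl; exact hne rfl
  have := hr γ hγ hγ1 y
  rw [dist_comm] at hxy
  linarith

/-- Lifts of points close to `b` are taken close to the chosen lift of `b`, the others arbitrarily.
No continuity is asked for, since below the injectivity radius lifts are unique anyway. -/
theorem IsOrbitMetricMap.exists_section (h : IsOrbitMetricMap Γ pr) :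
    ∃ s : ℝ → X → X → N, (∀ r b x, pr (s r b x) = x) ∧
      ∀ r b x, dist x b < r → dist (s r b x) (s r b b) < r := by
  choose t ht using h.surjective
  have : ∀ b x, ∀ r, ∃ y, pr y = x ∧ (dist x b < r → dist y (t b) < r) ∧ (x = b → y = t b) := by
    intro b x r
    by_cases hb : x = b
    · refine ⟨t b, by rw [ht, hb], fun hr => ?_, fun _ => rfl⟩
      rw [dist_self]; exact dist_nonneg.trans_lt hr
    by_cases hx : dist x b < r
    · obtain ⟨γ, hγ, hlt⟩ := h.exists_lt (t b) (t x) r (by rwa [ht, ht, dist_comm])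
      refine ⟨γ (t x), ?_, fun _ => by rwa [dist_comm], fun h => absurd h hb⟩
      conv_rhs => rw [← ht x]
      exact (h.eq_iff _ _).2 ⟨γ, hγ, rfl⟩
    · exact ⟨t x, ht x, fun h => absurd h hx, fun h => absurd h hb⟩
  choose s hs1 hs2 hs3 using this
  refine ⟨fun r b x => s b x r, fun r b x => hs1 b x r, fun r b x hx => ?_⟩
  simp only [hs3 b b r rfl]
  exact hs2 b x r hx

theorem IsOrbitMetricMap.isOpenMap (h : IsOrbitMetricMap Γ pr) : IsOpenMap pr := by
  refine IsOpenMap.of_nhds_le fun x => ?_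
  intro t ht
  obtain ⟨ε, hε, hb⟩ := Metric.mem_nhds_iff.1 (mem_map.1 ht)
  refine Metric.mem_nhds_iff.2 ⟨ε, hε, fun y hy => ?_⟩
  obtain ⟨y, rfl⟩ := h.surjective y
  obtain ⟨γ, hγ, hlt⟩ := h.exists_lt x y ε (by rwa [dist_comm])
  have : pr (γ y) = pr y := (h.eq_iff _ _).2 ⟨γ, hγ, rfl⟩
  rw [← this]
  exact hb (by rwa [mem_ball, dist_comm])

theorem IsOrbitMetricMap.lipschitzWith (h : IsOrbitMetricMap Γ pr) : LipschitzWith 1 pr :=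
  LipschitzWith.of_dist_le_mul fun x y => by simpa using h.dist_le x y

/-- Larger dimension would be visible in every neighbourhood of some point, but the image of a chart
domain is a Lipschitz image of a subset of `ℝ^n`. -/
theorem IsOrbitMetricMap.dimH_le [SecondCountableTopology X] (h : IsOrbitMetricMap Γ pr) {n : ℕ}
    (hch : HasBiLipschitzCharts n N) (S : Set X) : dimH S ≤ n := by
  by_contra! hlt
  obtain ⟨x, -, hx⟩ := exists_mem_nhdsWithin_lt_dimH_of_lt_dimH hlt
  obtain ⟨x, rfl⟩ := h.surjective x
  obtain ⟨e, hxe, C, hC, he⟩ := hch x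
  have h1 := hx (pr '' e.source) (mem_nhdsWithin_of_mem_nhds
    (h.isOpenMap.image_mem_nhds (e.open_source.mem_nhds hxe)))
  have h2 : LipschitzOnWith (Real.toNNReal C) e.symm e.target :=
    LipschitzOnWith.of_dist_le_mul fun u hu v hv => by
      have := (he _ (e.map_target hu) _ (e.map_target hv)).1
      rwa [e.right_inv hu, e.right_inv hv, ← Real.coe_toNNReal C hC.le] at this
  have h3 : dimH (pr '' e.source) ≤ n := by
    refine (h.lipschitzWith.dimH_image_le _).trans ?_
    rw [← e.symm_image_target_eq_source]
    refine (h2.dimH_image_le).trans ((dimH_mono (subset_univ _)).trans ?_)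
    rw [Real.dimH_univ_eq_finrank, finrank_euclideanSpace_fin]
  exact absurd h1 h3.not_gt

theorem IsOrbitMetricMap.exists_packing (h : IsOrbitMetricMap Γ pr) (hr0 : 0 < r)
    (hr : ∀ γ ∈ Γ, γ ≠ 1 → ∀ x, r ≤ dist x (γ x)) {n : ℕ} (hch : HasBiLipschitzCharts n N)
    {K : Set N} (hK : IsCompact K) (hKΓ : ∀ y, ∃ k ∈ K, ∃ γ ∈ Γ, y = γ k) :
    ∃ c > 0, c ≤ 1 ∧ ∃ r₀ > 0, ∀ (b : X) (ρ : ℝ) (m : ℕ), 0 < ρ → ρ ≤ r₀ → 0 < m →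
      ∃ ξ : Fin (m ^ n) → X, (∀ i, dist (ξ i) b ≤ ρ) ∧
        ∀ i j, i ≠ j → c * ρ / m ≤ dist (ξ i) (ξ j) := by
  have H : ∃ c > 0, ∀ x, ∀ (ρ : ℝ) (m : ℕ), 0 < ρ → ρ ≤ c → 0 < m → ∃ ξ : Fin (m ^ n) → N,
      (∀ i, dist (ξ i) x ≤ ρ) ∧ ∀ i j, i ≠ j → c * ρ / m ≤ dist (ξ i) (ξ j) := by
    refine exists_uniform_of_local hK ?_ ?_ hch.exists_packing
    · intro x c c' _ hcc hc ρ m hρ hρc hm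
      obtain ⟨ξ, h1, h2⟩ := hc ρ m hρ (hρc.trans hcc) hm
      exact ⟨ξ, h1, fun i j hij => le_trans (by gcongr) (h2 i j hij)⟩
    · intro y
      obtain ⟨k, hk, γ, hγ, rfl⟩ := hKΓ y
      refine ⟨k, hk, fun c _ hc ρ m hρ hρc hm => ?_⟩
      obtain ⟨ξ, h1, h2⟩ := hc ρ m hρ hρc hm
      exact ⟨fun i => γ (ξ i), fun i => by rw [h.isometry γ hγ]; exact h1 i, fun i j hij => by
        rw [h.isometry γ hγ]; exact h2 i j hij⟩
  obtain ⟨c, hc, hQ⟩ := H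
  refine ⟨min c 1, by positivity, min_le_right _ _, min c (r / 4), by positivity,
    fun b ρ m hρ hρc hm => ?_⟩
  obtain ⟨b, rfl⟩ := h.surjective b
  obtain ⟨ξ, hξ1, hξ2⟩ := hQ b ρ m hρ (hρc.trans (min_le_left _ _)) hm
  refine ⟨fun i => pr (ξ i), fun i => (h.dist_le _ _).trans (hξ1 i), fun i j hij => ?_⟩
  rw [h.dist_eq hr]
  · refine le_trans ?_ (hξ2 i j hij)
    gcongr
    exact min_le_left _ _
  · have h1 := dist_triangle_right (ξ i) (ξ j) b
    have h2 := hξ1 i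
    have h3 := hξ1 j
    have h4 := hρc.trans (min_le_right _ _)
    linarith

variable [Group N] [IsTopologicalGroup N] {V : Type*} [NormedAddCommGroup V] [NormedSpace ℝ V]
  {P : N → V}

theorem IsOrbitMetricMap.exists_norm_sub_le (h : IsOrbitMetricMap Γ pr)
    (hLM : IsLocallyLipschitzMul N) {K Λ : Set N} (hK : IsCompact K)
    (hΛ : ∀ l ∈ Λ, Equiv.mulRight l ∈ Γ) (hKΛ : ∀ y, ∃ k ∈ K, ∃ l ∈ Λ, y = k * l)
    (hmul : ∀ x y, P (x * y) = P x + P y) (hcont : Continuous P) :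
    ∃ c > 0, ∀ x y, dist x y ≤ c → ‖P x - P y‖ ≤ c⁻¹ * dist x y := by
  have hiso : ∀ l ∈ Λ, ∀ x y : N, dist (x * l) (y * l) = dist x y := fun l hl x y =>
    h.isometry _ (hΛ l hl) x y
  exact exists_uniform_of_local hK
    (Q := fun c x => ∀ y, dist x y ≤ c → ‖P x - P y‖ ≤ c⁻¹ * dist x y)
    (fun x c c' hc' hcc hc y hy => (hc y (hy.trans hcc)).trans (by gcongr))
    (fun y => by
      obtain ⟨k, hk, l, hl, rfl⟩ := hKΛ y
      refine ⟨k, hk, fun c _ hc z hz => ?_⟩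
      have h2 : z = z * l⁻¹ * l := by group
      rw [h2, hiso l hl] at hz ⊢
      rw [hmul, hmul (z * l⁻¹), add_sub_add_right_eq_sub]
      exact hc _ hz)
    (norm_sub_le_dist_local hLM hmul hcont)

/-- The functions `P ∘ s b` are the local coordinates used in the game. Both estimates are uniform
on `N` because lattice translations are isometries that change `P` by a constant; they descend
because `pr` is isometric at small scale. -/
theorem IsOrbitMetricMap.exists_local_lifts (h : IsOrbitMetricMap Γ pr) (hr0 : 0 < r)
    (hr : ∀ γ ∈ Γ, γ ≠ 1 → ∀ x, r ≤ dist x (γ x)) {n : ℕ} (hch : HasBiLipschitzCharts n N)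
    (hLM : IsLocallyLipschitzMul N) {K Λ : Set N} (hK : IsCompact K)
    (hΛ : ∀ l ∈ Λ, Equiv.mulRight l ∈ Γ) (hKΛ : ∀ y, ∃ k ∈ K, ∃ l ∈ Λ, y = k * l)
    (hmul : ∀ x y, P (x * y) = P x + P y) (hcont : Continuous P) (hopen : IsOpenMap P) :
    ∃ C₁ > 0, ∃ c > 0, ∃ r₀ > 0, ∃ s : X → X → N, (∀ b x, pr (s b x) = x) ∧
      (∀ b, ∀ x ∈ closedBall b r₀, ∀ y ∈ closedBall b r₀,
        ‖P (s b x) - P (s b y)‖ ≤ C₁ * dist x y) ∧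
      ∀ b, ∀ x ∈ closedBall b r₀, ∀ ℓ : V →L[ℝ] ℝ, ‖ℓ‖ = 1 → ∀ t, 0 < t → t ≤ r₀ →
        ∃ y, dist y x ≤ t ∧ ℓ (P (s b x)) + c * t ≤ ℓ (P (s b y)) := by
  have hiso : ∀ l ∈ Λ, ∀ x y : N, dist (x * l) (y * l) = dist x y := fun l hl x y =>
    h.isometry _ (hΛ l hl) x y
  obtain ⟨c₁, hc₁, hQ₁⟩ := h.exists_norm_sub_le hLM hK hΛ hKΛ hmul hcont
  obtain ⟨c₂, hc₂, hQ₂⟩ := exists_uniform_of_local hK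
    (Q := fun c x => ∀ ℓ : V →L[ℝ] ℝ, ‖ℓ‖ = 1 → ∀ t, 0 < t → t ≤ c →
      ∃ y, dist y x ≤ t ∧ ℓ (P x) + c * t ≤ ℓ (P y))
    (fun x c c' hc' hcc hc ℓ hℓ t ht htc => by
      obtain ⟨y, hy, hy2⟩ := hc ℓ hℓ t ht (htc.trans hcc)
      exact ⟨y, hy, le_trans (by gcongr) hy2⟩)
    (fun y => by
      obtain ⟨k, hk, l, hl, rfl⟩ := hKΛ y
      refine ⟨k, hk, fun c _ hc ℓ hℓ t ht htc => ?_⟩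
      obtain ⟨y, hy, hy2⟩ := hc ℓ hℓ t ht htc
      refine ⟨y * l, by rwa [hiso l hl], ?_⟩
      rw [hmul, hmul y, map_add, map_add]
      linarith)
    (exists_ascent_local hch hLM hmul hopen)
  obtain ⟨s, hs1, hs2⟩ := h.exists_section
  -- A point gained by ascent lies within `2 * r₀` of `b`, hence the section of radius `3 * r₀`. Two
  -- lifts are then within `6 * r₀`, at most `r / 2` and `c₁`; uniqueness of the lift of `pr z`
  -- needs `7 * r₀ < r`.
  set r₀ := min (r / 16) (min (c₁ / 8) c₂) with hr₀
  have hr₀pos : 0 < r₀ := by positivity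
  have hr₀1 : r₀ ≤ r / 16 := min_le_left _ _
  have hr₀2 : r₀ ≤ c₁ / 8 := (min_le_right _ _).trans (min_le_left _ _)
  have hr₀3 : r₀ ≤ c₂ := (min_le_right _ _).trans (min_le_right _ _)
  refine ⟨c₁⁻¹, by positivity, c₂, hc₂, r₀, hr₀pos, s (3 * r₀), fun b x => hs1 _ b x, ?_, ?_⟩
  · intro b x hx y hy
    have h1 := hs2 (3 * r₀) b x (by rw [mem_closedBall] at hx; linarith)
    have h2 := hs2 (3 * r₀) b y (by rw [mem_closedBall] at hy; linarith)
    have h3 := dist_triangle_right (s (3 * r₀) b x) (s (3 * r₀) b y) (s (3 * r₀) b b)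
    have h4 := hQ₁ (s (3 * r₀) b x) (s (3 * r₀) b y) (by linarith)
    have h5 := h.dist_eq hr (x := s (3 * r₀) b x) (y := s (3 * r₀) b y) (by linarith)
    rw [hs1, hs1] at h5
    rwa [← h5] at h4
  · intro b x hx ℓ hℓ t ht htr
    rw [mem_closedBall] at hx
    obtain ⟨z, hz, hz2⟩ := hQ₂ (s (3 * r₀) b x) ℓ hℓ t ht (htr.trans hr₀3)
    have h0 : dist (pr z) x ≤ t := by
      have := h.dist_le z (s (3 * r₀) b x)
      rw [hs1] at this
      exact this.trans hz
    refine ⟨pr z, h0, ?_⟩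
    have h1 := hs2 (3 * r₀) b x (by linarith)
    have h2 := hs2 (3 * r₀) b (pr z) (by
      have := dist_triangle (pr z) x b
      linarith)
    have h3 : s (3 * r₀) b (pr z) = z := by
      refine h.eq_of_dist_lt hr ?_ (hs1 _ _ _)
      have h4 := dist_triangle_right (s (3 * r₀) b (pr z)) z (s (3 * r₀) b b)
      have h5 := dist_triangle z (s (3 * r₀) b x) (s (3 * r₀) b b)
      linarith
    rwa [h3]

end OrbitQuotient

/-! ### The lattice of translations of an infranil group -/

section Lattice

variable {N : Type*} [Group N]

/-- The elements of `N` whose right translation belongs to `Γ`. -/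
def translationLattice (Γ : Subgroup (Equiv.Perm N)) : Subgroup N where
  carrier := {c | Equiv.mulRight c ∈ Γ}
  one_mem' := by simp
  mul_mem' {a b} ha hb := by
    have : Equiv.mulRight (a * b) = Equiv.mulRight b * Equiv.mulRight a := by
      ext x; simp [mul_assoc]
    change Equiv.mulRight (a * b) ∈ Γ
    rw [this]
    exact Γ.mul_mem hb ha
  inv_mem' {a} ha := by
    have : Equiv.mulRight a⁻¹ = (Equiv.mulRight a)⁻¹ := by
      ext x; simp
    change Equiv.mulRight a⁻¹ ∈ Γ
    rw [this]
    exact Γ.inv_mem ha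

variable {Γ : Subgroup (Equiv.Perm N)}

theorem mem_translationLattice {c : N} : c ∈ translationLattice Γ ↔ Equiv.mulRight c ∈ Γ := Iff.rfl

theorem finite_translationLattice_inter [TopologicalSpace N]
    (hpd : ∀ K : Set N, IsCompact K → {γ | γ ∈ Γ ∧ (γ '' K ∩ K).Nonempty}.Finite) (K : Set N)
    (hK : IsCompact K) : ((translationLattice Γ : Set N) ∩ K).Finite := by
  refine Set.Finite.of_finite_image ((hpd (insert 1 K) (hK.insert 1)).subset ?_)
    (f := Equiv.mulRight) ?_
  · rintro _ ⟨l, ⟨hl, hlK⟩, rfl⟩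
    exact ⟨hl, l, ⟨1, mem_insert _ _, by simp⟩, mem_insert_of_mem _ hlK⟩
  · intro a _ b _ hab
    simpa using DFunLike.congr_fun hab 1

theorem exists_finite_translationLattice_cosets
    (hfin : ((rightTranslations N).subgroupOf Γ).FiniteIndex) :
    ∃ T : Set (Equiv.Perm N), T.Finite ∧ T ⊆ Γ ∧
      ∀ γ ∈ Γ, ∃ t ∈ T, ∃ l ∈ translationLattice Γ, ∀ x, γ x = t x * l := by
  -- Inverses of coset representatives are taken so that the lattice translation is applied after
  -- `t`.
  refine ⟨range fun q : Γ ⧸ (rightTranslations N).subgroupOf Γ => ((q.out⁻¹ : Γ) : Equiv.Perm N),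
    finite_range _, ?_, fun γ hγ => ?_⟩
  · rintro _ ⟨q, rfl⟩
    exact (q.out⁻¹).2
  · set q : Γ ⧸ (rightTranslations N).subgroupOf Γ := QuotientGroup.mk (⟨γ, hγ⟩⁻¹ : Γ) with hq
    have h1 : q.out⁻¹ * (⟨γ, hγ⟩⁻¹ : Γ) ∈ (rightTranslations N).subgroupOf Γ := by
      rw [← QuotientGroup.eq, QuotientGroup.out_eq']
    obtain ⟨c, hc⟩ := ((rightTranslations N).subgroupOf Γ).inv_mem h1
    have h2 : ((q.out⁻¹ * (⟨γ, hγ⟩⁻¹ : Γ))⁻¹ : Γ) = Equiv.mulRight c := by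
      ext x; simpa using hc x
    refine ⟨_, ⟨q, rfl⟩, c, ?_, fun x => ?_⟩
    · rw [mem_translationLattice, ← h2]
      exact Subtype.property _
    · have h3 := hc (((q.out⁻¹ : Γ) : Equiv.Perm N) x)
      rw [← h3]
      simp

theorem exists_isCompact_mul_translationLattice [TopologicalSpace N]
    (hfin : ((rightTranslations N).subgroupOf Γ).FiniteIndex) (hcont : ∀ γ ∈ Γ, Continuous γ)
    {K : Set N} (hK : IsCompact K) (hKΓ : ∀ y, ∃ k ∈ K, ∃ γ ∈ Γ, y = γ k) :
    ∃ K', IsCompact K' ∧ ∀ y, ∃ k ∈ K', ∃ l ∈ translationLattice Γ, y = k * l := by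
  obtain ⟨T, hT, hTΓ, h⟩ := exists_finite_translationLattice_cosets hfin
  refine ⟨⋃ t ∈ T, t '' K, hT.isCompact_biUnion fun t ht => hK.image (hcont t (hTΓ ht)),
    fun y => ?_⟩
  obtain ⟨k, hk, γ, hγ, rfl⟩ := hKΓ y
  obtain ⟨t, ht, l, hl, htl⟩ := h γ hγ
  exact ⟨t k, mem_biUnion ht ⟨k, hk, rfl⟩, l, hl, htl k⟩

end Lattice

/-! ### Subsets of finitely many cosets of a discrete group -/

section DiscreteValues

variable {V : Type*} [NormedAddCommGroup V] {Δ : AddSubgroup V} {W Y : Set V}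

theorem finite_inter_closedBall_of_cosets
    (hΔ : ∀ r, ((Δ : Set V) ∩ Metric.closedBall 0 r).Finite) (hW : W.Finite)
    (hY : ∀ z ∈ Y, ∃ w ∈ W, z - w ∈ Δ) (r : ℝ) : (Y ∩ Metric.closedBall 0 r).Finite := by
  refine (hW.biUnion fun w _ => (hΔ (r + ‖w‖)).image fun u => u + w).subset ?_
  rintro z ⟨hz, hzr⟩
  obtain ⟨w, hw, hzw⟩ := hY z hz
  refine mem_biUnion hw ⟨z - w, ⟨hzw, ?_⟩, by simp⟩
  rw [mem_closedBall_zero_iff] at hzr ⊢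
  exact (norm_sub_le _ _).trans (by gcongr)

theorem countable_of_cosets
    (hΔ : ∀ r, ((Δ : Set V) ∩ Metric.closedBall 0 r).Finite) (hW : W.Finite)
    (hY : ∀ z ∈ Y, ∃ w ∈ W, z - w ∈ Δ) : Y.Countable := by
  refine (countable_iUnion fun k : ℕ =>
    (finite_inter_closedBall_of_cosets hΔ hW hY k).countable).mono fun z hz => ?_
  obtain ⟨k, hk⟩ := exists_nat_ge ‖z‖
  exact mem_iUnion.2 ⟨k, hz, mem_closedBall_zero_iff.2 hk⟩

/-- Differences of points of `Y` again lie in finitely many cosets of `Δ`, so only finitely many of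
them have norm at most `1`. -/
theorem exists_separation_of_cosets
    (hΔ : ∀ r, ((Δ : Set V) ∩ Metric.closedBall 0 r).Finite) (hW : W.Finite)
    (hY : ∀ z ∈ Y, ∃ w ∈ W, z - w ∈ Δ) :
    ∃ η > 0, ∀ z ∈ Y, ∀ z' ∈ Y, z ≠ z' → η ≤ ‖z - z'‖ := by
  have hfin : ({u | ∃ z ∈ Y, ∃ z' ∈ Y, u = z - z'} ∩ Metric.closedBall 0 1).Finite := by
    refine finite_inter_closedBall_of_cosets hΔ (hW.image2 (fun w w' => w - w') hW) ?_ 1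
    rintro _ ⟨z, hz, z', hz', rfl⟩
    obtain ⟨w, hw, h⟩ := hY z hz
    obtain ⟨w', hw', h'⟩ := hY z' hz'
    refine ⟨w - w', ⟨w, hw, w', hw', rfl⟩, ?_⟩
    have : z - z' - (w - w') = (z - w) - (z' - w') := by abel
    rw [this]
    exact Δ.sub_mem h h'
  have hmin : ∃ η > 0, ∀ u ∈ {u | ∃ z ∈ Y, ∃ z' ∈ Y, u = z - z'} ∩ Metric.closedBall 0 1,
      u ≠ 0 → η ≤ ‖u‖ := by
    refine hfin.induction_on_subset (motive := fun s _ => ∃ η > 0, ∀ u ∈ s, u ≠ 0 → η ≤ ‖u‖) _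
      ⟨1, one_pos, by simp⟩ ?_
    rintro u s - - - ⟨η, hη, hs⟩
    by_cases hu : u = 0
    · refine ⟨η, hη, fun v hv hv0 => ?_⟩
      rcases hv with rfl | hv
      · exact absurd hu hv0
      · exact hs v hv hv0
    · refine ⟨min η ‖u‖, lt_min hη (norm_pos_iff.2 hu), fun v hv hv0 => ?_⟩
      rcases hv with rfl | hv
      · exact min_le_right _ _
      · exact (min_le_left _ _).trans (hs v hv hv0)
  obtain ⟨η, hη, h⟩ := hmin
  refine ⟨min η 1, by positivity, fun z hz z' hz' hne => ?_⟩
  by_cases h1 : ‖z - z'‖ ≤ 1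
  · exact (min_le_left _ _).trans (h _ ⟨⟨z, hz, z', hz', rfl⟩, mem_closedBall_zero_iff.2 h1⟩
      (sub_ne_zero.2 hne))
  · exact (min_le_right _ _).trans (not_le.1 h1).le

end DiscreteValues

/-! ### Orbits of the group seen in the abelianization -/

section OrbitValues

variable {N : Type*} [Group N] {V : Type*} [AddCommGroup V] {P : N → V}
  {Γ : Subgroup (Equiv.Perm N)}

/-- The values of `P` on the `Γ`-orbits through the fibre of `P` over `v`. -/
def orbitValues (P : N → V) (Γ : Subgroup (Equiv.Perm N)) (v : V) : Set V :=
  {z | ∃ γ ∈ Γ, ∃ x, P x = v ∧ P (γ x) = z}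

/-- The commutator subgroup is characteristic, so affine maps permute the fibres of `P`. -/
theorem apply_affine_eq_of_eq (hmul : ∀ x y, P (x * y) = P x + P y)
    (hker : ∀ x, P x = 0 ↔ x ∈ commutator N) {γ : Equiv.Perm N} {A : N ≃* N} {c : N}
    (hγ : ∀ x, γ x = A x * c) {x y : N} (hxy : P x = P y) : P (γ x) = P (γ y) := by
  have h1 : P (x⁻¹ * y) = 0 := by
    have := hmul x (x⁻¹ * y)
    rw [mul_inv_cancel_left, ← hxy] at this
    simpa using this
  have h2 : P (A (x⁻¹ * y)) = 0 := by
    rw [hker] at h1 ⊢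
    have := (inferInstance : (commutator N).Characteristic)
    have h3 := Subgroup.characteristic_iff_le_comap.1 this A h1
    exact h3
  have h3 : γ y = A x * A (x⁻¹ * y) * c := by
    rw [hγ, ← map_mul, mul_inv_cancel_left]
  rw [h3, hγ, hmul, hmul, hmul, h2, add_zero]

theorem exists_finite_cosets_orbitValues (hmul : ∀ x y, P (x * y) = P x + P y)
    (hker : ∀ x, P x = 0 ↔ x ∈ commutator N) (hsurj : Function.Surjective P)
    (haff : ∀ γ ∈ Γ, ∃ A : N ≃* N, ∃ c, ∀ x, γ x = A x * c)
    (hfin : ((rightTranslations N).subgroupOf Γ).FiniteIndex) (v : V) :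
    ∃ W : Set V, W.Finite ∧ ∀ z ∈ orbitValues P Γ v, ∃ w ∈ W,
      ∃ l ∈ translationLattice Γ, z - w = P l := by
  obtain ⟨T, hT, hTΓ, h⟩ := exists_finite_translationLattice_cosets hfin
  obtain ⟨x₀, rfl⟩ := hsurj v
  refine ⟨(fun t => P (t x₀)) '' T, hT.image _, ?_⟩
  rintro _ ⟨γ, hγ, x, hx, rfl⟩
  obtain ⟨t, ht, l, hl, htl⟩ := h γ hγ
  obtain ⟨A, c, hA⟩ := haff t (hTΓ ht)
  refine ⟨_, ⟨t, ht, rfl⟩, l, hl, ?_⟩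
  rw [htl, hmul, apply_affine_eq_of_eq hmul hker hA hx]
  simp

end OrbitValues

/-! ### Periodic points in the abelianization -/

section LatticeProjection

variable {N : Type*} [Group N] {V : Type*} [NormedAddCommGroup V] [NormedSpace ℝ V]

/-- `P` is a projection of `N` to its abelianization `V`, in which the translations of the infranil
group `Γ` form a lattice. -/
structure IsLatticeProjection (Γ : Subgroup (Equiv.Perm N)) (P : N → V) : Prop where
  map_mul : ∀ x y, P (x * y) = P x + P y
  surjective : Function.Surjective P
  apply_eq_zero_iff : ∀ x, P x = 0 ↔ x ∈ commutator N
  affine : ∀ γ ∈ Γ, ∃ A : N ≃* N, ∃ c, ∀ x, γ x = A x * c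
  finiteIndex : ((rightTranslations N).subgroupOf Γ).FiniteIndex
  finite_inter : ∀ r, (P '' translationLattice Γ ∩ Metric.closedBall 0 r).Finite
  span_eq_top : Submodule.span ℝ (P '' translationLattice Γ) = ⊤

variable {Γ : Subgroup (Equiv.Perm N)} {P : N → V}

theorem IsLatticeProjection.map_one (h : IsLatticeProjection Γ P) : P 1 = 0 :=
  (h.apply_eq_zero_iff 1).2 (one_mem _)

/-- The lattice of translations in the abelianization. -/
def IsLatticeProjection.lattice (h : IsLatticeProjection Γ P) : AddSubgroup V where
  carrier := P '' translationLattice Γ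
  zero_mem' := ⟨1, one_mem _, h.map_one⟩
  add_mem' := by
    rintro _ _ ⟨a, ha, rfl⟩ ⟨b, hb, rfl⟩
    exact ⟨a * b, mul_mem ha hb, h.map_mul a b⟩
  neg_mem' := by
    rintro _ ⟨a, ha, rfl⟩
    refine ⟨a⁻¹, inv_mem ha, ?_⟩
    rw [eq_neg_iff_add_eq_zero, ← h.map_mul, inv_mul_cancel, h.map_one]

theorem IsLatticeProjection.exists_cosets (h : IsLatticeProjection Γ P) (v : V) :
    ∃ W : Set V, W.Finite ∧ ∀ z ∈ orbitValues P Γ v, ∃ w ∈ W, z - w ∈ h.lattice := by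
  obtain ⟨W, hW, hY⟩ := exists_finite_cosets_orbitValues h.map_mul h.apply_eq_zero_iff h.surjective
    h.affine h.finiteIndex v
  refine ⟨W, hW, fun z hz => ?_⟩
  obtain ⟨w, hw, l, hl, hzw⟩ := hY z hz
  exact ⟨w, hw, l, hl, hzw.symm⟩

theorem IsLatticeProjection.countable_orbitValues (h : IsLatticeProjection Γ P) (v : V) :
    (orbitValues P Γ v).Countable := by
  obtain ⟨W, hW, hY⟩ := h.exists_cosets v
  exact countable_of_cosets (Δ := h.lattice) h.finite_inter hW hY

theorem IsLatticeProjection.exists_separation_orbitValues (h : IsLatticeProjection Γ P) (v : V) :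
    ∃ η > 0, ∀ z ∈ orbitValues P Γ v, ∀ z' ∈ orbitValues P Γ v, z ≠ z' → η ≤ ‖z - z'‖ := by
  obtain ⟨W, hW, hY⟩ := h.exists_cosets v
  exact exists_separation_of_cosets (Δ := h.lattice) h.finite_inter hW hY

/-- `R` preserves the action of `Γ`, and induces `L` on the abelianization. -/
structure IsEquivariantLift (Γ : Subgroup (Equiv.Perm N)) (P : N → V) (R : N ≃* N)
    (L : Module.End ℝ V) : Prop where
  exists_apply : ∀ x, ∀ γ ∈ Γ, ∃ γ' ∈ Γ, R (γ x) = γ' (R x)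
  apply_eq : ∀ x, P (R x) = L (P x)

variable {R : N ≃* N} {L : Module.End ℝ V}

theorem IsEquivariantLift.iterate_apply_eq (hR : IsEquivariantLift Γ P R L) (k : ℕ) (x : N) :
    P (R^[k] x) = (L ^ k) (P x) := by
  induction k with
  | zero => simp
  | succ k ih => rw [Function.iterate_succ_apply', hR.apply_eq, ih, pow_succ', Module.End.mul_apply]

theorem IsEquivariantLift.exists_iterate_apply (hR : IsEquivariantLift Γ P R L) (k : ℕ) (x : N) :
    ∀ γ ∈ Γ, ∃ γ' ∈ Γ, R^[k] (γ x) = γ' (R^[k] x) := by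
  intro γ hγ
  induction k with
  | zero => exact ⟨γ, hγ, rfl⟩
  | succ k ih =>
    obtain ⟨γ', hγ', h⟩ := ih
    obtain ⟨γ'', hγ'', h'⟩ := hR.exists_apply (R^[k] x) γ' hγ'
    exact ⟨γ'', hγ'', by rw [Function.iterate_succ_apply', Function.iterate_succ_apply', h, h']⟩

/-- Equivariance at the point `1` shows that `R^k` maps a lattice element to `γ 1` with `γ ∈ Γ`.
This `γ` is not known to be a translation, so the conclusion is about `orbitValues` and not about
the lattice. -/
theorem IsEquivariantLift.pow_apply_mem (hR : IsEquivariantLift Γ P R L)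
    (h : IsLatticeProjection Γ P) (k : ℕ) {w : V} (hw : w ∈ P '' translationLattice Γ) :
    (L ^ k) w ∈ orbitValues P Γ 0 := by
  obtain ⟨l, hl, rfl⟩ := hw
  obtain ⟨γ, hγ, h1⟩ := hR.exists_iterate_apply k 1 _ hl
  have h2 : R^[k] 1 = 1 := iterate_map_one R k
  refine ⟨γ, hγ, 1, h.map_one, ?_⟩
  rw [h2] at h1
  rw [← hR.iterate_apply_eq, ← h1]
  simp

theorem IsEquivariantLift.injective [FiniteDimensional ℝ V] (hR : IsEquivariantLift Γ P R L)
    (h : IsLatticeProjection Γ P) : Function.Injective L := by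
  rw [LinearMap.injective_iff_surjective]
  intro v
  obtain ⟨x, rfl⟩ := h.surjective v
  exact ⟨P (R.symm x), by rw [← hR.apply_eq, R.apply_symm_apply]⟩

theorem IsEquivariantLift.pow_injective [FiniteDimensional ℝ V] (hR : IsEquivariantLift Γ P R L)
    (h : IsLatticeProjection Γ P) (k : ℕ) : Function.Injective (L ^ k) := by
  rw [Module.End.coe_pow]
  exact (hR.injective h).iterate k

/-- The orbit of `w` stays in a uniformly discrete set. Convergence would force two consecutive
terms to agree, so that `w` would be a nonzero fixed vector, against hyperbolicity. -/
theorem IsEquivariantLift.not_tendsto [FiniteDimensional ℝ V] (hR : IsEquivariantLift Γ P R L)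
    (h : IsLatticeProjection Γ P) (hL : IsSemisimpleHyperbolic L) {w : V}
    (hw : w ∈ P '' translationLattice Γ) (hw0 : w ≠ 0) :
    ¬Filter.Tendsto (fun k : ℕ => (L ^ k) w) Filter.atTop (𝓝 0) := by
  intro ht
  obtain ⟨η, hη, hsep⟩ := h.exists_separation_orbitValues 0
  have h1 : Filter.Tendsto (fun k : ℕ => (L ^ k) w - (L ^ (k + 1)) w) Filter.atTop (𝓝 0) := by
    simpa using ht.sub (ht.comp (Filter.tendsto_add_atTop_nat 1))
  obtain ⟨k, hk⟩ := (h1.eventually (Metric.ball_mem_nhds 0 hη)).exists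
  rw [dist_zero_right] at hk
  have h2 : (L ^ k) w = (L ^ (k + 1)) w := by
    by_contra hne
    exact absurd (hsep _ (hR.pow_apply_mem h k hw) _ (hR.pow_apply_mem h (k + 1) hw) hne) hk.not_ge
  rw [pow_succ, Module.End.mul_apply] at h2
  have h3 := hR.pow_injective h k h2
  exact hw0 (hL.eq_zero_of_pow_apply_eq_self one_ne_zero (by rw [pow_one]; exact h3.symm))

theorem IsLatticeProjection.exists_ne_zero [Nontrivial V] (h : IsLatticeProjection Γ P) :
    ∃ w ∈ P '' translationLattice Γ, w ≠ 0 := by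
  by_contra! H
  have h1 := h.span_eq_top
  rw [Submodule.span_eq_bot.2 H] at h1
  exact bot_ne_top h1

/-- A lift is determined by its values on a finite set of lattice vectors spanning `V`, and these
values lie in a countable set. -/
theorem IsLatticeProjection.countable_lifts [FiniteDimensional ℝ V]
    (h : IsLatticeProjection Γ P) :
    {L : Module.End ℝ V | ∃ R, IsEquivariantLift Γ P R L}.Countable := by
  obtain ⟨t, ht, hspan⟩ := (Submodule.fg_span_iff_fg_span_finset_subset
    (P '' (translationLattice Γ : Set N))).1 (IsNoetherian.noetherian (R := ℝ) _)
  rw [h.span_eq_top] at hspan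
  have := (h.countable_orbitValues 0).to_subtype
  let f : {L : Module.End ℝ V | ∃ R, IsEquivariantLift Γ P R L} → (t → orbitValues P Γ 0) :=
    fun L u => ⟨L.1 u, by
      obtain ⟨R, hR⟩ := L.2
      simpa using hR.pow_apply_mem h 1 (ht u.2)⟩
  have hf : Function.Injective f := by
    intro L L' hLL
    apply Subtype.ext
    refine LinearMap.ext_on hspan.symm fun u hu => ?_
    exact congrArg Subtype.val (congrFun hLL ⟨u, hu⟩)
  exact hf.countable

/-- All iterates `R^(m k) y` lie in the orbit of `y`. Modulo lattice translations there are finitely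
many group elements, so two iterates use the same representative and differ in `V` by a lattice
vector. -/
theorem IsEquivariantLift.exists_sub_mem (hR : IsEquivariantLift Γ P R L)
    (h : IsLatticeProjection Γ P) {y : N} {m : ℕ} (hm : 0 < m) {γ : Equiv.Perm N} (hγ : γ ∈ Γ)
    (hy : R^[m] y = γ y) :
    ∃ a b : ℕ, a < b ∧ (L ^ b) (P y) - (L ^ a) (P y) ∈ P '' translationLattice Γ := by
  have hper : ∀ k : ℕ, ∃ δ ∈ Γ, R^[m * k] y = δ y := by
    intro k
    induction k with
    | zero => exact ⟨1, Γ.one_mem, rfl⟩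
    | succ k ih =>
      obtain ⟨δ, hδ, h1⟩ := ih
      obtain ⟨δ', hδ', h2⟩ := hR.exists_iterate_apply m y δ hδ
      refine ⟨δ' * γ, Γ.mul_mem hδ' hγ, ?_⟩
      rw [Nat.mul_succ, Nat.add_comm, Function.iterate_add_apply, h1, h2, hy, Equiv.Perm.mul_apply]
  choose δ hδ hδy using hper
  obtain ⟨T, hT, -, hcos⟩ := exists_finite_translationLattice_cosets h.finiteIndex
  choose t ht l hl htl using fun k => hcos (δ k) (hδ k)
  obtain ⟨a, b, hab, htab⟩ : ∃ a b, a < b ∧ t a = t b := by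
    obtain ⟨a, -, b, -, hne, heq⟩ := infinite_univ.exists_ne_map_eq_of_mapsTo
      (f := t) (fun k _ => ht k) hT
    rcases hne.lt_or_gt with hlt | hlt
    · exact ⟨a, b, hlt, heq⟩
    · exact ⟨b, a, hlt, heq.symm⟩
  refine ⟨m * a, m * b, Nat.mul_lt_mul_of_pos_left hab hm, ?_⟩
  rw [← hR.iterate_apply_eq, ← hR.iterate_apply_eq, hδy, hδy, htl, htl, htab, h.map_mul,
    h.map_mul, add_sub_add_left_eq_sub]
  exact h.lattice.sub_mem ⟨_, hl b, rfl⟩ ⟨_, hl a, rfl⟩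

/-- For `a < b` the map `L^b - L^a` is injective, because `L^a` is and `L^(b - a)` has no nonzero
fixed vector. So each pair contributes at most one point per lattice vector. -/
theorem IsEquivariantLift.countable_periodic [FiniteDimensional ℝ V]
    (hR : IsEquivariantLift Γ P R L) (h : IsLatticeProjection Γ P)
    (hL : IsSemisimpleHyperbolic L) :
    {v : V | ∃ a b : ℕ, a < b ∧ (L ^ b) v - (L ^ a) v ∈ P '' translationLattice Γ}.Countable := by
  have hc : (P '' translationLattice Γ).Countable :=
    countable_of_cosets (Δ := h.lattice) (W := {0}) h.finite_inter (finite_singleton 0)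
      fun z hz => ⟨0, rfl, by rw [sub_zero]; exact hz⟩
  have h1 : ∀ a b : ℕ, a < b →
      {v : V | (L ^ b) v - (L ^ a) v ∈ P '' translationLattice Γ}.Countable := by
    intro a b hab
    refine hc.preimage_of_injOn (f := fun v => (L ^ b) v - (L ^ a) v) fun v _ v' _ hvv => ?_
    have h2 : (L ^ b) (v - v') = (L ^ a) (v - v') := by
      rw [map_sub, map_sub]
      exact sub_eq_sub_iff_sub_eq_sub.1 hvv
    obtain ⟨c, rfl⟩ := Nat.exists_eq_add_of_lt hab
    rw [add_assoc, pow_add, Module.End.mul_apply] at h2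
    exact sub_eq_zero.1 (hL.eq_zero_of_pow_apply_eq_self (Nat.succ_ne_zero c)
      (hR.pow_injective h a h2))
  refine (countable_iUnion fun a => countable_iUnion fun b =>
    countable_iUnion fun hab : a < b => h1 a b hab).mono ?_
  rintro v ⟨a, b, hab, hv⟩
  exact mem_iUnion.2 ⟨a, mem_iUnion.2 ⟨b, mem_iUnion.2 ⟨hab, hv⟩⟩⟩

end LatticeProjection

/-! ### Independence of the model of the abelianization -/

section Transfer

variable {N : Type*} [Group N] [TopologicalSpace N]
  {V V' : Type*} [NormedAddCommGroup V] [NormedSpace ℝ V]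
  [NormedAddCommGroup V'] [NormedSpace ℝ V'] {P : N → V} {P' : N → V'}

/-- Two projections to the abelianization differ by a linear isomorphism. -/
theorem exists_linearEquiv_of_ker_eq (hmul : ∀ x y, P (x * y) = P x + P y) (hcont : Continuous P)
    (hsurj : Function.Surjective P) (hopen : IsOpenMap P)
    (hmul' : ∀ x y, P' (x * y) = P' x + P' y) (hcont' : Continuous P')
    (hsurj' : Function.Surjective P') (hker : ∀ x, P x = 0 ↔ P' x = 0) :
    ∃ e : V ≃ₗ[ℝ] V', ∀ x, e (P x) = P' x := by
  have hdiv : ∀ x y, P x = P y ↔ P (x * y⁻¹) = 0 := fun x y => by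
    have := hmul (x * y⁻¹) y
    rw [inv_mul_cancel_right] at this
    rw [this, add_eq_right]
  have hdiv' : ∀ x y, P' x = P' y ↔ P' (x * y⁻¹) = 0 := fun x y => by
    have := hmul' (x * y⁻¹) y
    rw [inv_mul_cancel_right] at this
    rw [this, add_eq_right]
  have hiff : ∀ x y, P x = P y ↔ P' x = P' y := fun x y => by rw [hdiv, hdiv', hker]
  choose s hs using hsurj
  have hT : ∀ x, P' (s (P x)) = P' x := fun x => (hiff _ _).1 (hs _)
  -- Equal kernels make this independent of the section `s`, hence additive. It is continuous
  -- because `P` is a quotient map, and so it is real linear.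
  let T : V →+ V' := AddMonoidHom.mk' (fun v => P' (s v)) fun u v => by
    rw [← hmul']
    exact (hiff _ _).1 (by rw [hs, hmul, hs, hs])
  have hTc : Continuous T := by
    have hq : IsQuotientMap P :=
      (IsOpenQuotientMap.mk (fun v => ⟨s v, hs v⟩) hcont hopen).isQuotientMap
    rw [hq.continuous_iff]
    exact hcont'.congr fun x => (hT x).symm
  refine ⟨LinearEquiv.ofBijective (T.toRealLinearMap hTc : V →ₗ[ℝ] V') ⟨?_, ?_⟩, fun x => hT x⟩
  · intro u v huv
    have : P' (s u) = P' (s v) := huv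
    rw [← hiff, hs, hs] at this
    exact this
  · intro w
    obtain ⟨x, rfl⟩ := hsurj' w
    exact ⟨P x, hT x⟩

theorem IsSemisimpleHyperbolic.conj [FiniteDimensional ℝ V] [FiniteDimensional ℝ V']
    {L : Module.End ℝ V} (hL : IsSemisimpleHyperbolic L) (e : V ≃ₗ[ℝ] V') :
    IsSemisimpleHyperbolic (e.conj L) := by
  refine ⟨(LinearEquiv.isSemisimple_iff L _ e ?_).1 hL.1, fun z hz => hL.2 z ?_⟩
  · ext v
    simp [LinearEquiv.conj_apply]
  · rwa [LinearEquiv.charpoly_conj] at hz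

end Transfer

/-! ### The winning set of points with no periodic points in their orbit closures -/

section WinningSet

open Metric

variable {N X : Type*} [MetricSpace N] [MetricSpace X] {Γ : Subgroup (Equiv.Perm N)} {pr : N → X}
  [Group N] {V : Type*} [NormedAddCommGroup V] [NormedSpace ℝ V] {P : N → V}

/-- The points whose orbit closure under maps induced by hyperbolic lifts contains no periodic
points. -/
def nonperiodicSet (Γ : Subgroup (Equiv.Perm N)) (pr : N → X) (P : N → V)
    [Module.Finite ℝ V] : Set X :=
  {ξ | ∀ R L, IsEquivariantLift Γ P R L → IsSemisimpleHyperbolic L → ∀ f : X → X,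
    (∀ x, f (pr x) = pr (R x)) → ∀ y ∈ closure (range fun k : ℕ => f^[k] ξ),
      y ∉ Function.periodicPts f}

/-- If the orbit of `ξ` accumulates at `pr y`, then `R^k` of a lift of `ξ` comes close to some `γ'
y`, so by the Lipschitz bound `L^k` of its projection comes close to an element of `orbitValues P Γ
(P y)`, which the avoidance game prevents. The threshold for `α` involves only the geometric
constants of `P`, so the same `α` serves all pairs in the countable intersection. -/
theorem isAlphaWinning_nonperiodicSet [IsTopologicalGroup N] [CompactSpace X]
    [FiniteDimensional ℝ V] [Nontrivial V]
    (h : IsOrbitMetricMap Γ pr) {r : ℝ} (hr0 : 0 < r)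
    (hr : ∀ γ ∈ Γ, γ ≠ 1 → ∀ x, r ≤ dist x (γ x)) {n : ℕ} (hch : HasBiLipschitzCharts n N)
    (hLM : IsLocallyLipschitzMul N) {K : Set N} (hK : IsCompact K)
    (hKΛ : ∀ y, ∃ k ∈ K, ∃ l ∈ translationLattice Γ, y = k * l)
    (hP : IsLatticeProjection Γ P) (hcont : Continuous P) (hopen : IsOpenMap P) :
    ∃ ν > 0, ν ≤ 1 / 2 ∧ ∀ α, 0 < α → α ≤ ν → IsAlphaWinning α (nonperiodicSet Γ pr P) := by
  obtain ⟨C₁, hC₁, c, hc, r₀, hr₀, s, hs, hLip, hasc⟩ := h.exists_local_lifts hr0 hr hch hLM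
    (Λ := translationLattice Γ) hK (fun l hl => hl) hKΛ hP.map_mul hcont hopen
  obtain ⟨c', hc', hunif⟩ := h.exists_norm_sub_le hLM (Λ := translationLattice Γ) hK
    (fun l hl => hl) hKΛ hP.map_mul hcont
  refine ⟨min (1 / 2) (c / (4 * C₁)), by positivity, min_le_left _ _, fun α hα hαν => ?_⟩
  have hα2 : α ≤ 1 / 2 := hαν.trans (min_le_left _ _)
  have hαc : C₁ * α ≤ c / 4 := by
    have := hαν.trans (min_le_right _ _)
    rw [le_div_iff₀ (by positivity)] at this
    linarith
  let avoid : Module.End ℝ V → V → Set X := fun L v =>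
    {x | ∃ b, dist x b ≤ r₀ ∧ ∃ δ > 0, ∀ k : ℕ, ∀ y ∈ orbitValues P Γ v,
      δ ≤ ‖(L ^ k) (P (s b x)) - y‖}
  have hwin : IsAlphaWinning α (⋂ L ∈ {L : Module.End ℝ V |
      (∃ R, IsEquivariantLift Γ P R L) ∧ IsSemisimpleHyperbolic L},
      ⋂ v ∈ {v : V | ∃ a b : ℕ, a < b ∧ (L ^ b) v - (L ^ a) v ∈ P '' translationLattice Γ},
        avoid L v) := by
    refine IsAlphaWinning.biInter hα (by linarith)
      (hP.countable_lifts.mono fun L hL => hL.1) ?_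
    rintro L ⟨⟨R, hR⟩, hL⟩
    refine IsAlphaWinning.biInter hα (by linarith) (hR.countable_periodic hP hL) fun v _ => ?_
    obtain ⟨w, hw, hw0⟩ := hP.exists_ne_zero
    obtain ⟨φ, lam, C, hlam, hφ1, hφ, hC0, hC⟩ :=
      hL.exists_dominant (hR.not_tendsto hP hL hw hw0)
    obtain ⟨η, hη, hsep⟩ := hP.exists_separation_orbitValues v
    exact isAlphaWinning_avoid hC₁ hc hr₀ (F := fun b x => P (s b x)) hLip hasc hlam hφ1 hφ hC0 hC
      hη hsep hα hα2 hαc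
  refine hwin.mono fun ξ hξ R L hR hL f hf y hy hper => ?_
  obtain ⟨m, hm, hym⟩ := hper
  obtain ⟨y, rfl⟩ := h.surjective y
  have hiter : ∀ (k : ℕ) (x : N), f^[k] (pr x) = pr (R^[k] x) := by
    intro k x
    induction k with
    | zero => rfl
    | succ k ih => rw [Function.iterate_succ_apply', ih, hf, Function.iterate_succ_apply']
  have hym' : pr (R^[m] y) = pr y := by rw [← hiter]; exact hym
  obtain ⟨γ, hγ, hγy⟩ := (h.eq_iff _ _).1 hym'
  have hv := hR.exists_sub_mem hP hm hγ hγy.symm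
  obtain ⟨b, -, δ, hδ, hav⟩ := mem_iInter₂.1 (mem_iInter₂.1 hξ L ⟨⟨R, hR⟩, hL⟩) (P y) hv
  have hε : 0 < min c' (c' * δ) := by positivity
  obtain ⟨_, ⟨k, rfl⟩, hk⟩ := Metric.mem_closure_iff.1 hy _ hε
  have hk' : dist (pr (R^[k] (s b ξ))) (pr y) < min c' (c' * δ) := by
    rw [← hiter, hs, dist_comm]; exact hk
  obtain ⟨γ', hγ', hlt⟩ := h.exists_lt _ _ _ hk'
  have h1 := hunif _ _ (hlt.le.trans (min_le_left _ _))
  have h2 := hav k _ ⟨γ', hγ', y, rfl, rfl⟩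
  rw [hR.iterate_apply_eq] at h1
  have h3 : c'⁻¹ * dist (R^[k] (s b ξ)) (γ' y) < δ := by
    rw [inv_mul_lt_iff₀ hc']
    exact hlt.trans_le (min_le_right _ _)
  linarith

end WinningSet

/-! ### Assembly for abstract orbit maps -/

section Assembly

-- A compact neighbourhood of `1` generates an open, hence closed, subgroup, which is everything by
-- connectedness. Its words of each length form compact sets.
open scoped Pointwise in
theorem sigmaCompactSpace_of_connectedSpace (G : Type*) [TopologicalSpace G] [Group G]
    [IsTopologicalGroup G] [WeaklyLocallyCompactSpace G] [ConnectedSpace G] :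
    SigmaCompactSpace G := by
  obtain ⟨K, hK, hK1⟩ := exists_compact_mem_nhds (1 : G)
  have hS : IsCompact (K ∪ K⁻¹) := hK.union hK.inv
  have hSpow : ∀ k : ℕ, IsCompact ((K ∪ K⁻¹) ^ k) := by
    intro k
    induction k with
    | zero => rw [pow_zero]; exact isCompact_singleton
    | succ k ih => rw [pow_succ]; exact ih.mul hS
  have hinv : (K ∪ K⁻¹)⁻¹ = K ∪ K⁻¹ := by rw [union_inv, inv_inv, union_comm]
  have hopen : IsOpen (Subgroup.closure K : Set G) :=
    Subgroup.isOpen_of_mem_nhds _ (Filter.mem_of_superset hK1 Subgroup.subset_closure)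
  have huniv : (Subgroup.closure K : Set G) = univ :=
    IsClopen.eq_univ ⟨Subgroup.isClosed_of_isOpen _ hopen, hopen⟩ ⟨1, one_mem _⟩
  rw [SigmaCompactSpace_iff_exists_compact_covering]
  refine ⟨fun k => (K ∪ K⁻¹) ^ k, hSpow, eq_univ_of_forall fun x => ?_⟩
  have hx : x ∈ Subgroup.closure K := by rw [← SetLike.mem_coe, huniv]; trivial
  rw [mem_iUnion]
  induction hx using Subgroup.closure_induction with
  | mem x hx => exact ⟨1, by rw [pow_one]; exact Or.inl hx⟩
  | one => exact ⟨0, by rw [pow_zero]; rfl⟩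
  | mul x y _ _ hx hy =>
    obtain ⟨a, ha⟩ := hx
    obtain ⟨b, hb⟩ := hy
    exact ⟨a + b, by rw [pow_add]; exact mul_mem_mul ha hb⟩
  | inv x _ hx =>
    obtain ⟨a, ha⟩ := hx
    refine ⟨a, ?_⟩
    rw [← hinv, inv_pow]
    exact Set.inv_mem_inv.2 ha

theorem HasBiLipschitzCharts.nontrivial {n : ℕ} (hn : 0 < n) {N : Type*} [MetricSpace N]
    [Nonempty N] (h : HasBiLipschitzCharts n N) : Nontrivial N := by
  obtain ⟨x⟩ := ‹Nonempty N›
  obtain ⟨c, hc, hx⟩ := h.exists_packing x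
  obtain ⟨ξ, -, hξ⟩ := hx.self_of_nhds c 2 hc le_rfl two_pos
  have h1 : 1 < 2 ^ n := Nat.one_lt_two_pow hn.ne'
  refine ⟨ξ ⟨0, by omega⟩, ξ ⟨1, h1⟩, dist_pos.1 (lt_of_lt_of_le ?_ (hξ _ _ (by simp)))⟩
  positivity

variable {N X : Type*} [MetricSpace N] [Group N] [IsTopologicalGroup N] [LocallyCompactSpace N]
  [ConnectedSpace N] [Group.IsNilpotent N] [MetricSpace X] [CompactSpace X]
  {Γ : Subgroup (Equiv.Perm N)} {pr : N → X}

theorem exists_isExceptional_isAlphaWinning {n : ℕ} (hn : 0 < n) (h : IsOrbitMetricMap Γ pr)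
    (hch : HasBiLipschitzCharts n N) (hLM : IsLocallyLipschitzMul N)
    (hfree : ∀ γ ∈ Γ, ∀ x, γ x = x → γ = 1)
    (hpd : ∀ K : Set N, IsCompact K → {γ | γ ∈ Γ ∧ (γ '' K ∩ K).Nonempty}.Finite)
    (haff : ∀ γ ∈ Γ, ∃ A : N ≃* N, ∃ c, ∀ x, γ x = A x * c)
    (hfin : ((rightTranslations N).subgroupOf Γ).FiniteIndex) (C : Set (X → X))
    (hC : ∀ f ∈ C, ∃ R : N ≃* N, (∀ x, ∀ γ ∈ Γ, ∃ γ' ∈ Γ, R (γ x) = γ' (R x)) ∧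
      HasHyperbolicAbelianization R ∧ ∀ x, f (pr x) = pr (R x)) :
    ∃ ν : ℝ, 0 < ν ∧ ν ≤ 1 / 2 ∧ ∃ S : Set X, IsExceptional C S ∧
      (∀ α : ℝ, 0 < α → α ≤ ν → IsAlphaWinning α S) ∧
      ∀ U : Set X, IsOpen U → U.Nonempty → dimH (S ∩ U) = n := by
  obtain ⟨K₀, hK₀, hK₀X⟩ := h.isOpenMap.exists_compact_subset_image h.surjective
    (isCompact_univ (X := X))
  have hK₀Γ : ∀ y, ∃ k ∈ K₀, ∃ γ ∈ Γ, y = γ k := fun y => by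
    obtain ⟨k, hk, hky⟩ := hK₀X (mem_univ (pr y))
    obtain ⟨γ, hγ, hγk⟩ := (h.eq_iff y k).1 hky.symm
    exact ⟨k, hk, γ, hγ, hγk.symm⟩
  obtain ⟨r, hr0, hr⟩ := h.exists_injectivityRadius hfree hpd hK₀ hK₀Γ
  obtain ⟨c, hc, hc1, r₀, hr₀, hpack⟩ := h.exists_packing hr0 hr hch hK₀ hK₀Γ
  have hcontΓ : ∀ γ ∈ Γ, Continuous γ := fun γ hγ =>
    (Isometry.of_dist_eq (h.isometry γ hγ)).continuous
  obtain ⟨K, hK, hKΛ⟩ := exists_isCompact_mul_translationLattice hfin hcontΓ hK₀ hK₀Γ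
  -- it suffices to find a winning set
  suffices H : ∃ ν : ℝ, 0 < ν ∧ ν ≤ 1 / 2 ∧ ∃ S : Set X,
      (∀ f ∈ C, ∀ x ∈ S, ∀ y ∈ closure (range fun k : ℕ => f^[k] x),
        y ∉ Function.periodicPts f) ∧ ∀ α : ℝ, 0 < α → α ≤ ν → IsAlphaWinning α S by
    obtain ⟨ν, hν, hν2, S, hS, hwin⟩ := H
    have hdim : ∀ U : Set X, IsOpen U → U.Nonempty → dimH (S ∩ U) = n := fun U hU hne =>
      le_antisymm (h.dimH_le hch _) ((hwin ν hν le_rfl).le_dimH_inter hν (by linarith) hn hc hc1 hr₀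
        hpack hU hne)
    have hX : Nonempty X := ⟨pr 1⟩
    refine ⟨ν, hν, hν2, S, ⟨?_, hS⟩, hwin, hdim⟩
    have h1 := hdim univ isOpen_univ univ_nonempty
    rw [inter_univ] at h1
    rw [nonempty_iff_ne_empty]
    rintro rfl
    rw [dimH_empty] at h1
    exact hn.ne (by exact_mod_cast h1)
  -- A model of the abelianization is supplied only by a member of `C`. If there is none, the whole
  -- space serves as the winning set.
  rcases C.eq_empty_or_nonempty with rfl | ⟨f₀, hf₀⟩
  · exact ⟨1 / 2, by norm_num, le_rfl, univ, by simp, fun α hα hα2 =>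
      isAlphaWinning_univ hα (by linarith)⟩
  obtain ⟨-, -, ⟨d, p, -, hcont, hsurj, hker, -, -⟩, -⟩ := hC f₀ hf₀
  have hσ : SigmaCompactSpace N := sigmaCompactSpace_of_connectedSpace N
  set P : N → EuclideanSpace ℝ (Fin d) := fun x => (p x).toAdd with hPdef
  have hmul : ∀ x y, P (x * y) = P x + P y := fun x y => by simp [P]
  have hPsurj : Function.Surjective P := fun v => by
    obtain ⟨x, hx⟩ := hsurj (Multiplicative.ofAdd v)
    exact ⟨x, by simp [P, hx]⟩
  -- Open mapping theorem for homomorphisms from a σ-compact group onto a Baire group.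
  have hopen : IsOpenMap P := by
    have hb : BaireSpace (Multiplicative (EuclideanSpace ℝ (Fin d))) :=
      inferInstanceAs (BaireSpace (EuclideanSpace ℝ (Fin d)))
    exact MonoidHom.isOpenMap_of_sigmaCompact p hsurj hcont
  have hPker : ∀ x, P x = 0 ↔ x ∈ commutator N := fun x => by
    rw [← hker, MonoidHom.mem_ker]
    exact Iff.rfl
  have hP : IsLatticeProjection Γ P :=
    { map_mul := hmul
      surjective := hPsurj
      apply_eq_zero_iff := hPker
      affine := haff
      finiteIndex := hfin
      finite_inter := fun r => finite_image_lattice_inter hmul hcont hPsurj hopen hPker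
        (finite_translationLattice_inter hpd) hK hKΛ (isCompact_closedBall 0 r)
      span_eq_top := span_image_eq_top_of_cocompact hmul hcont hPsurj hK hKΛ }
  -- A nontrivial nilpotent group differs from its commutator subgroup.
  have hV : Nontrivial (EuclideanSpace ℝ (Fin d)) := by
    by_contra hV
    rw [not_nontrivial_iff_subsingleton] at hV
    have := hch.nontrivial hn
    refine (Group.IsSolvable.commutator_lt_top_of_nontrivial N).ne (eq_top_iff.2 fun x _ => ?_)
    exact (hPker x).1 (Subsingleton.elim _ _)
  obtain ⟨ν, hν, hν2, hwin⟩ := isAlphaWinning_nonperiodicSet h hr0 hr hch hLM hK hKΛ hP hcont hopen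
  refine ⟨ν, hν, hν2, nonperiodicSet Γ pr P, fun f hf ξ hξ => ?_, hwin⟩
  obtain ⟨R, hR, ⟨d', p', L', hcont', hsurj', hker', hL', hhyp⟩, hfR⟩ := hC f hf
  -- Each map comes with its own model of the abelianization; its linear part is conjugated to the
  -- model fixed by `f₀`.
  obtain ⟨e, he⟩ := exists_linearEquiv_of_ker_eq (P' := fun x => (p' x).toAdd) hmul hcont hPsurj
    hopen (fun x y => by simp) hcont' (fun v => by
      obtain ⟨x, hx⟩ := hsurj' (Multiplicative.ofAdd v)
      exact ⟨x, by simp [hx]⟩) (fun x => by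
      rw [hPker, ← hker', MonoidHom.mem_ker]
      exact Iff.rfl)
  refine hξ R (e.symm.conj L') ⟨hR, fun x => ?_⟩ (hhyp.conj e.symm) f hfR
  rw [LinearEquiv.conj_apply]
  simp only [LinearMap.comp_apply, LinearEquiv.coe_coe, LinearEquiv.symm_symm]
  rw [he, ← hL', LinearEquiv.eq_symm_apply, he]

end Assembly

/-! ### The metric of an infranil manifold as an orbit metric -/

section InfranilMetric

variable {n : ℕ} {N : Type*} [TopologicalSpace N] [T2Space N]
  [ChartedSpace (EuclideanSpace ℝ (Fin n)) N] [Group N] [LieGroup (𝓡 n) ∞ N] [ConnectedSpace N]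

theorem isOrbitMetricMap_infranilMetric (Γ : Subgroup (Equiv.Perm N)) (hΓ : IsInfranilGroup n Γ)
    (g : ContMDiffRiemannianMetric (𝓡 n) ∞ (EuclideanSpace ℝ (Fin n))
      (fun x : N => TangentSpace (𝓡 n) x))
    (hg : ∀ γ ∈ Γ, PreservesMetric g γ) :
    @IsOrbitMetricMap N (InfranilManifold Γ) (lieGroupMetric g) (infranilMetric Γ hΓ g hg) Γ
      (Quotient.mk _) := by
  let _ : PseudoEMetricSpace N := lieGroupEDist g
  have _ : IsIsometricSMul Γ N := lieGroupEDist_smul Γ hΓ.affine g hg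
  let MN : MetricSpace N := lieGroupMetric g
  let MX : MetricSpace (InfranilManifold Γ) := infranilMetric Γ hΓ g hg
  have hdN : ∀ x y : N, MN.dist x y = ((lieGroupEDist g).edist x y).toReal := fun x y => rfl
  have hdX : ∀ a b : InfranilManifold Γ, MX.dist a b = (orbitEDist a b).toReal :=
    fun a b => rfl
  refine @IsOrbitMetricMap.mk N (InfranilManifold Γ) MN MX Γ _ Quotient.mk_surjective ?_ ?_ ?_ ?_
  · intro x y
    constructor
    · intro hxy
      obtain ⟨γ, hγ⟩ := Quotient.exact hxy
      exact ⟨γ, γ.2, hγ⟩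
    · rintro ⟨γ, hγ, rfl⟩
      exact Quotient.sound ⟨⟨γ, hγ⟩, rfl⟩
  · intro γ hγ x y
    rw [hdN, hdN]
    exact congrArg _ (edist_smul_left (⟨γ, hγ⟩ : Γ) x y)
  · intro x y
    rw [hdN, hdX]
    exact ENNReal.toReal_mono (lieGroupEDist_ne_top g x y) (orbitEDist_le x y)
  · intro x y c hc
    have hc0 : 0 < c := lt_of_le_of_lt ENNReal.toReal_nonneg hc
    have hne : orbitEDist (Quotient.mk _ x : InfranilManifold Γ) (Quotient.mk _ y) ≠ ⊤ :=
      ((orbitEDist_le x y).trans_lt (lieGroupEDist_ne_top g x y).lt_top).ne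
    rw [hdX, ← ENNReal.lt_ofReal_iff_toReal_lt hne, orbitEDist_lt_iff] at hc
    obtain ⟨z, hz, hlt⟩ := hc
    obtain ⟨γ, hγ⟩ := Quotient.exact hz
    refine ⟨γ, γ.2, ?_⟩
    have hγ' : (γ : Equiv.Perm N) y = z := hγ
    rw [hdN, hγ', ← ENNReal.lt_ofReal_iff_toReal_lt (lieGroupEDist_ne_top g x z)]
    exact hlt

end InfranilMetric

theorem theorem3 {n : ℕ} (hn : 0 < n) {N : Type*} [TopologicalSpace N] [T2Space N]
    [ChartedSpace (EuclideanSpace ℝ (Fin n)) N] [Group N] [LieGroup (𝓡 n) ∞ N]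
    [SimplyConnectedSpace N] [Group.IsNilpotent N]
    (Γ : Subgroup (Equiv.Perm N)) (hΓ : IsInfranilGroup n Γ)
    (g : ContMDiffRiemannianMetric (𝓡 n) ∞ (EuclideanSpace ℝ (Fin n))
      (fun x : N => TangentSpace (𝓡 n) x))
    (hg : ∀ γ ∈ Γ, PreservesMetric g γ) :
    letI : MetricSpace (InfranilManifold Γ) := infranilMetric Γ hΓ g hg
    ∃ ν : ℝ, 0 < ν ∧ ν ≤ 1 / 2 ∧ ∃ S : Set (InfranilManifold Γ),
      IsExceptional (hyperbolicEndomorphisms n Γ) S ∧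
      (∀ α : ℝ, 0 < α → α ≤ ν → IsAlphaWinning α S) ∧
      ∀ U : Set (InfranilManifold Γ), IsOpen U → U.Nonempty → dimH (S ∩ U) = n := by
  have hgrp : IsTopologicalGroup N := topologicalGroup_of_lieGroup (𝓡 n) ∞
  have hlc : LocallyCompactSpace N :=
    ChartedSpace.locallyCompactSpace (EuclideanSpace ℝ (Fin n)) N
  refine @exists_isExceptional_isAlphaWinning N (InfranilManifold Γ) (lieGroupMetric g) _ hgrp hlc
    inferInstance inferInstance (infranilMetric Γ hΓ g hg) hΓ.cocompact Γ (Quotient.mk _) n hn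
    (isOrbitMetricMap_infranilMetric Γ hΓ g hg) (hasBiLipschitzCharts_lieGroupMetric g)
    (isLocallyLipschitzMul_lieGroupMetric g) hΓ.free ?_ ?_ hΓ.finiteIndex
    (hyperbolicEndomorphisms n Γ) ?_
  · intro K hK
    have := hΓ.properlyDiscontinuous
    refine ((ProperlyDiscontinuousSMul.finite_disjoint_inter_image (Γ := Γ) hK hK).image
      Subtype.val).subset ?_
    rintro γ ⟨hγ, hne⟩
    exact ⟨⟨γ, hγ⟩, hne, rfl⟩
  · intro γ hγ
    obtain ⟨A, -, c, hc⟩ := hΓ.affine hγ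
    exact ⟨A, c, hc⟩
  · rintro ρ ⟨R, -, hR, hhyp, hρ⟩
    exact ⟨R, hR, hhyp, hρ⟩
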